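/- **Setting.** Let $Z_1,Z_2,\dots$ be i.i.d. with law $\mathscr D$ on a measurable space $\mathscr Z$, let $\mathbb E_{\hat{\mathscr D}}[f(Z)]=\frac1n\sum_{i\le n}f(Z_i)$, and let $x_1,x_2$ be fixed query points. *M-estimator.* Let $\Theta\subseteq\mathbb R^p$ and $m:\Theta\times\mathscr Z\to\mathbb R$, with $m(\theta,\cdot)$ measurable and $\mathscr D$-integrable for $\theta\in\Theta$ and $m(\cdot,z)$ twice continuously differentiable on the interior of $\Theta$ for every $z$. For every $n\ge1$, almost surely, $\hat\theta=\hat\theta_n(Z_1,\dots,Z_n)$ maximizes $\mathbb E_{\hat{\mathscr D}}[m(\theta,Z)]$ over $\theta\in\Theta$. Let $\theta_0$ be an interior point of $\Theta$ and assume: - $\sup_{\theta\in\Theta}|\mathbb E_{\hat{\mathscr D}}[m(\theta,Z)]-\mathbb E_{\mathscr D}[m(\theta,Z)]|\to0$ in probability; - $\sup_{\theta\in\Theta,\|\theta-\theta_0\|\ge\epsilon}\mathbb E_{\mathscr D}[m(\theta,Z)]<\mathbb E_{\mathscr D}[m(\theta_0,Z)]$ for every $\epsilon>0$; - $\nabla_\theta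 m(\theta_0,\cdot)\in L^2(\mathscr D)$; there are $h\in L^1(\mathscr D)$ and a neighbourhood $U$ of $\theta_0$ such that, for $\mathscr D$-almost every $z$, $\|\nabla^2_\theta m(\theta,z)\|\le h(z)$ for all $\theta\in U$; and $\mathbb E_{\mathscr D}[\nabla_\theta^2m(\theta_0,Z)]$ is invertible. The prediction $\eta(\theta,x_1)$ is continuously differentiable in $\theta$ on the interior of $\Theta$, and for some $N$ the family $\{n(\eta(\hat\theta_n,x_1)-\eta(\theta_0,x_1))^2\}_{n\ge N}$ is uniformly integrable. Its directional derivatives are $$U_i(x_1)=-\nabla_\theta\eta(\hat\theta,x_1)^\top\big(\mathbb E_{\hat{\mathscr D}}[\nabla^2_\theta m(\hat\theta,Z)]\big)^{-1}\nabla_\theta m(\hat\theta,Z_i),$$ where the inverse of a singular matrix is read as $0$. *Forest.* For subsample sizes $k=k_n\ge1$ let $T(x_2;z_1,\dots,z_k)$ be a measurable, symmetric, square-integrable tree kernel. Let $\hat F(x_2)$ be the average of $T(x_2;\cdot)$ over all size-$k$ subsamples (without replacement) of $Z_1,\dots,Z_n$. Let $U_i'(x_2)=n\,\mathrm{cov}_b(N_{i,b},T_b(x_2))$,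 where $b$ is a uniformly random such subsample, $N_{i,b}$ is the number of times $Z_i$ is in it, and $T_b$ is the tree trained on it. With $T_1(x_2;z)=\mathbb E[T(x_2;Z_1,\dots,Z_k)\mid Z_1=z]-\mathbb E[T]$, the first Hájek projection of the forest is $\mathring F(x_2)=\mathbb E[T]+\frac kn\sum_{j=1}^nT_1(x_2;Z_j)$. Let $$\zeta_{c,k}=\mathrm{cov}\big(T(x_2;Z_1,\dots,Z_k),\,T(x_2;Z_1,\dots,Z_c,Z'_{c+1},\dots,Z'_k)\big),$$ with $Z'_j$ independent copies. Assume either $k_n/n\to0$ and $k_n\zeta_{1,k_n}/\zeta_{k_n,k_n}$ converges to a nonzero limit, or the weaker condition that $\zeta_{1,k_n}\ne0$ eventually and $\frac{k_n}n\cdot\frac{\zeta_{k_n,k_n}}{k_n\zeta_{1,k_n}}\to0$. **Claim.** Let $\hat C_n=\frac1{n^2}\sum_{i=1}^nU_i(x_1)U_i'(x_2)$ be the IJ covariance estimate and $r_n=\sqrt n/\sqrt{\mathrm{Var}\,\hat F(x_2)}$. For $G=\hat F(x_2)$ and for its Hájek projection $G=\mathring F(x_2)$: 1. $r_n\big(\hat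 C_n-\mathrm{cov}(\eta(\hat\theta,x_1),G)\big)\to0$ in probability. That is, the IJ estimate of the covariance between $\sqrt n\,\eta(\hat\theta,x_1)$ and the forest standardized by its standard deviation is consistent. 2. If $\zeta_{k_n,k_n}$ is bounded above, then $\hat C_n-\mathrm{cov}(\eta(\hat\theta,x_1),G)\to0$ in probability. 3. If the family $\{r_n\hat C_n\}_{n\ge N'}$ is uniformly integrable for some $N'$, then $r_n\big(\mathbb E[\hat C_n]-\mathrm{cov}(\eta(\hat\theta,x_1),G)\big)\to0$. If moreover $\zeta_{k_n,k_n}$ is bounded above, then $\mathbb E[\hat C_n]-\mathrm{cov}(\eta(\hat\theta,x_1),G)\to0$. -/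

import Mathlib

open MeasureTheory ProbabilityTheory Filter Topology

noncomputable section

namespace IJack

/-- Empirical mean of `f` over the sample `z`. -/
def empMean {S F : Type*} [AddCommGroup F] [Module ℝ F] {n : ℕ} (z : Fin n → S) (f : S → F) : F :=
  (n : ℝ)⁻¹ • ∑ i, f (z i)

/-- The first `n` observations of the data sequence `Z`. -/
def sample {Ω S : Type*} (Z : ℕ → Ω → S) (n : ℕ) (ω : Ω) : Fin n → S := fun i => Z i ω

section MEstimator

variable {S X : Type*} {p : ℕ}

/-- `∇_θ m(θ, z)`. -/
def grad (m : EuclideanSpace ℝ (Fin p) → S → ℝ) (θ : EuclideanSpace ℝ (Fin p)) (z : S) :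
    EuclideanSpace ℝ (Fin p) :=
  gradient (fun t => m t z) θ

/-- `∇²_θ m(θ, z)`, as a linear map. -/
def hess (m : EuclideanSpace ℝ (Fin p) → S → ℝ) (θ : EuclideanSpace ℝ (Fin p)) (z : S) :
    EuclideanSpace ℝ (Fin p) →L[ℝ] EuclideanSpace ℝ (Fin p) :=
  fderiv ℝ (fun t => grad m t z) θ

/-- Directional derivative of the M-estimator prediction at `x`, with fitted parameter `θ`:
`U_i(x) = - ∇_θ η(θ, x)ᵀ [(1/n) ∑_k ∇²_θ m(θ, z_k)]⁻¹ ∇_θ m(θ, z_i)`. -/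
def mestDirDeriv (m : EuclideanSpace ℝ (Fin p) → S → ℝ) (η : EuclideanSpace ℝ (Fin p) → X → ℝ)
    (x : X) {n : ℕ} (z : Fin n → S) (θ : EuclideanSpace ℝ (Fin p)) (i : Fin n) : ℝ :=
  - inner ℝ (gradient (fun t => η t x) θ)
      ((empMean z (hess m θ)).inverse (grad m θ (z i)))

end MEstimator

section Forest

variable {S : Type*}

/-- Mean over a uniformly random ordered subsample of size `k`, without replacement,
of `n` indices. -/
def subsampleMean {n k : ℕ} (f : (Fin k ↪ Fin n) → ℝ) : ℝ :=
  (∑ s, f s) / Fintype.card (Fin k ↪ Fin n)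

/-- The subsampled forest built from the tree kernel `T`: the average of the trees
over all subsamples of size `k`. -/
def forest {n k : ℕ} (T : (Fin k → S) → ℝ) (z : Fin n → S) : ℝ :=
  subsampleMean fun s : Fin k ↪ Fin n => T fun j => z (s j)

/-- Number of times observation `i` is in the subsample `s`. -/
def inbag {n k : ℕ} (i : Fin n) (s : Fin k ↪ Fin n) : ℝ :=
  ∑ j, if s j = i then 1 else 0

/-- Directional derivative of the forest: `n` times the covariance, over the subsamples,
of the in-bag count of observation `i` and the tree. -/
def forestDirDeriv {n k : ℕ} (T : (Fin k → S) → ℝ) (z : Fin n → S) (i : Fin n) : ℝ :=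
  n * (subsampleMean (fun s : Fin k ↪ Fin n => inbag i s * T fun j => z (s j))
    - subsampleMean (fun s : Fin k ↪ Fin n => inbag i s)
      * subsampleMean (fun s : Fin k ↪ Fin n => T fun j => z (s j)))

variable [MeasurableSpace S]

/-- `ζ_{c,k} = cov(T(Z_1, …, Z_k), T(Z_1, …, Z_c, Z'_{c+1}, …, Z'_k))`. -/
def zeta (D : Measure S) {k : ℕ} (T : (Fin k → S) → ℝ) (c : ℕ) : ℝ :=
  cov[fun w => T w.1, fun w => T fun j => if (j : ℕ) < c then w.1 j else w.2 j;
    (Measure.pi fun _ : Fin k => D).prod (Measure.pi fun _ : Fin k => D)]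

/-- `E[T]` for `k` independent observations from `D`. -/
def treeMean (D : Measure S) {k : ℕ} (T : (Fin k → S) → ℝ) : ℝ :=
  ∫ w, T w ∂(Measure.pi fun _ : Fin k => D)

/-- `T_1(a) = E[T(Z_1, …, Z_k) | Z_1 = a] - E[T]`. -/
def treeProj (D : Measure S) {k : ℕ} (T : (Fin k → S) → ℝ) (a : S) : ℝ :=
  (∫ w, T (fun j => if (j : ℕ) = 0 then a else w j) ∂(Measure.pi fun _ : Fin k => D))
    - treeMean D T

/-- First Hájek projection of the forest: `E[T] + (k/n) ∑_j T_1(z_j)`. -/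
def hajekForest (D : Measure S) {n k : ℕ} (T : (Fin k → S) → ℝ) (z : Fin n → S) : ℝ :=
  treeMean D T + (k : ℝ) / n * ∑ j, treeProj D T (z j)

end Forest

/-- The IJ covariance estimate `(1/n²) ∑_i U_i(x₁) U'_i(x₂)` of the M-estimator prediction
at `x₁` and the forest with tree kernel `T = T(x₂; ·)`. -/
def ijCov {S X : Type*} {p : ℕ}
    (m : EuclideanSpace ℝ (Fin p) → S → ℝ) (η : EuclideanSpace ℝ (Fin p) → X → ℝ) (x₁ : X)
    {n k : ℕ} (T : (Fin k → S) → ℝ) (z : Fin n → S) (θ : EuclideanSpace ℝ (Fin p)) : ℝ :=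
  1 / (n : ℝ) ^ 2 * ∑ i, mestDirDeriv m η x₁ z θ i * forestDirDeriv T z i

end IJack

end

open MeasureTheory ProbabilityTheory Filter Topology

noncomputable section

set_option linter.unusedSectionVars false

namespace IJack

/-! At the scale `r_n` the estimate and the covariance are both close to one bounded deterministic
sequence. Let `ψ` be the influence function of the prediction, `τ_n = T₁/√ζ_{1,k}` the standardized
first projection of the tree, and `ρ_n = k √ζ_{1,k} / (√n · sd F̂)`, the ratio of the standard
deviations of the Hájek projection and the forest, which is eventually at most 1. The common
sequence is `ρ_n ∫ ψ τ_n dD`.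

Forest. The covariance of two trees depends only on how many observations they share, and expands
over the subsets of the shared set into variances of Hoeffding components, which are nonnegative
(`zetaDiff_nonneg`). In `U'_i` the first-order component contributes `k T₁(Z_i)`, up to centring and
a factor tending to 1 (`forestDirDeriv_sample`). All higher components together have second moments
summing over `i` to at most `4 k² ζ_{k,k}` (`sum_integral_forestResid_sq_le`); this is negligible
because `ζ_{k,k}/(n ζ_{1,k}) → 0`.

M-estimator. Consistency puts the estimator in the interior, where the score vanishes. Linearizing
the score gives `√n (η̂ - η₀ - mean ψ) → 0` in probability (`tendsto_delta`), and the average of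
`(U_i - ψ(Z_i))²` tends to 0 (`tendsto_mean_sq_dirDeriv`). So `r_n Ĉ_n` is asymptotically `ρ_n`
times the empirical mean of `ψ τ_n`. As `τ_n` changes with `n`, a law of large numbers for a
triangular array is needed (`tendsto_empMean_mul`); truncating the fixed factor `ψ` suffices.

Covariance. Uniform integrability upgrades the delta method to `L²`
(`tendsto_integral_linearization_sq`). The prediction may then be replaced by `mean ψ`, with an
error controlled by Cauchy–Schwarz and `Var G ≤ Var F̂`. The covariance of `mean ψ` with `G` is
`(k/n) ∫ T₁ ψ` for the forest and for its projection alike.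

The unscaled claims follow because `r_n → ∞` when `ζ_{k,k}` is bounded above, and the claims on
expectations follow from Vitali's theorem (`consistency_of_scaled`). -/

/-- `Z 0, Z 1, …` are independent with common law `D`. -/
structure IsIID {Ω S : Type*} [MeasurableSpace Ω] [MeasurableSpace S]
    (P : Measure Ω) (D : Measure S) (Z : ℕ → Ω → S) : Prop where
  measurable : ∀ i, Measurable (Z i)
  indep : iIndepFun Z P
  law : ∀ i, P.map (Z i) = D

/-- A measurable, symmetric, square-integrable kernel. -/
structure IsTreeKernel {S : Type*} [MeasurableSpace S] (D : Measure S) {k : ℕ}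
    (T : (Fin k → S) → ℝ) : Prop where
  measurable : Measurable T
  symm : ∀ (σ : Equiv.Perm (Fin k)) (w : Fin k → S), T (fun j => w (σ j)) = T w
  memLp : MemLp T 2 (Measure.pi fun _ : Fin k => D)

/-! ### Covariances of trees on overlapping index sets. -/

/-- The tree trained on the observations with indices `s`. -/
def tree {Ω S : Type*} (Z : ℕ → Ω → S) {k : ℕ} (T : (Fin k → S) → ℝ) (s : Fin k → ℕ) (ω : Ω) : ℝ :=
  T fun j => Z (s j) ω

/-- Two injective families of indices can be reordered so that they agree on an initial segment,
and are disjoint afterwards. -/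
lemma exists_aligned {k : ℕ} {s s' : Fin k → ℕ} (hs : s.Injective) (hs' : s'.Injective) :
    ∃ (σ σ' : Equiv.Perm (Fin k)) (e : Fin k ⊕ Fin k → ℕ), e.Injective ∧
      (∀ j, e (Sum.inl j) = s (σ j)) ∧
      ∀ j, s' (σ' j) = if (j : ℕ) < (Finset.univ.image s ∩ Finset.univ.image s').card
        then e (Sum.inl j) else e (Sum.inr j) := by
  classical
  set c := (Finset.univ.image s ∩ Finset.univ.image s').card with hc
  have hcard : (Finset.univ.filter fun j => s j ∈ Set.range s').card = c := by
    rw [hc, ← Finset.card_image_of_injective _ hs]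
    congr 1
    ext x
    simp only [Finset.mem_image, Finset.mem_filter, Finset.mem_univ, true_and, Finset.mem_inter,
      Set.mem_range]
    constructor
    · rintro ⟨j, ⟨j', h⟩, rfl⟩; exact ⟨⟨j, rfl⟩, ⟨j', h⟩⟩
    · rintro ⟨⟨j, rfl⟩, ⟨j', h⟩⟩; exact ⟨j, ⟨j', h⟩, rfl⟩
  have hck : c ≤ k := by
    rw [← hcard]; simpa using Finset.card_le_univ (Finset.univ.filter fun j => s j ∈ Set.range s')
  have hcard2 : Fintype.card {j : Fin k // (j : ℕ) < c}
      = Fintype.card {j : Fin k // s j ∈ Set.range s'} := by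
    rw [Fintype.card_subtype, Fintype.card_subtype, hcard, Fin.card_filter_val_lt]
    simp [hck]
  let e₀ := Fintype.equivOfCardEq hcard2
  let σ : Equiv.Perm (Fin k) := e₀.extendSubtype
  have hσ : ∀ j : Fin k, (j : ℕ) < c ↔ s (σ j) ∈ Set.range s' := fun j =>
    ⟨fun h => e₀.extendSubtype_mem j h, fun h => by
      by_contra h'
      exact e₀.extendSubtype_not_mem j h' h⟩
  choose f hf using fun j : {j : Fin k // (j : ℕ) < c} => (hσ j).1 j.2
  -- The value for `j ≥ c` is a dummy: only the injection on the first `c` positions is extended to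
  -- a permutation.
  let f' : Fin k → Fin k := fun j => if h : (j : ℕ) < c then f ⟨j, h⟩ else j
  have hf' : ∀ j : Fin k, (j : ℕ) < c → s' (f' j) = s (σ j) := fun j h => by
    simp only [f', h, dif_pos]; exact hf ⟨j, h⟩
  obtain ⟨g, hg⟩ := Finset.exists_equiv_extend_of_card_eq (α := Fin k) (t := Finset.univ)
    (by simp) (s := Finset.univ.filter fun j : Fin k => (j : ℕ) < c) (f := f')
    (Finset.subset_univ _) (by
      intro a ha b hb hab
      have ha' : (a : ℕ) < c := by simpa using ha
      have hb' : (b : ℕ) < c := by simpa using hb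
      apply σ.injective
      apply hs
      rw [← hf' a ha', ← hf' b hb', hab])
  let σ' : Equiv.Perm (Fin k) := g.trans (Equiv.subtypeUnivEquiv (fun x => Finset.mem_univ x))
  have hσ' : ∀ j : Fin k, (j : ℕ) < c → s' (σ' j) = s (σ j) := fun j h => by
    rw [← hf' j h]
    congr 1
    exact hg j (by simpa using h)
  -- `M` exceeds every index in use, so the numbers `M + j` can fill the slots `Sum.inr j` with `j <
  -- c`. The second tree never reads these slots, but `e` has to be injective.
  let M : ℕ := (∑ j, s j) + (∑ j, s' j) + 1
  have hM : ∀ j, s j < M := fun j => by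
    have := Finset.single_le_sum (f := s) (fun _ _ => Nat.zero_le _) (Finset.mem_univ j)
    omega
  have hM' : ∀ j, s' j < M := fun j => by
    have := Finset.single_le_sum (f := s') (fun _ _ => Nat.zero_le _) (Finset.mem_univ j)
    omega
  refine ⟨σ, σ', Sum.elim (fun j => s (σ j)) (fun j => if (j : ℕ) < c then M + j else s' (σ' j)),
    ?_, fun j => rfl, ?_⟩
  · have key : ∀ a b : Fin k, s (σ a) ≠ if (b : ℕ) < c then M + b else s' (σ' b) := by
      intro a b h
      split_ifs at h with hb
      · have := hM (σ a); omega
      · have ha : (a : ℕ) < c := (hσ a).2 ⟨_, h.symm⟩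
        rw [← hσ' a ha] at h
        exact hb (σ'.injective (hs' h) ▸ ha)
    rintro (a | a) (b | b) h
    · simpa using σ.injective (hs h)
    · exact absurd h (key a b)
    · exact absurd h.symm (key b a)
    · simp only [Sum.elim_inr] at h
      congr 1
      split_ifs at h with ha hb hb
      · ext; omega
      · have := hM' (σ' b); omega
      · have := hM' (σ' a); omega
      · exact σ'.injective (hs' h)
  · intro j
    by_cases h : (j : ℕ) < c
    · simp [h, hσ' j h]
    · simp [h]

section

variable {Ω S : Type*} [MeasurableSpace Ω] [MeasurableSpace S] {P : Measure Ω}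
  [IsProbabilityMeasure P] {D : Measure S} [IsProbabilityMeasure D] {Z : ℕ → Ω → S}
  {k : ℕ} {T : (Fin k → S) → ℝ}

lemma IsIID.measurePreserving_pi (hZ : IsIID P D Z) {ι : Type*} [Fintype ι] {e : ι → ℕ}
    (he : e.Injective) :
    MeasurePreserving (fun ω i => Z (e i) ω) P (Measure.pi fun _ : ι => D) := by
  refine ⟨measurable_pi_lambda _ fun i => hZ.measurable _, ?_⟩
  have := (iIndepFun_iff_map_fun_eq_pi_map (μ := P) (f := fun i => Z (e i))
    (fun i => (hZ.measurable _).aemeasurable)).1 (hZ.indep.precomp he)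
  rw [this]
  simp [hZ.law]

lemma IsIID.measurePreserving (hZ : IsIID P D Z) (i : ℕ) : MeasurePreserving (Z i) P D :=
  ⟨hZ.measurable i, hZ.law i⟩

/-- `zeta` lives on a product of two samples; an injective family indexed by a sum type realizes
that product inside the data sequence. -/
lemma IsIID.measurePreserving_prod (hZ : IsIID P D Z) {ι ι' : Type*} [Fintype ι] [Fintype ι']
    {e : ι ⊕ ι' → ℕ} (he : e.Injective) :
    MeasurePreserving (fun ω => (fun i => Z (e (Sum.inl i)) ω, fun i => Z (e (Sum.inr i)) ω)) P
      ((Measure.pi fun _ : ι => D).prod (Measure.pi fun _ : ι' => D)) :=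
  (measurePreserving_sumPiEquivProdPi (fun _ : ι ⊕ ι' => D)).comp (hZ.measurePreserving_pi he)

lemma IsTreeKernel.memLp_tree (hT : IsTreeKernel D T) (hZ : IsIID P D Z) {s : Fin k → ℕ}
    (hs : s.Injective) : MemLp (tree Z T s) 2 P :=
  hT.memLp.comp_measurePreserving (hZ.measurePreserving_pi hs)

lemma IsTreeKernel.integral_tree (hT : IsTreeKernel D T) (hZ : IsIID P D Z) {s : Fin k → ℕ}
    (hs : s.Injective) : ∫ ω, tree Z T s ω ∂P = treeMean D T := by
  have h := hZ.measurePreserving_pi hs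
  rw [treeMean, ← h.map_eq, integral_map h.measurable.aemeasurable
    hT.measurable.aestronglyMeasurable]
  rfl

lemma IsTreeKernel.tree_perm (hT : IsTreeKernel D T) (s : Fin k → ℕ) (σ : Equiv.Perm (Fin k)) :
    tree Z T (fun j => s (σ j)) = tree Z T s := by
  ext ω
  exact hT.symm σ fun j => Z (s j) ω

/-- The covariance of two trees depends only on the number of shared observations. -/
lemma IsTreeKernel.covariance_tree (hT : IsTreeKernel D T) (hZ : IsIID P D Z) {s s' : Fin k → ℕ}
    (hs : s.Injective) (hs' : s'.Injective) :
    cov[tree Z T s, tree Z T s'; P]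
      = zeta D T (Finset.univ.image s ∩ Finset.univ.image s').card := by
  obtain ⟨σ, σ', e, he, h1, h2⟩ := exists_aligned hs hs'
  have hmp := hZ.measurePreserving_prod he
  rw [zeta, ← hmp.map_eq, covariance_map_fun, ← hT.tree_perm s σ, ← hT.tree_perm s' σ']
  · congr 1
    · ext ω; simp only [tree, h1]
    · ext ω
      simp only [tree, h2]
      congr 1
      ext j
      split_ifs <;> rfl
  · exact (hT.measurable.comp measurable_fst).aestronglyMeasurable
  · refine (hT.measurable.comp (measurable_pi_lambda _ fun j => ?_)).aestronglyMeasurable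
    split_ifs
    · exact (measurable_pi_apply j).comp measurable_fst
    · exact (measurable_pi_apply j).comp measurable_snd
  · exact hmp.measurable.aemeasurable

end

/-! ### The first-order projection of the tree. -/

lemma sq_integral_le_integral_sq {Ω : Type*} [MeasurableSpace Ω] {P : Measure Ω}
    [IsProbabilityMeasure P] {f : Ω → ℝ} (hf : MemLp f 2 P) :
    (∫ ω, f ω ∂P) ^ 2 ≤ ∫ ω, f ω ^ 2 ∂P := by
  have h := variance_eq_sub hf
  have h' := variance_nonneg f P
  simp only [Pi.pow_apply] at h
  linarith

/-- Conditional expectation given the first factor of a product is square-integrable. -/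
lemma MemLp.integral_prod_two {α β : Type*} [MeasurableSpace α] [MeasurableSpace β]
    {μ : Measure α} {ν : Measure β} [IsProbabilityMeasure μ] [IsProbabilityMeasure ν]
    {f : α × β → ℝ} (hf : MemLp f 2 (μ.prod ν)) : MemLp (fun a => ∫ b, f (a, b) ∂ν) 2 μ := by
  have hsq : Integrable (fun x => f x ^ 2) (μ.prod ν) := hf.integrable_sq
  have hint := hf.integrable (by norm_num)
  have hmeas := hint.1.integral_prod_right'
  rw [memLp_two_iff_integrable_sq hmeas]
  refine hsq.integral_prod_left.mono' (hmeas.pow 2) ?_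
  -- Jensen's inequality on almost every fibre.
  filter_upwards [hsq.prod_right_ae, hint.prod_right_ae] with a ha ha'
  rw [Real.norm_of_nonneg (sq_nonneg _)]
  exact sq_integral_le_integral_sq ((memLp_two_iff_integrable_sq ha'.1).2 ha)

section

variable {Ω S : Type*} [MeasurableSpace Ω] [MeasurableSpace S] {P : Measure Ω}
  [IsProbabilityMeasure P] {D : Measure S} [IsProbabilityMeasure D] {Z : ℕ → Ω → S}
  {k : ℕ} {T : (Fin k → S) → ℝ}

/-- Replacing the first coordinate by an independent copy preserves the product law. -/
lemma IsIID.measurePreserving_cons (hZ : IsIID P D Z) (k : ℕ) :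
    MeasurePreserving (fun x : S × (Fin k → S) => fun j : Fin k => if (j : ℕ) = 0 then x.1 else x.2 j)
      (D.prod (Measure.pi fun _ => D)) (Measure.pi fun _ => D) := by
  have hmeas : Measurable
      (fun x : S × (Fin k → S) => fun j : Fin k => if (j : ℕ) = 0 then x.1 else x.2 j) := by
    refine measurable_pi_lambda _ fun j => ?_
    split_ifs
    · exact measurable_fst
    · exact (measurable_pi_apply j).comp measurable_snd
  refine ⟨hmeas, ?_⟩
  -- The data sequence serves as a model of both laws: `Z 0` supplies the new first coordinate and
  -- `Z (j + 1)` the coordinate `j`. The composite map reads the indices 0, 2, 3, …, and `Z 1`, the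
  -- replaced coordinate, is never used.
  have he : Function.Injective (Sum.elim (fun _ : Unit => 0) (fun j : Fin k => (j : ℕ) + 1)) := by
    rintro (a | a) (b | b) h <;> simp at h ⊢
    exact Fin.ext h
  have h1 := hZ.measurePreserving_prod he
  have h2 := ((measurePreserving_funUnique D Unit).prod
    (MeasurePreserving.id (Measure.pi fun _ : Fin k => D))).comp h1
  have he' : Function.Injective (fun j : Fin k => if (j : ℕ) = 0 then 0 else (j : ℕ) + 1) := by
    intro a b h
    ext
    simp only at h
    split_ifs at h <;> omega
  have h3 := hZ.measurePreserving_pi he'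
  rw [← h2.map_eq, Measure.map_map hmeas h2.measurable, ← h3.map_eq]
  congr 1
  ext ω j
  by_cases hj : (j : ℕ) = 0 <;> simp [hj, MeasurableEquiv.funUnique]

lemma IsTreeKernel.memLp_cons (hT : IsTreeKernel D T) (hZ : IsIID P D Z) :
    MemLp (fun x : S × (Fin k → S) => T fun j => if (j : ℕ) = 0 then x.1 else x.2 j) 2
      (D.prod (Measure.pi fun _ => D)) :=
  hT.memLp.comp_measurePreserving (hZ.measurePreserving_cons k)

lemma IsTreeKernel.memLp_treeProj (hT : IsTreeKernel D T) (hZ : IsIID P D Z) :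
    MemLp (treeProj D T) 2 D :=
  (MemLp.integral_prod_two (hT.memLp_cons hZ)).sub (memLp_const _)

/-- The defining property of the conditional expectation given the first observation: Fubini, after
that coordinate is split off by `measurePreserving_cons`. The index `j₀` also records that `k` is
positive. -/
lemma IsTreeKernel.integral_mul_apply_zero (hT : IsTreeKernel D T) (hZ : IsIID P D Z)
    {g : S → ℝ} (hg : MemLp g 2 D) {j₀ : Fin k} (hj₀ : (j₀ : ℕ) = 0) :
    ∫ w, T w * g (w j₀) ∂(Measure.pi fun _ => D) = ∫ a, (treeProj D T a + treeMean D T) * g a ∂D := by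
  have hmp := hZ.measurePreserving_cons k
  have hmeas : AEStronglyMeasurable (fun w : Fin k → S => T w * g (w j₀))
      (Measure.pi fun _ => D) :=
    hT.measurable.aestronglyMeasurable.mul
      (hg.1.comp_measurePreserving (measurePreserving_eval (fun _ : Fin k => D) j₀))
  conv_lhs => rw [← hmp.map_eq]
  rw [integral_map hmp.measurable.aemeasurable (by rwa [hmp.map_eq])]
  simp only [hj₀, if_true]
  rw [integral_prod]
  · simp only [integral_mul_const, treeProj, sub_add_cancel]
  · exact (hT.memLp_cons hZ).integrable_mul (hg.comp_measurePreserving measurePreserving_fst)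

lemma IsTreeKernel.integral_treeProj (hT : IsTreeKernel D T) (hZ : IsIID P D Z) (hk : 1 ≤ k) :
    ∫ a, treeProj D T a ∂D = 0 := by
  have h := hT.integral_mul_apply_zero hZ (memLp_const (1 : ℝ)) (j₀ := ⟨0, hk⟩) rfl
  simp only [mul_one] at h
  rw [integral_add ((hT.memLp_treeProj hZ).integrable (by norm_num)) (integrable_const _)] at h
  simpa [treeMean] using h

/-- If `i` is in the subsample, symmetry of the kernel moves it to slot 0, where conditioning on it
produces `treeProj`; otherwise the tree and `Z i` are independent. -/
lemma IsTreeKernel.covariance_tree_comp (hT : IsTreeKernel D T) (hZ : IsIID P D Z)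
    {g : S → ℝ} (hg : MemLp g 2 D) {s : Fin k → ℕ} (hs : s.Injective) (i : ℕ) :
    cov[tree Z T s, fun ω => g (Z i ω); P]
      = if i ∈ Finset.univ.image s then ∫ a, treeProj D T a * g a ∂D else 0 := by
  have hgi : MemLp (fun ω => g (Z i ω)) 2 P := hg.comp_measurePreserving (hZ.measurePreserving i)
  split_ifs with hi
  · obtain ⟨j, -, hj⟩ := Finset.mem_image.1 hi
    have hk : 0 < k := j.pos
    let j₀ : Fin k := ⟨0, hk⟩
    let s₁ : Fin k → ℕ := fun l => s (Equiv.swap j₀ j l)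
    have hs₁ : s₁.Injective := hs.comp (Equiv.injective _)
    have hmp := hZ.measurePreserving_pi hs₁
    have h0 := hT.integral_mul_apply_zero hZ hg (j₀ := j₀) rfl
    rw [← hT.tree_perm s (Equiv.swap j₀ j), covariance_eq_sub (hT.memLp_tree hZ hs₁) hgi,
      hT.integral_tree hZ hs₁]
    have h1 : ∫ ω, (tree Z T s₁ * fun ω => g (Z i ω)) ω ∂P
        = ∫ w, T w * g (w j₀) ∂(Measure.pi fun _ => D) := by
      rw [← hmp.map_eq, integral_map hmp.measurable.aemeasurable]
      · simp [tree, s₁, hj]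
      · rw [hmp.map_eq]
        exact hT.measurable.aestronglyMeasurable.mul
          (hg.1.comp_measurePreserving (measurePreserving_eval (fun _ : Fin k => D) j₀))
    have h2 : ∫ ω, g (Z i ω) ∂P = ∫ a, g a ∂D := by
      rw [← hZ.law i, integral_map (hZ.measurable i).aemeasurable (by rw [hZ.law i]; exact hg.1)]
    have hti : Integrable (fun a => treeProj D T a * g a) D :=
      (hT.memLp_treeProj hZ).integrable_mul hg
    rw [h1, h0, h2]
    simp only [add_mul]
    rw [integral_add hti ((hg.integrable (by norm_num)).const_mul _), integral_const_mul]
    ring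
  · have he : Function.Injective (Sum.elim s (fun _ : Unit => i)) := by
      rintro (a | a) (b | b) h
      · simpa using hs h
      · exact absurd (Finset.mem_image.2 ⟨a, Finset.mem_univ _, h⟩) hi
      · exact absurd (Finset.mem_image.2 ⟨b, Finset.mem_univ _, h.symm⟩) hi
      · rfl
    have hmp := hZ.measurePreserving_prod he
    have hg' : MemLp (fun x : Unit → S => g (x ())) 2 (Measure.pi fun _ => D) :=
      hg.comp_measurePreserving (measurePreserving_eval (fun _ : Unit => D) ())
    have h := covariance_fst_snd_prod hT.memLp hg'
    rw [← hmp.map_eq, covariance_map_fun] at h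
    · exact h
    · rw [hmp.map_eq]; exact hT.memLp.1.comp_fst
    · rw [hmp.map_eq]; exact hg'.1.comp_snd
    · exact hmp.measurable.aemeasurable

lemma IsIID.covariance_comp (hZ : IsIID P D Z) {f g : S → ℝ} (hf : MemLp f 2 D) (hg : MemLp g 2 D)
    (i j : ℕ) : cov[fun ω => f (Z i ω), fun ω => g (Z j ω); P] = if i = j then cov[f, g; D] else 0 := by
  split_ifs with h
  · subst h
    rw [← hZ.law i, covariance_map_fun]
    · rw [hZ.law i]; exact hf.1
    · rw [hZ.law i]; exact hg.1
    · exact (hZ.measurable i).aemeasurable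
  · refine IndepFun.covariance_eq_zero ?_ (hf.comp_measurePreserving (hZ.measurePreserving i))
      (hg.comp_measurePreserving (hZ.measurePreserving j))
    exact (hZ.indep.indepFun h).comp₀ (hZ.measurable i).aemeasurable (hZ.measurable j).aemeasurable
      (by rw [hZ.law i]; exact hf.1.aemeasurable) (by rw [hZ.law j]; exact hg.1.aemeasurable)

lemma IsTreeKernel.covariance_treeProj (hT : IsTreeKernel D T) (hZ : IsIID P D Z) (hk : 1 ≤ k)
    {g : S → ℝ} (hg : MemLp g 2 D) : cov[treeProj D T, g; D] = ∫ a, treeProj D T a * g a ∂D := by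
  rw [covariance_eq_sub (hT.memLp_treeProj hZ) hg, hT.integral_treeProj hZ hk]
  simp

lemma IsTreeKernel.zeta_zero (hT : IsTreeKernel D T) : zeta D T 0 = 0 := by
  simp only [zeta, Nat.not_lt_zero, if_false]
  exact covariance_fst_snd_prod hT.memLp hT.memLp

/-- Given the single shared observation the two trees are independent, so their covariance is the
variance of the conditional mean. -/
lemma IsTreeKernel.zeta_one (hT : IsTreeKernel D T) (hZ : IsIID P D Z) (hk : 1 ≤ k) :
    zeta D T 1 = ∫ a, treeProj D T a ^ 2 ∂D := by
  let j₀ : Fin k := ⟨0, hk⟩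
  let π : Measure (Fin k → S) := Measure.pi fun _ => D
  have hcons := hZ.measurePreserving_cons k
  have hmp : MeasurePreserving (fun w : (Fin k → S) × (Fin k → S) => (w.1 j₀, w.2)) (π.prod π)
      (D.prod π) :=
    (measurePreserving_eval (fun _ : Fin k => D) j₀).prod (MeasurePreserving.id π)
  have h1 : MemLp (fun w : (Fin k → S) × (Fin k → S) => T w.1) 2 (π.prod π) :=
    hT.memLp.comp_measurePreserving measurePreserving_fst
  have h2 : MemLp (fun w : (Fin k → S) × (Fin k → S) =>
      T fun j => if (j : ℕ) = 0 then w.1 j₀ else w.2 j) 2 (π.prod π) :=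
    (hT.memLp_cons hZ).comp_measurePreserving hmp
  have heq : (fun w : (Fin k → S) × (Fin k → S) => T fun j => if (j : ℕ) < 1 then w.1 j else w.2 j)
      = fun w => T fun j => if (j : ℕ) = 0 then w.1 j₀ else w.2 j := by
    ext w
    congr 1
    ext j
    by_cases hj : (j : ℕ) = 0
    · have : j = j₀ := Fin.ext hj
      simp [this, j₀]
    · simp [hj]
  have ht := hT.memLp_treeProj hZ
  have hti : Integrable (treeProj D T) D := ht.integrable (by norm_num)
  rw [zeta, heq, covariance_eq_sub h1 h2]
  have e1 : ∫ w : (Fin k → S) × (Fin k → S), T w.1 ∂(π.prod π) = treeMean D T :=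
    (integral_fun_fst (μ := π) (ν := π) T).trans (by simp [treeMean, π])
  have e2 : ∫ w : (Fin k → S) × (Fin k → S),
      (T fun j => if (j : ℕ) = 0 then w.1 j₀ else w.2 j) ∂(π.prod π) = treeMean D T := by
    have h := hcons.comp hmp
    rw [treeMean, ← h.map_eq, integral_map h.measurable.aemeasurable
      hT.measurable.aestronglyMeasurable]
    rfl
  have e3 : ∫ w : (Fin k → S) × (Fin k → S), ((fun w : (Fin k → S) × (Fin k → S) => T w.1) *
      fun w : (Fin k → S) × (Fin k → S) =>
        T fun j => if (j : ℕ) = 0 then w.1 j₀ else w.2 j) w ∂(π.prod π)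
      = ∫ a, (treeProj D T a + treeMean D T) * (treeProj D T a + treeMean D T) ∂D := by
    rw [← hT.integral_mul_apply_zero hZ (g := fun a => treeProj D T a + treeMean D T)
      (ht.add (memLp_const _)) (j₀ := j₀) rfl, integral_prod _ (h1.integrable_mul h2)]
    simp only [Pi.mul_apply, integral_const_mul, treeProj, sub_add_cancel]
    rfl
  rw [e1, e2, e3]
  have : ∀ a, (treeProj D T a + treeMean D T) * (treeProj D T a + treeMean D T)
      = treeProj D T a ^ 2 + (2 * treeMean D T * treeProj D T a + treeMean D T * treeMean D T) :=
    fun a => by ring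
  have hlin : Integrable (fun a => 2 * treeMean D T * treeProj D T a
      + treeMean D T * treeMean D T) D := (hti.const_mul _).add (integrable_const _)
  simp only [this]
  rw [integral_add ht.integrable_sq hlin,
    integral_add (hti.const_mul _) (integrable_const _), integral_const_mul,
    hT.integral_treeProj hZ hk]
  simp

end

/-! ### Hoeffding component variances and their nonnegativity. -/

/-- The finite differences at `0` of `c ↦ ζ_{c,k}`: the variances of the Hoeffding components. -/
def zetaDiff {S : Type*} [MeasurableSpace S] (D : Measure S) {k : ℕ} (T : (Fin k → S) → ℝ)
    (j : ℕ) : ℝ :=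
  (fwdDiff 1)^[j] (zeta D T) 0

/-- The sum factorizes over the elements of `J`: an element of `A` contributes `-1`, and an element
outside `A` contributes `-1 + 1 = 0`. -/
lemma sum_powerset_neg_one_pow_filter_superset {A J : Finset ℕ} (hA : A ⊆ J) :
    ∑ B ∈ J.powerset, (-1 : ℝ) ^ B.card * (if A ⊆ B then 1 else 0)
      = if A = J then (-1) ^ J.card else 0 := by
  classical
  have h := Finset.prod_add (fun _ : ℕ => (-1 : ℝ)) (fun i => if i ∈ A then 0 else 1) J
  have h1 : ∀ B ∈ J.powerset, (∏ i ∈ B, (-1 : ℝ)) * ∏ i ∈ J \ B, (if i ∈ A then (0 : ℝ) else 1)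
      = (-1 : ℝ) ^ B.card * (if A ⊆ B then 1 else 0) := by
    intro B hB
    rw [Finset.prod_const]
    congr 1
    split_ifs with hAB
    · refine Finset.prod_eq_one fun i hi => ?_
      rw [if_neg fun hiA => (Finset.mem_sdiff.1 hi).2 (hAB hiA)]
    · obtain ⟨i, hiA, hiB⟩ := Finset.not_subset.1 hAB
      exact Finset.prod_eq_zero (Finset.mem_sdiff.2 ⟨hA hiA, hiB⟩) (if_pos hiA)
  rw [← Finset.sum_congr rfl h1, ← h]
  split_ifs with hAJ
  · subst hAJ
    rw [← Finset.prod_const]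
    refine Finset.prod_congr rfl fun i hi => by simp [hi]
  · obtain ⟨i, hiJ, hiA⟩ := Finset.not_subset.1 fun hJA => hAJ (hA.antisymm hJA)
    exact Finset.prod_eq_zero hiJ (by simp [hiA])

/-- Applied to the variance of a sum of `N` variables with common pairwise covariance `v` and
variances at most `K`: for large `N` the covariance term dominates. -/
lemma nonneg_of_forall_quadratic {v K : ℝ} (h : ∀ N : ℕ, 0 ≤ (N : ℝ) * (N - 1) * v + N * K) :
    0 ≤ v := by
  by_contra! hv
  obtain ⟨N, hN⟩ := exists_nat_gt (K / -v)
  have h1 := h (N + 1)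
  push_cast at h1
  rw [div_lt_iff₀ (by linarith)] at hN
  have hN1 : (0 : ℝ) < N + 1 := by positivity
  have : 0 ≤ (N : ℝ) * v + K := by
    refine nonneg_of_mul_nonneg_right (a := (N : ℝ) + 1) ?_ hN1
    linarith
  linarith

section

variable {Ω S : Type*} [MeasurableSpace Ω] [MeasurableSpace S] {P : Measure Ω}
  [IsProbabilityMeasure P] {D : Measure S} [IsProbabilityMeasure D] {Z : ℕ → Ω → S}
  {k : ℕ} {T : (Fin k → S) → ℝ}

/-- Newton's forward difference formula, its binomial coefficients read as numbers of subsets. -/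
lemma zeta_card (D : Measure S) (T : (Fin k → S) → ℝ) {α : Type*} (A : Finset α) :
    zeta D T A.card = ∑ B ∈ A.powerset, zetaDiff D T B.card := by
  rw [Finset.sum_powerset_apply_card]
  have h := shift_eq_sum_fwdDiff_iter (1 : ℕ) (zeta D T) A.card 0
  simp only [smul_eq_mul, mul_one, zero_add] at h
  exact h

/-- Möbius inversion: after expansion by `zeta_card`, the two alternating sums annihilate every
subset `A` other than `J` itself. -/
lemma sum_neg_one_pow_mul_zeta_inter (D : Measure S) (T : (Fin k → S) → ℝ) (J : Finset ℕ) :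
    ∑ B ∈ J.powerset, ∑ B' ∈ J.powerset,
      (-1 : ℝ) ^ B.card * ((-1) ^ B'.card * zeta D T (B ∩ B').card) = zetaDiff D T J.card := by
  classical
  have h1 : ∀ B ∈ J.powerset, ∀ B' ∈ J.powerset, zeta D T (B ∩ B').card
      = ∑ A ∈ J.powerset, zetaDiff D T A.card * ((if A ⊆ B then 1 else 0) * if A ⊆ B' then 1 else 0) := by
    intro B hB B' hB'
    rw [zeta_card, ← Finset.sum_subset (s₁ := (B ∩ B').powerset) (s₂ := J.powerset)]
    · refine Finset.sum_congr rfl fun A hA => ?_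
      have := Finset.subset_inter_iff.1 (Finset.mem_powerset.1 hA)
      simp [this.1, this.2]
    · exact Finset.powerset_mono.2 (Finset.inter_subset_left.trans (Finset.mem_powerset.1 hB))
    · intro A _ hA
      rw [Finset.mem_powerset, Finset.subset_inter_iff, not_and_or] at hA
      rcases hA with hA | hA <;> simp [hA]
  have h2 : ∑ B ∈ J.powerset, ∑ B' ∈ J.powerset,
      (-1 : ℝ) ^ B.card * ((-1) ^ B'.card * zeta D T (B ∩ B').card)
      = ∑ A ∈ J.powerset, zetaDiff D T A.card *
        ((∑ B ∈ J.powerset, (-1 : ℝ) ^ B.card * (if A ⊆ B then 1 else 0)) *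
          ∑ B ∈ J.powerset, (-1 : ℝ) ^ B.card * (if A ⊆ B then 1 else 0)) := by
    simp_rw [Finset.sum_mul_sum, Finset.mul_sum]
    symm
    rw [Finset.sum_comm]
    refine Finset.sum_congr rfl fun B hB => ?_
    rw [Finset.sum_comm]
    refine Finset.sum_congr rfl fun B' hB' => ?_
    rw [h1 B hB B' hB', Finset.mul_sum, Finset.mul_sum]
    exact Finset.sum_congr rfl fun A _ => by ring
  rw [h2, Finset.sum_eq_single J]
  · rw [sum_powerset_neg_one_pow_filter_superset subset_rfl, if_pos rfl, ← mul_pow]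
    simp
  · intro A hA hAJ
    rw [sum_powerset_neg_one_pow_filter_superset (Finset.mem_powerset.1 hA), if_neg hAJ]
    simp
  · simp

/-- Shared indices in `B`, and fresh ones from block `l` elsewhere. -/
def blockIndex (k : ℕ) (B : Finset ℕ) (l : ℕ) (i : Fin k) : ℕ :=
  if (i : ℕ) ∈ B then i else k + l * k + i

lemma blockIndex_injective (k : ℕ) (B : Finset ℕ) (l : ℕ) : (blockIndex k B l).Injective := by
  intro a b h
  simp only [blockIndex] at h
  ext
  generalize l * k = m at h
  split_ifs at h <;> omega

lemma image_blockIndex_inter {k : ℕ} {B B' : Finset ℕ} (hB : B ⊆ Finset.range k)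
    (_hB' : B' ⊆ Finset.range k) {l l' : ℕ} (hl : l ≠ l') :
    Finset.univ.image (blockIndex k B l) ∩ Finset.univ.image (blockIndex k B' l') = B ∩ B' := by
  have key : ∀ a b : Fin k, l * k + a ≠ l' * k + b := by
    intro a b h
    have h1 : (l * k + a) / k = l := by
      rw [mul_comm, Nat.mul_add_div a.pos, Nat.div_eq_of_lt a.2, add_zero]
    have h2 : (l' * k + b) / k = l' := by
      rw [mul_comm, Nat.mul_add_div a.pos, Nat.div_eq_of_lt b.2, add_zero]
    exact hl (h1.symm.trans ((congrArg (· / k) h).trans h2))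
  ext x
  simp only [Finset.mem_inter, Finset.mem_image, Finset.mem_univ, true_and, blockIndex]
  constructor
  · rintro ⟨⟨a, ha⟩, ⟨b, hb⟩⟩
    have := key a b
    generalize l * k = m at *
    generalize l' * k = m' at *
    split_ifs at ha hb with h1 h2
    · exact ⟨ha ▸ h1, hb ▸ h2⟩
    · omega
    · omega
    · omega
  · rintro ⟨h1, h2⟩
    have := Finset.mem_range.1 (hB h1)
    exact ⟨⟨⟨x, this⟩, by simp [h1]⟩, ⟨⟨x, this⟩, by simp [h2]⟩⟩

/-- Let `X l` be the alternating sum, over subsets `B` of the first `j` indices, of trees that keep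
the observations in `B` and take fresh ones from block `l` elsewhere. Distinct `X l` have covariance
`zetaDiff D T j`, and their variances are bounded. A negative common covariance would make the
variance of a long sum of them negative. -/
lemma IsTreeKernel.zetaDiff_nonneg (hT : IsTreeKernel D T) (hZ : IsIID P D Z) {j : ℕ}
    (hj : j ≤ k) : 0 ≤ zetaDiff D T j := by
  classical
  let J := Finset.range j
  have hJ : ∀ B ∈ J.powerset, B ⊆ Finset.range k := fun B hB =>
    (Finset.mem_powerset.1 hB).trans (Finset.range_subset_range.2 hj)
  let X : ℕ → Ω → ℝ := fun l ω =>
    ∑ B ∈ J.powerset, (-1 : ℝ) ^ B.card * tree Z T (blockIndex k B l) ω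
  have hmem : ∀ B l, MemLp (fun ω => (-1 : ℝ) ^ B.card * tree Z T (blockIndex k B l) ω) 2 P :=
    fun B l => (hT.memLp_tree hZ (blockIndex_injective k B l)).const_mul _
  have hX : ∀ l, MemLp (X l) 2 P := fun l => memLp_finsetSum _ fun B _ => hmem B l
  have hcov : ∀ l l', cov[X l, X l'; P] = ∑ B ∈ J.powerset, ∑ B' ∈ J.powerset,
      (-1 : ℝ) ^ B.card * ((-1) ^ B'.card * zeta D T (Finset.univ.image (blockIndex k B l) ∩
        Finset.univ.image (blockIndex k B' l')).card) := by
    intro l l'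
    rw [covariance_fun_sum_fun_sum' (fun B _ => hmem B l) (fun B _ => hmem B l')]
    refine Finset.sum_congr rfl fun B _ => Finset.sum_congr rfl fun B' _ => ?_
    rw [covariance_const_mul_left, covariance_const_mul_right,
      hT.covariance_tree hZ (blockIndex_injective k B l) (blockIndex_injective k B' l')]
  have hne : ∀ l l', l ≠ l' → cov[X l, X l'; P] = zetaDiff D T j := by
    intro l l' hl
    rw [hcov]
    conv_rhs => rw [← Finset.card_range j, ← sum_neg_one_pow_mul_zeta_inter]
    refine Finset.sum_congr rfl fun B hB => Finset.sum_congr rfl fun B' hB' => ?_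
    rw [image_blockIndex_inter (hJ B hB) (hJ B' hB') hl]
  let M := ∑ c ∈ Finset.range (k + 1), |zeta D T c|
  let K := ∑ _B ∈ J.powerset, ∑ _B' ∈ J.powerset, M
  have heq : ∀ l, cov[X l, X l; P] ≤ K := by
    intro l
    rw [hcov]
    refine Finset.sum_le_sum fun B _ => Finset.sum_le_sum fun B' _ => (le_abs_self _).trans ?_
    rw [abs_mul, abs_mul, abs_pow, abs_pow, abs_neg, abs_one, one_pow, one_pow, one_mul, one_mul]
    refine Finset.single_le_sum (f := fun c => |zeta D T c|) (fun _ _ => abs_nonneg _) ?_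
    refine Finset.mem_range.2 (Nat.lt_succ_of_le ?_)
    refine (Finset.card_le_card Finset.inter_subset_left).trans ?_
    simpa using Finset.card_image_le (s := Finset.univ) (f := blockIndex k B l)
  refine nonneg_of_forall_quadratic (K := K) fun N => ?_
  have hvar : 0 ≤ cov[fun ω => ∑ l ∈ Finset.range N, X l ω, fun ω => ∑ l ∈ Finset.range N, X l ω; P] := by
    rw [covariance_self (memLp_finsetSum _ fun l _ => hX l).1.aemeasurable]
    exact variance_nonneg _ _
  rw [covariance_fun_sum_fun_sum' (fun l _ => hX l) (fun l _ => hX l)] at hvar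
  refine hvar.trans ?_
  have : ∀ l ∈ Finset.range N, ∑ l' ∈ Finset.range N, cov[X l, X l'; P]
      ≤ ((N : ℝ) - 1) * zetaDiff D T j + K := by
    intro l hl
    rw [← Finset.sum_erase_add _ _ hl, Finset.sum_congr rfl (g := fun _ => zetaDiff D T j)
      fun l' hl' => hne l l' (Finset.ne_of_mem_erase hl').symm, Finset.sum_const,
      Finset.card_erase_of_mem hl, Finset.card_range, nsmul_eq_mul,
      Nat.cast_sub (by have := Finset.mem_range.1 hl; omega)]
    have := heq l
    push_cast
    linarith
  refine (Finset.sum_le_sum this).trans (le_of_eq ?_)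
  rw [Finset.sum_const, Finset.card_range, nsmul_eq_mul]
  ring

end

/-! ### Inclusion probabilities and in-bag covariances of a random subsample. -/

section Subsample

variable {n k : ℕ}

lemma subsampleMean_add (f g : (Fin k ↪ Fin n) → ℝ) :
    subsampleMean (fun s => f s + g s) = subsampleMean f + subsampleMean g := by
  simp only [subsampleMean, Finset.sum_add_distrib, add_div]

lemma subsampleMean_sub (f g : (Fin k ↪ Fin n) → ℝ) :
    subsampleMean (fun s => f s - g s) = subsampleMean f - subsampleMean g := by
  simp only [subsampleMean, Finset.sum_sub_distrib, sub_div]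

lemma subsampleMean_const_mul (c : ℝ) (f : (Fin k ↪ Fin n) → ℝ) :
    subsampleMean (fun s => c * f s) = c * subsampleMean f := by
  simp only [subsampleMean, ← Finset.mul_sum, mul_div_assoc]

lemma subsampleMean_sum {ι : Type*} (A : Finset ι) (f : ι → (Fin k ↪ Fin n) → ℝ) :
    subsampleMean (fun s => ∑ i ∈ A, f i s) = ∑ i ∈ A, subsampleMean (f i) := by
  simp only [subsampleMean]
  rw [Finset.sum_comm, Finset.sum_div]

lemma card_embedding_pos (hkn : k ≤ n) : (0 : ℝ) < Fintype.card (Fin k ↪ Fin n) := by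
  have : Nonempty (Fin k ↪ Fin n) := ⟨Fin.castLEEmb hkn⟩
  exact_mod_cast Fintype.card_pos

lemma subsampleMean_const (hkn : k ≤ n) (c : ℝ) :
    subsampleMean (fun _ : Fin k ↪ Fin n => c) = c := by
  simp only [subsampleMean, Finset.sum_const, Finset.card_univ, nsmul_eq_mul]
  exact mul_div_cancel_left₀ _ (card_embedding_pos hkn).ne'

lemma subsampleMean_mono {f g : (Fin k ↪ Fin n) → ℝ} (h : ∀ s, f s ≤ g s) :
    subsampleMean f ≤ subsampleMean g :=
  div_le_div_of_nonneg_right (Finset.sum_le_sum fun s _ => h s) (Nat.cast_nonneg _)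

lemma subsampleMean_perm (τ : Equiv.Perm (Fin n)) (f : (Fin k ↪ Fin n) → ℝ) :
    subsampleMean (fun s => f (s.trans τ.toEmbedding)) = subsampleMean f := by
  simp only [subsampleMean]
  congr 1
  exact Fintype.sum_equiv (Equiv.embeddingCongr (Equiv.refl _) τ) _ _ fun s => rfl

lemma inbag_eq (i : Fin n) (s : Fin k ↪ Fin n) :
    inbag i s = if i ∈ Finset.univ.image s then 1 else 0 := by
  simp only [inbag]
  split_ifs with h
  · obtain ⟨j, -, rfl⟩ := Finset.mem_image.1 h
    simp
  · refine Finset.sum_eq_zero fun j _ => if_neg fun hj => h (Finset.mem_image.2 ⟨j, by simp, hj⟩)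

/-- The probability that a random subsample of size `k` contains all of `A`. -/
def inclProb (k : ℕ) (A : Finset (Fin n)) : ℝ :=
  subsampleMean fun s : Fin k ↪ Fin n => if A ⊆ Finset.univ.image s then 1 else 0

lemma inclProb_nonneg (k : ℕ) (A : Finset (Fin n)) : 0 ≤ inclProb k A :=
  div_nonneg (Finset.sum_nonneg fun s _ => by positivity) (Nat.cast_nonneg _)

lemma inclProb_empty (hkn : k ≤ n) : inclProb k (∅ : Finset (Fin n)) = 1 := by
  simp [inclProb, subsampleMean_const hkn]

lemma inclProb_map (τ : Equiv.Perm (Fin n)) (A : Finset (Fin n)) :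
    inclProb k (A.map τ.toEmbedding) = inclProb k A := by
  rw [inclProb, ← subsampleMean_perm τ]
  congr 1
  ext s
  congr 1
  have : Finset.univ.image (s.trans τ.toEmbedding) = (Finset.univ.image s).map τ.toEmbedding := by
    rw [Finset.map_eq_image, Finset.image_image]; rfl
  rw [this, Finset.map_subset_map]

lemma inclProb_insert_eq {A : Finset (Fin n)} {i i' : Fin n} (hi : i ∉ A) (hi' : i' ∉ A) :
    inclProb k (insert i' A) = inclProb k (insert i A) := by
  rw [← inclProb_map (Equiv.swap i i') (insert i A)]
  congr 1
  rw [Finset.map_insert, Equiv.coe_toEmbedding, Equiv.swap_apply_left]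
  congr 1
  ext x
  rw [Finset.mem_map_equiv, Equiv.symm_swap]
  by_cases h : x = i
  · subst h; simp [hi, hi']
  by_cases h' : x = i'
  · subst h'; simp [hi, hi']
  rw [Equiv.swap_apply_of_ne_of_ne h h']

/-- Double counting: a subsample containing `A` has `k - |A|` further indices, and by
exchangeability each of the `n - |A|` candidates is equally likely to be among them. -/
lemma inclProb_insert {A : Finset (Fin n)} {i : Fin n} (hi : i ∉ A) :
    ((n : ℝ) - A.card) * inclProb k (insert i A) = ((k : ℝ) - A.card) * inclProb k A := by
  have h1 : ∑ i' ∈ Aᶜ, inclProb k (insert i' A) = ((n : ℝ) - A.card) * inclProb k (insert i A) := by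
    rw [Finset.sum_congr rfl fun i' hi' => inclProb_insert_eq hi (Finset.mem_compl.1 hi'),
      Finset.sum_const, Finset.card_compl, Fintype.card_fin, nsmul_eq_mul, Nat.cast_sub]
    simpa using Finset.card_le_univ A
  rw [← h1]
  simp only [inclProb]
  rw [← subsampleMean_sum, ← subsampleMean_const_mul]
  congr 1
  ext s
  have hs : (Finset.univ.image s).card = k := by
    rw [Finset.card_image_of_injective _ s.injective]; simp
  by_cases hA : A ⊆ Finset.univ.image s
  · simp only [Finset.insert_subset_iff, hA, and_true, if_true, mul_one]
    rw [Finset.sum_boole]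
    have : Finset.filter (fun i => i ∈ Finset.univ.image s) Aᶜ = Finset.univ.image s \ A := by
      ext x; simp [and_comm]
    rw [this, Finset.cast_card_sdiff hA, hs]
  · simp [Finset.insert_subset_iff, hA]

lemma inclProb_eq_zero {A : Finset (Fin n)} (hA : k < A.card) : inclProb k A = 0 := by
  have : ∀ s : Fin k ↪ Fin n, (if A ⊆ Finset.univ.image s then (1 : ℝ) else 0) = 0 := fun s => by
    refine if_neg fun h => ?_
    have := Finset.card_le_card h
    rw [Finset.card_image_of_injective _ s.injective] at this
    simp at this
    omega
  simp [inclProb, this, subsampleMean]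

lemma card_lt_of_notMem {A : Finset (Fin n)} {i : Fin n} (hi : i ∉ A) : (A.card : ℝ) < n := by
  have := Finset.card_lt_univ_of_notMem hi
  rw [Fintype.card_fin] at this
  exact_mod_cast this

/-- Including one more element costs a factor `(k - a)/(n - a) ≤ k/n`. -/
lemma inclProb_le_pow (hkn : k ≤ n) (A : Finset (Fin n)) :
    inclProb k A ≤ ((k : ℝ) / n) ^ A.card := by
  induction A using Finset.induction_on with
  | empty => simp [inclProb_empty hkn]
  | insert i A hi ih =>
    have hA := card_lt_of_notMem hi
    have hA0 : (0 : ℝ) ≤ A.card := Nat.cast_nonneg _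
    have hn : (0 : ℝ) < n := hA0.trans_lt hA
    have hkn' : (k : ℝ) ≤ n := by exact_mod_cast hkn
    have h := inclProb_insert (k := k) hi
    have hp := inclProb_nonneg k A
    rw [Finset.card_insert_of_notMem hi, pow_succ']
    refine le_trans ?_ (mul_le_mul_of_nonneg_left ih (by positivity))
    rw [div_mul_eq_mul_div, le_div_iff₀ hn]
    have h2 : ((n : ℝ) - A.card) * (inclProb k (insert i A) * n)
        ≤ ((n : ℝ) - A.card) * (k * inclProb k A) := by
      have : ((n : ℝ) - A.card) * (inclProb k (insert i A) * n) = n * ((k - A.card) * inclProb k A) := by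
        rw [← h]; ring
      rw [this]
      have : 0 ≤ (A.card : ℝ) * inclProb k A * (n - k) :=
        mul_nonneg (mul_nonneg hA0 hp) (by linarith)
      linarith
    exact le_of_mul_le_mul_left h2 (by linarith)

/-- The covariance, over the subsamples, of the in-bag count of `i` with the event `A ⊆ s`. -/
def inclCov (k : ℕ) (i : Fin n) (A : Finset (Fin n)) : ℝ :=
  subsampleMean fun s : Fin k ↪ Fin n =>
    (inbag i s - (k : ℝ) / n) * if A ⊆ Finset.univ.image s then 1 else 0

lemma inclCov_eq (i : Fin n) (A : Finset (Fin n)) :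
    inclCov k i A = inclProb k (insert i A) - (k : ℝ) / n * inclProb k A := by
  simp only [inclCov, inclProb]
  rw [← subsampleMean_const_mul, ← subsampleMean_sub]
  congr 1
  ext s
  rw [inbag_eq]
  simp only [Finset.insert_subset_iff]
  by_cases h : i ∈ Finset.univ.image s <;> by_cases h' : A ⊆ Finset.univ.image s <;> simp [h']

lemma inclCov_of_mem {i : Fin n} {A : Finset (Fin n)} (hi : i ∈ A) :
    inclCov k i A = inclProb k A * (1 - (k : ℝ) / n) := by
  rw [inclCov_eq, Finset.insert_eq_of_mem hi]
  ring

lemma inclCov_of_notMem {i : Fin n} {A : Finset (Fin n)} (hi : i ∉ A) :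
    ((n : ℝ) - A.card) * inclCov k i A = - (A.card * inclProb k A * (1 - (k : ℝ) / n)) := by
  have hn : (n : ℝ) ≠ 0 := ((Nat.cast_nonneg _).trans_lt (card_lt_of_notMem hi)).ne'
  rw [inclCov_eq, mul_sub, inclProb_insert hi]
  field_simp
  ring

/-- Each `i ∈ A` contributes at most `inclProb²`. Outside `A` the covariance is at most `|A| ·
inclProb / n` in absolute value, and since `|A| ≤ k ≤ n` these at most `n` squares also sum to at
most `|A| · inclProb²`. For `|A| > k` both sides vanish. -/
lemma sum_inclCov_sq_le (hkn : k ≤ n) (A : Finset (Fin n)) :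
    ∑ i, inclCov k i A ^ 2 ≤ 2 * A.card * inclProb k A ^ 2 := by
  by_cases hA : k < A.card
  · have h0 : ∀ i, inclCov k i A = 0 := fun i => by
      rw [inclCov_eq, inclProb_eq_zero hA, inclProb_eq_zero
        (hA.trans_le (Finset.card_le_card (Finset.subset_insert i A)))]
      simp
    simp [h0, inclProb_eq_zero hA]
  push Not at hA
  rcases Nat.eq_zero_or_pos n with rfl | hn0
  · simp only [Finset.univ_eq_empty, Finset.sum_empty]; positivity
  have hn : (0 : ℝ) < n := by exact_mod_cast hn0
  have hAk : (A.card : ℝ) ≤ k := by exact_mod_cast hA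
  have hkn' : (k : ℝ) ≤ n := by exact_mod_cast hkn
  have hA0 : (0 : ℝ) ≤ A.card := Nat.cast_nonneg _
  have hp := inclProb_nonneg k A
  have hr : 0 ≤ 1 - (k : ℝ) / n := by rw [sub_nonneg, div_le_one hn]; exact hkn'
  have hr1 : 1 - (k : ℝ) / n ≤ 1 := by linarith [show (0 : ℝ) ≤ k / n by positivity]
  have h1 : ∀ i ∈ A, inclCov k i A ^ 2 ≤ inclProb k A ^ 2 := fun i hi => by
    rw [inclCov_of_mem hi]
    exact pow_le_pow_left₀ (mul_nonneg hp hr) (mul_le_of_le_one_right hp hr1) 2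
  have h2 : ∀ i ∈ Aᶜ, inclCov k i A ^ 2 ≤ (A.card * inclProb k A / n) ^ 2 := fun i hi => by
    have hi' := Finset.mem_compl.1 hi
    have hlt := card_lt_of_notMem hi'
    have hpos : 0 < (n : ℝ) - A.card := by linarith
    have h := inclCov_of_notMem (k := k) hi'
    have habs : |inclCov k i A| ≤ A.card * inclProb k A / n := by
      refine le_of_mul_le_mul_left ?_ hpos
      rw [← abs_of_pos hpos, ← abs_mul, h, abs_neg, abs_of_pos hpos,
        abs_of_nonneg (mul_nonneg (mul_nonneg hA0 hp) hr)]
      have : ((n : ℝ) - A.card) * (A.card * inclProb k A / n)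
          = A.card * inclProb k A * (1 - A.card / n) := by field_simp
      rw [this]
      have : (A.card : ℝ) / n ≤ k / n := by gcongr
      exact mul_le_mul_of_nonneg_left (by linarith) (mul_nonneg hA0 hp)
    exact sq_le_sq' (by linarith [(abs_le.1 habs).1]) (abs_le.1 habs).2
  rw [← Finset.sum_add_sum_compl A]
  refine (add_le_add (Finset.sum_le_sum h1) (Finset.sum_le_sum h2)).trans ?_
  rw [Finset.sum_const, Finset.sum_const, nsmul_eq_mul, nsmul_eq_mul]
  have hc : (Aᶜ.card : ℝ) ≤ n := by
    have := Finset.card_le_univ Aᶜ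
    rw [Fintype.card_fin] at this
    exact_mod_cast this
  have h3 : (Aᶜ.card : ℝ) * (A.card * inclProb k A / n) ^ 2
      ≤ A.card * inclProb k A ^ 2 := by
    calc (Aᶜ.card : ℝ) * (A.card * inclProb k A / n) ^ 2
        ≤ n * (A.card * inclProb k A / n) ^ 2 := by gcongr
      _ = A.card * inclProb k A ^ 2 * (A.card / n) := by field_simp
      _ ≤ A.card * inclProb k A ^ 2 * 1 := by
        refine mul_le_mul_of_nonneg_left ?_ (by positivity)
        rw [div_le_one hn]; linarith
      _ = _ := mul_one _
  linarith

/-- For `x ≤ 1/2` the sequence `c ↦ c x ^ c` does not increase from `c = 2` on. -/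
lemma natCast_mul_pow_le {x : ℝ} (hx : 0 ≤ x) (hx2 : x ≤ 1 / 2) {c : ℕ} (hc : 2 ≤ c) :
    (c : ℝ) * x ^ c ≤ 2 * x ^ 2 := by
  induction c, hc using Nat.le_induction with
  | base => norm_num
  | succ c hc ih =>
    refine le_trans ?_ ih
    rw [pow_succ]
    have hc' : (2 : ℝ) ≤ c := by exact_mod_cast hc
    have h1 : ((c + 1 : ℕ) : ℝ) * x ≤ c := by push_cast; nlinarith
    have := mul_le_mul_of_nonneg_left h1 (pow_nonneg hx c)
    linarith

/-- One factor `inclProb` is spent on the gain `(k/n)²`, which requires `|A| ≥ 2`. The other is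
kept, so that summation against the component variances still yields at most `ζ_{k,k}`. -/
lemma sum_inclCov_sq_le_of_two_le (hkn : k ≤ n) (hkn2 : (k : ℝ) / n ≤ 1 / 2) {A : Finset (Fin n)}
    (hA : 2 ≤ A.card) : ∑ i, inclCov k i A ^ 2 ≤ 4 * ((k : ℝ) / n) ^ 2 * inclProb k A := by
  have hp := inclProb_nonneg k A
  refine (sum_inclCov_sq_le hkn A).trans ?_
  have h1 := mul_le_mul_of_nonneg_left (inclProb_le_pow hkn A) (Nat.cast_nonneg (α := ℝ) A.card)
  have h2 := natCast_mul_pow_le (x := (k : ℝ) / n) (by positivity) hkn2 hA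
  have h3 := mul_le_mul_of_nonneg_right (h1.trans h2) hp
  nlinarith

lemma subsampleMean_inbag (hkn : k ≤ n) (i : Fin n) :
    subsampleMean (fun s : Fin k ↪ Fin n => inbag i s) = (k : ℝ) / n := by
  have hn : (n : ℝ) ≠ 0 := by exact_mod_cast i.pos.ne'
  have h := inclProb_insert (k := k) (A := ∅) (i := i) (by simp)
  rw [inclProb_empty hkn] at h
  have h1 : subsampleMean (fun s : Fin k ↪ Fin n => inbag i s) = inclProb k {i} := by
    simp only [inclProb, inbag_eq, Finset.singleton_subset_iff]
  rw [h1, eq_div_iff hn]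
  simpa [mul_comm] using h

lemma inclProb_singleton (hkn : k ≤ n) (i : Fin n) : inclProb k {i} = (k : ℝ) / n := by
  rw [← subsampleMean_inbag hkn i]
  simp only [inclProb, inbag_eq, Finset.singleton_subset_iff]

lemma forestDirDeriv_eq {S : Type*} (hkn : k ≤ n) (T : (Fin k → S) → ℝ) (z : Fin n → S) (i : Fin n) :
    forestDirDeriv T z i = n * subsampleMean (fun s : Fin k ↪ Fin n =>
      (inbag i s - (k : ℝ) / n) * T fun j => z (s j)) := by
  simp only [forestDirDeriv, sub_mul]
  rw [subsampleMean_sub, subsampleMean_const_mul, subsampleMean_inbag hkn]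

/-- In-bag covariance with a linear statistic of the subsample. -/
lemma subsampleMean_inbag_mul_sum (hkn : k ≤ n) (hn : 2 ≤ n) (t : Fin n → ℝ) (i : Fin n) :
    n * subsampleMean (fun s : Fin k ↪ Fin n => (inbag i s - (k : ℝ) / n) * ∑ j, t (s j))
      = k * ((n - k) / (n - 1)) * (t i - (n : ℝ)⁻¹ * ∑ l, t l) := by
  have hn' : (2 : ℝ) ≤ n := by exact_mod_cast hn
  have hn1 : (n : ℝ) - 1 ≠ 0 := by linarith
  have hn0 : (n : ℝ) ≠ 0 := by linarith
  have h1 : ∀ s : Fin k ↪ Fin n, (inbag i s - (k : ℝ) / n) * ∑ j, t (s j)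
      = ∑ l, t l * ((inbag i s - (k : ℝ) / n) *
        if {l} ⊆ Finset.univ.image s then 1 else 0) := by
    intro s
    rw [← Finset.sum_image (f := t) (s := Finset.univ) (g := s) (fun a _ b _ h => s.injective h)]
    simp only [Finset.singleton_subset_iff, mul_ite, mul_one, mul_zero]
    rw [← Finset.sum_filter, Finset.mul_sum]
    refine Finset.sum_congr (by ext; simp) fun l _ => mul_comm _ _
  have hi : inclCov k i {i} = (k : ℝ) / n * (1 - k / n) := by
    rw [inclCov_of_mem (Finset.mem_singleton_self i), inclProb_singleton hkn]
  have hl : ∀ l ≠ i, inclCov k i {l} = - ((k : ℝ) / n * (1 - k / n) / (n - 1)) := by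
    intro l hl
    have h := inclCov_of_notMem (k := k) (i := i) (A := {l}) (by simpa using hl.symm)
    rw [inclProb_singleton hkn] at h
    simp only [Finset.card_singleton, Nat.cast_one, one_mul] at h
    rw [← neg_div, eq_div_iff hn1, mul_comm]
    exact h
  simp_rw [h1]
  rw [subsampleMean_sum]
  simp_rw [subsampleMean_const_mul]
  change (n : ℝ) * ∑ l, t l * inclCov k i {l} = _
  rw [← Finset.add_sum_erase _ _ (Finset.mem_univ i), hi,
    Finset.sum_congr rfl fun l hl' => by rw [hl l (Finset.ne_of_mem_erase hl')],
    ← Finset.sum_mul]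
  rw [← Finset.add_sum_erase _ t (Finset.mem_univ i)]
  field_simp
  ring

end Subsample

/-! ### Higher-order components of the forest's directional derivatives. -/

/-- The event `A ⊆ s ∩ s'` factorizes into `A ⊆ s` and `A ⊆ s'`, so a quadratic form over pairs of
subsamples becomes a weighted sum of squares indexed by the Hoeffding components. -/
lemma sum_sum_mul_sum_powerset_inter {n k : ℕ} (a : (Fin k ↪ Fin n) → ℝ) (f : ℕ → ℝ) :
    ∑ s, ∑ s', a s * a s' *
        ∑ A ∈ (Finset.univ.image s ∩ Finset.univ.image s').powerset, f A.card
      = ∑ A : Finset (Fin n), f A.card *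
        (∑ s, a s * if A ⊆ Finset.univ.image s then 1 else 0) ^ 2 := by
  classical
  have h1 : ∀ s s' : Fin k ↪ Fin n,
      ∑ A ∈ (Finset.univ.image s ∩ Finset.univ.image s').powerset, f A.card
      = ∑ A : Finset (Fin n), f A.card * ((if A ⊆ Finset.univ.image s then 1 else 0) *
        if A ⊆ Finset.univ.image s' then 1 else 0) := by
    intro s s'
    rw [← Finset.sum_subset (Finset.subset_univ
      (Finset.univ.image s ∩ Finset.univ.image s').powerset)]
    · refine Finset.sum_congr rfl fun A hA => ?_
      have := Finset.subset_inter_iff.1 (Finset.mem_powerset.1 hA)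
      simp [this.1, this.2]
    · intro A _ hA
      rw [Finset.mem_powerset, Finset.subset_inter_iff, not_and_or] at hA
      rcases hA with hA | hA <;> simp [hA]
  simp_rw [h1, pow_two, Finset.sum_mul_sum, Finset.mul_sum]
  symm
  rw [Finset.sum_comm]
  refine Finset.sum_congr rfl fun s _ => ?_
  rw [Finset.sum_comm]
  exact Finset.sum_congr rfl fun s' _ => Finset.sum_congr rfl fun A _ => by ring

section

variable {Ω S : Type*} [MeasurableSpace Ω] [MeasurableSpace S] {P : Measure Ω}
  [IsProbabilityMeasure P] {D : Measure S} [IsProbabilityMeasure D] {Z : ℕ → Ω → S}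
  {k : ℕ} {T : (Fin k → S) → ℝ}

lemma IsIID.memLp_comp (hZ : IsIID P D Z) {g : S → ℝ} {q : ENNReal} (hg : MemLp g q D) (i : ℕ) :
    MemLp (fun ω => g (Z i ω)) q P :=
  hg.comp_measurePreserving (hZ.measurePreserving i)

lemma IsIID.integral_comp (hZ : IsIID P D Z) {g : S → ℝ} (hg : AEStronglyMeasurable g D) (i : ℕ) :
    ∫ ω, g (Z i ω) ∂P = ∫ a, g a ∂D := by
  conv_rhs => rw [← hZ.law i]
  rw [integral_map (hZ.measurable i).aemeasurable (by rwa [hZ.law i])]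

lemma IsTreeKernel.covariance_treeProj_self (hT : IsTreeKernel D T) (hZ : IsIID P D Z)
    (hk : 1 ≤ k) : ∫ a, treeProj D T a * treeProj D T a ∂D = zeta D T 1 := by
  simp_rw [hT.zeta_one hZ hk, pow_two]

lemma IsTreeKernel.zetaDiff_zero (hT : IsTreeKernel D T) : zetaDiff D T 0 = 0 := hT.zeta_zero

lemma IsTreeKernel.zetaDiff_one (hT : IsTreeKernel D T) : zetaDiff D T 1 = zeta D T 1 := by
  simp [zetaDiff, fwdDiff, hT.zeta_zero]

/-- The tree with its first-order Hoeffding component removed. -/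
def residTree (Z : ℕ → Ω → S) (D : Measure S) (T : (Fin k → S) → ℝ) (s : Fin k → ℕ) (ω : Ω) : ℝ :=
  tree Z T s ω - ∑ i ∈ Finset.univ.image s, treeProj D T (Z i ω)

lemma IsTreeKernel.memLp_residTree (hT : IsTreeKernel D T) (hZ : IsIID P D Z) {s : Fin k → ℕ}
    (hs : s.Injective) : MemLp (residTree Z D T s) 2 P :=
  (hT.memLp_tree hZ hs).sub
    (memLp_finsetSum _ fun i _ => hZ.memLp_comp (hT.memLp_treeProj hZ) i)

lemma IsTreeKernel.integral_residTree (hT : IsTreeKernel D T) (hZ : IsIID P D Z) (hk : 1 ≤ k)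
    {s : Fin k → ℕ} (hs : s.Injective) : ∫ ω, residTree Z D T s ω ∂P = treeMean D T := by
  have ht := hT.memLp_treeProj hZ
  have hti : ∀ i : ℕ, Integrable (fun ω => treeProj D T (Z i ω)) P := fun i =>
    (hZ.memLp_comp ht i).integrable (by norm_num)
  simp only [residTree]
  rw [integral_sub ((hT.memLp_tree hZ hs).integrable (by norm_num))
    (integrable_finsetSum _ fun i _ => hti i), integral_finsetSum _ fun i _ => hti i,
    hT.integral_tree hZ hs]
  simp [hZ.integral_comp ht.1, hT.integral_treeProj hZ hk]

/-- In the expansion of `zeta_card` the empty set contributes 0 and each singleton contributes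
`ζ_{1,k}`. -/
lemma IsTreeKernel.zeta_sub_eq_sum (hT : IsTreeKernel D T) {α : Type*} (A : Finset α) :
    zeta D T A.card - A.card * zeta D T 1
      = ∑ B ∈ A.powerset, if 2 ≤ B.card then zetaDiff D T B.card else 0 := by
  have h : ∀ B : Finset α, zetaDiff D T B.card = (if 2 ≤ B.card then zetaDiff D T B.card else 0)
      + if 2 ≤ B.card then 0 else zetaDiff D T B.card := fun B => by split_ifs <;> simp
  rw [zeta_card, Finset.sum_congr rfl fun B _ => h B, Finset.sum_add_distrib,
    Finset.sum_powerset_apply_card (f := fun m => if 2 ≤ m then 0 else zetaDiff D T m)]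
  have : ∑ m ∈ Finset.range (A.card + 1), A.card.choose m •
      (if 2 ≤ m then 0 else zetaDiff D T m) = A.card * zeta D T 1 := by
    generalize A.card = c
    rcases c with _ | c
    · simp [hT.zetaDiff_zero]
    · rw [Finset.sum_range_succ', Finset.sum_range_succ', Finset.sum_eq_zero]
      · simp [hT.zetaDiff_zero, hT.zetaDiff_one]
      · intro m _
        simp
  rw [this]
  ring

/-- With `c` shared observations, both cross covariances and the covariance of the two linear parts
equal `c ζ_{1,k}`; the total is `ζ_{c,k} - c ζ_{1,k} - c ζ_{1,k} + c ζ_{1,k}`. -/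
lemma IsTreeKernel.covariance_residTree (hT : IsTreeKernel D T) (hZ : IsIID P D Z) (hk : 1 ≤ k)
    {s s' : Fin k → ℕ} (hs : s.Injective) (hs' : s'.Injective) :
    cov[residTree Z D T s, residTree Z D T s'; P]
      = zeta D T (Finset.univ.image s ∩ Finset.univ.image s').card
        - (Finset.univ.image s ∩ Finset.univ.image s').card * zeta D T 1 := by
  have ht := hT.memLp_treeProj hZ
  have hti : ∀ i : ℕ, MemLp (fun ω => treeProj D T (Z i ω)) 2 P := hZ.memLp_comp ht
  have hsum : ∀ A : Finset ℕ, MemLp (fun ω => ∑ i ∈ A, treeProj D T (Z i ω)) 2 P :=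
    fun A => memLp_finsetSum _ fun i _ => hti i
  have hone := hT.covariance_treeProj_self hZ hk
  have h1 : ∀ {u : Fin k → ℕ} (_ : u.Injective) (A : Finset ℕ),
      cov[tree Z T u, fun ω => ∑ i ∈ A, treeProj D T (Z i ω); P]
        = (Finset.univ.image u ∩ A).card * zeta D T 1 := by
    intro u hu A
    rw [covariance_fun_sum_right' (fun i _ => hti i) (hT.memLp_tree hZ hu)]
    simp_rw [hT.covariance_tree_comp hZ ht hu, hone]
    rw [Finset.sum_ite_mem, Finset.inter_comm, Finset.sum_const, nsmul_eq_mul]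
  have h2 : cov[fun ω => ∑ i ∈ Finset.univ.image s, treeProj D T (Z i ω),
      fun ω => ∑ i ∈ Finset.univ.image s', treeProj D T (Z i ω); P]
      = (Finset.univ.image s ∩ Finset.univ.image s').card * zeta D T 1 := by
    rw [covariance_fun_sum_fun_sum' (fun i _ => hti i) (fun i _ => hti i)]
    simp_rw [hZ.covariance_comp ht ht, hT.covariance_treeProj hZ hk ht, hone,
      Finset.sum_ite_eq]
    rw [Finset.sum_ite_mem, Finset.sum_const, nsmul_eq_mul]
  have e : ∀ u : Fin k → ℕ, residTree Z D T u
      = fun ω => tree Z T u ω - ∑ i ∈ Finset.univ.image u, treeProj D T (Z i ω) := fun u => rfl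
  rw [e s, e s', covariance_fun_sub_fun_sub (hT.memLp_tree hZ hs) (hsum _)
    (hT.memLp_tree hZ hs') (hsum _), hT.covariance_tree hZ hs hs', h1 hs, h2,
    covariance_comm (fun ω => ∑ i ∈ Finset.univ.image s, treeProj D T (Z i ω)), h1 hs',
    Finset.inter_comm (Finset.univ.image s')]
  ring

/-- The contribution of the higher-order Hoeffding components to the directional derivative. -/
def forestResid (Z : ℕ → Ω → S) (D : Measure S) (T : (Fin k → S) → ℝ) (n : ℕ) (i : Fin n)
    (ω : Ω) : ℝ :=
  n * subsampleMean fun s : Fin k ↪ Fin n =>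
    (inbag i s - (k : ℝ) / n) * residTree Z D T (fun j => (s j : ℕ)) ω

lemma injective_val_comp {n k : ℕ} (s : Fin k ↪ Fin n) :
    Function.Injective fun j => ((s j : Fin n) : ℕ) :=
  Fin.val_injective.comp s.injective

lemma image_val_comp {n k : ℕ} (s : Fin k ↪ Fin n) :
    Finset.univ.image (fun j => ((s j : Fin n) : ℕ))
      = (Finset.univ.image s).image (fun i : Fin n => (i : ℕ)) := by
  rw [Finset.image_image]; rfl

lemma card_inter_image_val {n k : ℕ} (s s' : Fin k ↪ Fin n) :
    (Finset.univ.image (fun j => ((s j : Fin n) : ℕ))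
      ∩ Finset.univ.image (fun j => ((s' j : Fin n) : ℕ))).card
      = (Finset.univ.image s ∩ Finset.univ.image s').card := by
  rw [image_val_comp, image_val_comp, ← Finset.image_inter _ _ Fin.val_injective,
    Finset.card_image_of_injective _ Fin.val_injective]

lemma forestDirDeriv_sample {n : ℕ} (hkn : k ≤ n) (hn : 2 ≤ n) (i : Fin n) (ω : Ω) :
    forestDirDeriv T (sample Z n ω) i
      = k * ((n - k) / (n - 1)) * (treeProj D T (Z i ω)
          - (n : ℝ)⁻¹ * ∑ l : Fin n, treeProj D T (Z l ω)) + forestResid Z D T n i ω := by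
  rw [forestDirDeriv_eq hkn, ← subsampleMean_inbag_mul_sum hkn hn (fun l => treeProj D T (Z l ω)) i,
    forestResid, ← mul_add, ← subsampleMean_add]
  congr 2
  ext s
  rw [residTree, Finset.sum_image fun a _ b _ h => injective_val_comp s h]
  simp only [tree, sample]
  ring

lemma forestResid_eq_sum (n : ℕ) (i : Fin n) : forestResid Z D T n i = fun ω =>
    ∑ s : Fin k ↪ Fin n, (n : ℝ) * (inbag i s - (k : ℝ) / n) / Fintype.card (Fin k ↪ Fin n) *
      residTree Z D T (fun j => ((s j : Fin n) : ℕ)) ω := by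
  ext ω
  simp only [forestResid, subsampleMean, mul_div_assoc, Finset.sum_div, Finset.mul_sum]
  exact Finset.sum_congr rfl fun s _ => by ring

lemma IsTreeKernel.memLp_forestResid (hT : IsTreeKernel D T) (hZ : IsIID P D Z) (n : ℕ)
    (i : Fin n) : MemLp (forestResid Z D T n i) 2 P := by
  rw [forestResid_eq_sum]
  exact memLp_finsetSum _ fun s _ => (hT.memLp_residTree hZ (injective_val_comp s)).const_mul _

lemma IsTreeKernel.integral_forestResid (hT : IsTreeKernel D T) (hZ : IsIID P D Z) (hk : 1 ≤ k)
    {n : ℕ} (hkn : k ≤ n) (i : Fin n) : ∫ ω, forestResid Z D T n i ω ∂P = 0 := by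
  simp only [forestResid, subsampleMean]
  rw [integral_const_mul, integral_div, integral_finsetSum _ fun s _ =>
    ((hT.memLp_residTree hZ (injective_val_comp s)).integrable (by norm_num)).const_mul _]
  simp_rw [integral_const_mul, hT.integral_residTree hZ hk (injective_val_comp _)]
  rw [← Finset.sum_mul, mul_div_right_comm]
  have : subsampleMean (fun s : Fin k ↪ Fin n => inbag i s - (k : ℝ) / n) = 0 := by
    rw [subsampleMean_sub, subsampleMean_inbag hkn, subsampleMean_const hkn, sub_self]
  rw [subsampleMean] at this
  rw [this]
  simp

/-- The residual is centred, so this is a variance. It diagonalizes over the components `A` of order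
at least two, each weighted by how strongly the event `A ⊆ s` covaries with the in-bag count of `i`.
-/
lemma IsTreeKernel.integral_forestResid_sq (hT : IsTreeKernel D T) (hZ : IsIID P D Z) (hk : 1 ≤ k)
    {n : ℕ} (hkn : k ≤ n) (i : Fin n) : ∫ ω, forestResid Z D T n i ω ^ 2 ∂P
      = n ^ 2 * ∑ A : Finset (Fin n),
        (if 2 ≤ A.card then zetaDiff D T A.card else 0) * inclCov k i A ^ 2 := by
  have hm := hT.memLp_forestResid hZ n i
  have h0 := hT.integral_forestResid hZ hk hkn i
  have h1 : ∫ ω, forestResid Z D T n i ω ^ 2 ∂P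
      = cov[forestResid Z D T n i, forestResid Z D T n i; P] := by
    rw [covariance_self hm.1.aemeasurable, variance_of_integral_eq_zero hm.1.aemeasurable h0]
  let c : ℝ := Fintype.card (Fin k ↪ Fin n)
  let a : (Fin k ↪ Fin n) → ℝ := fun s => (n : ℝ) * (inbag i s - (k : ℝ) / n) / c
  have hW : ∀ s : Fin k ↪ Fin n,
      MemLp (fun ω => a s * residTree Z D T (fun j => ((s j : Fin n) : ℕ)) ω) 2 P :=
    fun s => (hT.memLp_residTree hZ (injective_val_comp s)).const_mul _
  rw [h1, forestResid_eq_sum]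
  rw [covariance_fun_sum_fun_sum hW hW]
  have h3 : ∀ s s' : Fin k ↪ Fin n,
      cov[fun ω => a s * residTree Z D T (fun j => ((s j : Fin n) : ℕ)) ω,
        fun ω => a s' * residTree Z D T (fun j => ((s' j : Fin n) : ℕ)) ω; P]
      = a s * a s' * ∑ A ∈ (Finset.univ.image s ∩ Finset.univ.image s').powerset,
          if 2 ≤ A.card then zetaDiff D T A.card else 0 := by
    intro s s'
    rw [covariance_const_mul_left, covariance_const_mul_right,
      hT.covariance_residTree hZ hk (injective_val_comp s) (injective_val_comp s'),
      card_inter_image_val, hT.zeta_sub_eq_sum]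
    ring
  simp_rw [h3]
  rw [sum_sum_mul_sum_powerset_inter a (fun j => if 2 ≤ j then zetaDiff D T j else 0),
    Finset.mul_sum]
  refine Finset.sum_congr rfl fun A _ => ?_
  have h4 : ∑ s, a s * (if A ⊆ Finset.univ.image s then 1 else 0) = n * inclCov k i A := by
    simp only [inclCov, subsampleMean, a, Finset.sum_div, Finset.mul_sum, c]
    exact Finset.sum_congr rfl fun s _ => by ring
  rw [h4]
  ring

/-- The higher-order components contribute little to the directional derivatives. -/
lemma IsTreeKernel.sum_integral_forestResid_sq_le (hT : IsTreeKernel D T) (hZ : IsIID P D Z)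
    (hk : 1 ≤ k) {n : ℕ} (hkn : k ≤ n) (hkn2 : (k : ℝ) / n ≤ 1 / 2) :
    ∑ i, ∫ ω, forestResid Z D T n i ω ^ 2 ∂P ≤ 4 * (k : ℝ) ^ 2 * zeta D T k := by
  have hn : (n : ℝ) ≠ 0 := by have : 0 < n := by omega
                              exact_mod_cast this.ne'
  simp_rw [hT.integral_forestResid_sq hZ hk hkn]
  rw [← Finset.mul_sum, Finset.sum_comm]
  simp_rw [← Finset.mul_sum]
  have h1 : ∀ A : Finset (Fin n), (if 2 ≤ A.card then zetaDiff D T A.card else 0)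
      * ∑ i, inclCov k i A ^ 2 ≤ 4 * ((k : ℝ) / n) ^ 2 *
        ((if 2 ≤ A.card then zetaDiff D T A.card else 0) * inclProb k A) := by
    intro A
    by_cases hA : 2 ≤ A.card
    · by_cases hAk : A.card ≤ k
      · have h := mul_le_mul_of_nonneg_left (sum_inclCov_sq_le_of_two_le hkn hkn2 hA)
          (hT.zetaDiff_nonneg hZ hAk)
        simp only [hA, if_true]
        linarith
      · have h := sum_inclCov_sq_le hkn A
        rw [inclProb_eq_zero (by omega)] at h ⊢
        have h' : ∑ i, inclCov k i A ^ 2 = 0 :=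
          le_antisymm (by simpa using h) (Finset.sum_nonneg fun i _ => sq_nonneg _)
        simp [h']
    · simp [hA]
  -- The inclusion probability is an average over `s`; for each fixed `s` the sum runs over the
  -- subsets of its image and equals `ζ_{k,k} - k ζ_{1,k}`.
  have h2 : ∑ A : Finset (Fin n),
      (if 2 ≤ A.card then zetaDiff D T A.card else 0) * inclProb k A ≤ zeta D T k := by
    simp only [inclProb]
    simp_rw [← subsampleMean_const_mul]
    rw [← subsampleMean_sum, ← subsampleMean_const hkn (zeta D T k)]
    refine subsampleMean_mono fun s => ?_
    have hs : (Finset.univ.image s).card = k := by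
      rw [Finset.card_image_of_injective _ s.injective]; simp
    simp_rw [mul_ite, mul_one, mul_zero]
    rw [← Finset.sum_filter]
    have hf : Finset.univ.filter (fun A => A ⊆ Finset.univ.image s)
        = (Finset.univ.image s).powerset := by ext; simp
    rw [hf, ← hT.zeta_sub_eq_sum, hs, sub_le_self_iff, hT.zeta_one hZ hk]
    exact mul_nonneg (Nat.cast_nonneg _) (integral_nonneg fun a => sq_nonneg _)
  refine (mul_le_mul_of_nonneg_left ((Finset.sum_le_sum fun A _ => h1 A).trans
    ((Finset.mul_sum _ _ _).symm.le.trans (mul_le_mul_of_nonneg_left h2 (by positivity))))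
    (sq_nonneg _)).trans (le_of_eq ?_)
  field_simp

/-! ### Variance of the forest and of its Hájek projection -/

lemma IsTreeKernel.zeta_one_nonneg (hT : IsTreeKernel D T) (hZ : IsIID P D Z) (hk : 1 ≤ k) :
    0 ≤ zeta D T 1 := by
  rw [hT.zeta_one hZ hk]
  exact integral_nonneg fun a => sq_nonneg _

/-- The difference is the total variance of the components of order at least two. -/
lemma IsTreeKernel.mul_zeta_one_le (hT : IsTreeKernel D T) (hZ : IsIID P D Z) :
    k * zeta D T 1 ≤ zeta D T k := by
  have h := hT.zeta_sub_eq_sum (Finset.range k)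
  rw [Finset.card_range] at h
  have : 0 ≤ ∑ B ∈ (Finset.range k).powerset, if 2 ≤ B.card then zetaDiff D T B.card else 0 := by
    refine Finset.sum_nonneg fun B hB => ?_
    split_ifs
    · refine hT.zetaDiff_nonneg hZ ?_
      simpa using Finset.card_le_card (Finset.mem_powerset.1 hB)
    · rfl
  linarith

lemma forest_sample {n : ℕ} : (fun ω => forest T (sample Z n ω))
    = fun ω => ∑ s : Fin k ↪ Fin n, (Fintype.card (Fin k ↪ Fin n) : ℝ)⁻¹ *
        tree Z T (fun j => ((s j : Fin n) : ℕ)) ω := by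
  ext ω
  simp only [forest, subsampleMean, tree, sample, ← Finset.mul_sum]
  rw [div_eq_inv_mul]

lemma IsTreeKernel.memLp_forest (hT : IsTreeKernel D T) (hZ : IsIID P D Z) (n : ℕ) :
    MemLp (fun ω => forest T (sample Z n ω)) 2 P := by
  rw [forest_sample]
  exact memLp_finsetSum _ fun s _ => (hT.memLp_tree hZ (injective_val_comp s)).const_mul _

lemma IsTreeKernel.memLp_hajekForest (hT : IsTreeKernel D T) (hZ : IsIID P D Z) (n : ℕ) :
    MemLp (fun ω => hajekForest D T (sample Z n ω)) 2 P := by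
  have h : MemLp (fun ω => ∑ i : Fin n, treeProj D T (Z i ω)) 2 P :=
    memLp_finsetSum _ fun i _ => hZ.memLp_comp (hT.memLp_treeProj hZ) i
  exact (memLp_const (treeMean D T)).add (h.const_mul ((k : ℝ) / n))

lemma IsTreeKernel.covariance_forest_comp (hT : IsTreeKernel D T) (hZ : IsIID P D Z)
    {n : ℕ} (hkn : k ≤ n) {g : S → ℝ} (hg : MemLp g 2 D) (i : Fin n) :
    cov[fun ω => forest T (sample Z n ω), fun ω => g (Z i ω); P]
      = (k : ℝ) / n * ∫ a, treeProj D T a * g a ∂D := by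
  rw [forest_sample, covariance_fun_sum_left
    (fun s => (hT.memLp_tree hZ (injective_val_comp s)).const_mul _) (hZ.memLp_comp hg i)]
  simp_rw [covariance_const_mul_left, hT.covariance_tree_comp hZ hg (injective_val_comp _)]
  rw [← subsampleMean_inbag hkn i, subsampleMean, div_eq_inv_mul, mul_assoc, Finset.sum_mul,
    Finset.mul_sum]
  refine Finset.sum_congr rfl fun s _ => ?_
  rw [inbag_eq, image_val_comp]
  simp only [Finset.mem_image, Fin.val_inj, exists_eq_right, ite_mul, one_mul, zero_mul]

lemma IsTreeKernel.covariance_hajekForest_comp (hT : IsTreeKernel D T) (hZ : IsIID P D Z)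
    (hk : 1 ≤ k) {n : ℕ} {g : S → ℝ} (hg : MemLp g 2 D) (i : Fin n) :
    cov[fun ω => hajekForest D T (sample Z n ω), fun ω => g (Z i ω); P]
      = (k : ℝ) / n * ∫ a, treeProj D T a * g a ∂D := by
  have ht := hT.memLp_treeProj hZ
  have hti : ∀ j : Fin n, MemLp (fun ω => treeProj D T (Z j ω)) 2 P := fun j => hZ.memLp_comp ht j
  simp only [hajekForest, sample]
  rw [covariance_const_add_left (((memLp_finsetSum _ fun j _ => hti j).const_mul _).integrable
    (by norm_num)), covariance_const_mul_left, covariance_fun_sum_left hti (hZ.memLp_comp hg i)]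
  simp_rw [hZ.covariance_comp ht hg, hT.covariance_treeProj hZ hk hg, Fin.val_inj]
  simp

/-- Stated for a general `X` because the forest and its projection have the same covariances with
the terms `treeProj D T (Z i)`. -/
lemma IsTreeKernel.covariance_hajekForest (hT : IsTreeKernel D T) (hZ : IsIID P D Z)
    {n : ℕ} (hn : 0 < n) {X : Ω → ℝ} (hX : MemLp X 2 P)
    (h : ∀ i : Fin n, cov[X, fun ω => treeProj D T (Z i ω); P] = (k : ℝ) / n * zeta D T 1) :
    cov[X, fun ω => hajekForest D T (sample Z n ω); P] = (k : ℝ) ^ 2 / n * zeta D T 1 := by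
  have hti : ∀ j : Fin n, MemLp (fun ω => treeProj D T (Z j ω)) 2 P := fun j =>
    hZ.memLp_comp (hT.memLp_treeProj hZ) j
  have hn' : (n : ℝ) ≠ 0 := by exact_mod_cast hn.ne'
  simp only [hajekForest, sample]
  rw [covariance_const_add_right (((memLp_finsetSum _ fun j _ => hti j).const_mul _).integrable
    (by norm_num)), covariance_const_mul_right, covariance_fun_sum_right hti hX]
  simp_rw [h]
  simp only [Finset.sum_const, Finset.card_univ, Fintype.card_fin, nsmul_eq_mul]
  field_simp

lemma IsTreeKernel.variance_hajekForest (hT : IsTreeKernel D T) (hZ : IsIID P D Z)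
    (hk : 1 ≤ k) {n : ℕ} (hn : 0 < n) :
    Var[fun ω => hajekForest D T (sample Z n ω); P] = (k : ℝ) ^ 2 / n * zeta D T 1 := by
  rw [← covariance_self (hT.memLp_hajekForest hZ n).1.aemeasurable]
  refine hT.covariance_hajekForest hZ hn (hT.memLp_hajekForest hZ n) fun i => ?_
  rw [hT.covariance_hajekForest_comp hZ hk (hT.memLp_treeProj hZ) i,
    hT.covariance_treeProj_self hZ hk]

/-- The covariance of the forest with its projection equals the variance of the projection, so the
difference of the two variances is the variance of the difference. -/
lemma IsTreeKernel.variance_hajekForest_le (hT : IsTreeKernel D T) (hZ : IsIID P D Z)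
    (hk : 1 ≤ k) {n : ℕ} (hkn : k ≤ n) :
    Var[fun ω => hajekForest D T (sample Z n ω); P] ≤ Var[fun ω => forest T (sample Z n ω); P] := by
  have h1 := hT.variance_hajekForest hZ hk (hk.trans hkn)
  have h2 := hT.covariance_hajekForest hZ (hk.trans hkn) (hT.memLp_forest hZ n) fun i => by
    rw [hT.covariance_forest_comp hZ hkn (hT.memLp_treeProj hZ) i,
      hT.covariance_treeProj_self hZ hk]
  have h := variance_nonneg
    (fun ω => forest T (sample Z n ω) - hajekForest D T (sample Z n ω)) P
  rw [variance_fun_sub (hT.memLp_forest hZ n) (hT.memLp_hajekForest hZ n), h2] at h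
  linarith

lemma IsTreeKernel.variance_forest_le (hT : IsTreeKernel D T) (hZ : IsIID P D Z)
    {n : ℕ} (hkn : k ≤ n) : Var[fun ω => forest T (sample Z n ω); P] ≤ zeta D T k := by
  have hc := card_embedding_pos hkn
  have hm : ∀ s : Fin k ↪ Fin n, MemLp (tree Z T (fun j => ((s j : Fin n) : ℕ))) 2 P :=
    fun s => hT.memLp_tree hZ (injective_val_comp s)
  have hvar : ∀ s : Fin k ↪ Fin n, Var[tree Z T (fun j => ((s j : Fin n) : ℕ)); P] = zeta D T k := by
    intro s
    rw [← covariance_self (hm s).1.aemeasurable, hT.covariance_tree hZ (injective_val_comp s)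
      (injective_val_comp s), Finset.inter_self,
      Finset.card_image_of_injective _ (injective_val_comp s)]
    simp
  have hcov : ∀ s s' : Fin k ↪ Fin n, cov[tree Z T (fun j => ((s j : Fin n) : ℕ)),
      tree Z T (fun j => ((s' j : Fin n) : ℕ)); P] ≤ zeta D T k := by
    intro s s'
    have h := variance_nonneg (tree Z T (fun j => ((s j : Fin n) : ℕ))
      - tree Z T (fun j => ((s' j : Fin n) : ℕ))) P
    rw [variance_sub (hm s) (hm s'), hvar, hvar] at h
    linarith
  rw [← covariance_self (hT.memLp_forest hZ n).1.aemeasurable, forest_sample,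
    covariance_fun_sum_fun_sum (fun s => (hm s).const_mul _) (fun s => (hm s).const_mul _)]
  simp_rw [covariance_const_mul_left, covariance_const_mul_right]
  calc _ ≤ ∑ _s : Fin k ↪ Fin n, ∑ _s' : Fin k ↪ Fin n,
        (Fintype.card (Fin k ↪ Fin n) : ℝ)⁻¹ * ((Fintype.card (Fin k ↪ Fin n) : ℝ)⁻¹ * zeta D T k) :=
        Finset.sum_le_sum fun s _ => Finset.sum_le_sum fun s' _ => by gcongr; exact hcov s s'
    _ = zeta D T k := by
        simp only [Finset.sum_const, Finset.card_univ, nsmul_eq_mul]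
        field_simp

end

/-! ### Convergence and boundedness in probability, expressed through a filter. -/

open scoped ENNReal

section

variable {Ω : Type*} [MeasurableSpace Ω]

/-- The filter on `ℕ × Ω` of the events whose (outer) probability tends to one: convergence along it
is convergence in probability. -/
def probFilter (P : Measure Ω) : Filter (ℕ × Ω) where
  sets := {E | Tendsto (fun n => P {ω | (n, ω) ∉ E}) atTop (𝓝 0)}
  univ_sets := by simp
  sets_of_superset := by
    intro A B hA hAB
    exact tendsto_of_tendsto_of_tendsto_of_le_of_le tendsto_const_nhds hA (fun _ => zero_le)
      fun n => measure_mono fun ω hω h => hω (hAB h)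
  inter_sets := by
    intro A B hA hB
    have h : Tendsto (fun n => P {ω | (n, ω) ∉ A} + P {ω | (n, ω) ∉ B}) atTop (𝓝 0) := by
      simpa using Tendsto.add hA hB
    refine tendsto_of_tendsto_of_tendsto_of_le_of_le tendsto_const_nhds h (fun _ => zero_le)
      fun n => (measure_mono fun ω hω => ?_).trans (measure_union_le _ _)
    exact not_and_or.1 hω

variable {P : Measure Ω}

lemma eventually_probFilter {p : ℕ × Ω → Prop} :
    (∀ᶠ x in probFilter P, p x) ↔ Tendsto (fun n => P {ω | ¬ p (n, ω)}) atTop (𝓝 0) :=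
  Iff.rfl

lemma tendsto_fst_probFilter : Tendsto Prod.fst (probFilter P) atTop := by
  intro E hE
  have : ∀ᶠ n in atTop, P {ω | ¬ (n, ω) ∈ Prod.fst ⁻¹' E} = 0 := by
    filter_upwards [hE] with n hn
    simp [hn]
  exact tendsto_const_nhds.congr' (this.mono fun n hn => hn.symm)

lemma eventually_probFilter_of_ae {p : ℕ → Ω → Prop} (h : ∀ᶠ n in atTop, ∀ᵐ ω ∂P, p n ω) :
    ∀ᶠ x in probFilter P, p x.1 x.2 :=
  eventually_probFilter.2 (tendsto_const_nhds.congr' (h.mono fun _ hn => hn.symm))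

lemma tendstoInMeasure_iff_tendsto_probFilter {E : Type*} [PseudoEMetricSpace E] {f : ℕ → Ω → E}
    {c : E} : TendstoInMeasure P f atTop (fun _ => c)
      ↔ Tendsto (fun x : ℕ × Ω => f x.1 x.2) (probFilter P) (𝓝 c) := by
  rw [Metric.nhds_basis_eball.tendsto_right_iff]
  simp only [TendstoInMeasure, eventually_probFilter, Metric.mem_eball, not_lt]

/-- Convergence in probability to `0`, from a bound with small expectation. -/
lemma tendsto_probFilter_of_lintegral_le {f : ℕ × Ω → ℝ≥0∞}
    (h : ∀ δ : ℝ≥0∞, 0 < δ → δ ≠ ∞ → ∃ r : ℕ → Ω → ℝ≥0∞, (∀ n, AEMeasurable (r n) P) ∧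
      (∀ᶠ n in atTop, ∫⁻ ω, r n ω ∂P ≤ δ) ∧ ∀ᶠ x in probFilter P, f x ≤ r x.1 x.2 + δ) :
    Tendsto f (probFilter P) (𝓝 0) := by
  rw [ENNReal.tendsto_nhds_zero]
  intro ε' hε'
  obtain ⟨ε, hε, hεε', hεtop⟩ : ∃ ε : ℝ≥0∞, 0 < ε ∧ ε ≤ ε' ∧ ε ≠ ∞ :=
    ⟨min ε' 1, lt_min hε' one_pos, min_le_left _ _, ne_top_of_le_ne_top ENNReal.one_ne_top (min_le_right _ _)⟩
  refine Eventually.mono (p := fun x => f x ≤ ε) ?_ fun x hx => hx.trans hεε'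
  rw [eventually_probFilter, ENNReal.tendsto_nhds_zero]
  intro γ' hγ'
  obtain ⟨γ, hγ, hγγ', hγtop⟩ : ∃ γ : ℝ≥0∞, 0 < γ ∧ γ ≤ γ' ∧ γ ≠ ∞ :=
    ⟨min γ' 1, lt_min hγ' one_pos, min_le_left _ _, ne_top_of_le_ne_top ENNReal.one_ne_top (min_le_right _ _)⟩
  have hε2 : ε / 2 ≠ 0 := (ENNReal.half_pos hε.ne').ne'
  have hγ2 : γ / 2 ≠ 0 := (ENNReal.half_pos hγ.ne').ne'
  have hε2' : ε / 2 ≠ ∞ := ne_top_of_le_ne_top hεtop ENNReal.half_le_self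
  have hγ2' : γ / 2 ≠ ∞ := ne_top_of_le_ne_top hγtop ENNReal.half_le_self
  -- The bound `ε / 2` absorbs the additive error; the bound `ε / 2 * (γ / 2)` on the expectation
  -- makes Markov's inequality at level `ε / 2` yield probability at most `γ / 2`.
  obtain ⟨r, hr, hr1, hr2⟩ := h (min (ε / 2) (ε / 2 * (γ / 2)))
    (lt_min (pos_iff_ne_zero.2 hε2) (pos_iff_ne_zero.2 (mul_ne_zero hε2 hγ2)))
    (ne_top_of_le_ne_top hε2' (min_le_left _ _))
  have hr3 := (ENNReal.tendsto_nhds_zero.1 (eventually_probFilter.1 hr2)) (γ / 2)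
    (pos_iff_ne_zero.2 hγ2)
  filter_upwards [hr1, hr3] with n hn1 hn3
  have hsub : {ω | ¬ f (n, ω) ≤ ε} ⊆ {ω | ¬ f (n, ω) ≤ r n ω + min (ε / 2) (ε / 2 * (γ / 2))}
      ∪ {ω | ε / 2 ≤ r n ω} := by
    intro ω hω
    by_contra hcon
    rw [Set.mem_union, not_or] at hcon
    have h1 : f (n, ω) ≤ r n ω + min (ε / 2) (ε / 2 * (γ / 2)) := not_not.1 hcon.1
    have h2 : r n ω < ε / 2 := not_le.1 hcon.2
    refine hω (h1.trans ((add_le_add h2.le (min_le_left _ _)).trans ?_))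
    rw [ENNReal.add_halves]
  have hmarkov : P {ω | ε / 2 ≤ r n ω} ≤ γ / 2 := by
    have h1 := (mul_meas_ge_le_lintegral₀ (hr n) (ε / 2)).trans (hn1.trans (min_le_right _ _))
    exact (ENNReal.mul_le_mul_iff_right hε2 hε2').1 h1
  calc P {ω | ¬ f (n, ω) ≤ ε} ≤ γ / 2 + γ / 2 :=
        (measure_mono hsub).trans ((measure_union_le _ _).trans (add_le_add hn3 hmarkov))
    _ = γ := ENNReal.add_halves γ
    _ ≤ γ' := hγγ'

lemma tendsto_zero_iff_enorm {α : Type*} {l : Filter α} {E : Type*} [SeminormedAddCommGroup E]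
    {f : α → E} : Tendsto f l (𝓝 0) ↔ Tendsto (fun x => ‖f x‖ₑ) l (𝓝 0) := by
  rw [tendsto_iff_edist_tendsto_0]
  simp

/-- Real-valued version of `tendsto_probFilter_of_lintegral_le`. -/
lemma tendsto_probFilter_of_integral_le {f : ℕ × Ω → ℝ}
    (h : ∀ δ : ℝ, 0 < δ → ∃ r : ℕ → Ω → ℝ, (∀ n, Integrable (r n) P) ∧ (∀ n ω, 0 ≤ r n ω) ∧
      (∀ᶠ n in atTop, ∫ ω, r n ω ∂P ≤ δ) ∧ ∀ᶠ x in probFilter P, |f x| ≤ r x.1 x.2 + δ) :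
    Tendsto f (probFilter P) (𝓝 0) := by
  rw [tendsto_zero_iff_enorm]
  refine tendsto_probFilter_of_lintegral_le fun δ hδ hδtop => ?_
  obtain ⟨r, hr, hr0, hr1, hr2⟩ := h δ.toReal (ENNReal.toReal_pos hδ.ne' hδtop)
  refine ⟨fun n ω => ENNReal.ofReal (r n ω), fun n => (hr n).1.aemeasurable.ennreal_ofReal,
    hr1.mono fun n hn => ?_, hr2.mono fun x hx => ?_⟩
  · rw [← ofReal_integral_eq_lintegral_ofReal (hr n) (ae_of_all _ (hr0 n))]
    exact (ENNReal.ofReal_le_ofReal hn).trans ENNReal.ofReal_toReal_le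
  · rw [← ENNReal.ofReal_toReal hδtop, ← ENNReal.ofReal_add (hr0 _ _) ENNReal.toReal_nonneg,
      ← ofReal_norm]
    exact ENNReal.ofReal_le_ofReal hx

lemma tendsto_probFilter_of_tendsto_integral {f r : ℕ → Ω → ℝ} (hr : ∀ n, Integrable (r n) P)
    (hr0 : ∀ n ω, 0 ≤ r n ω) (hlim : Tendsto (fun n => ∫ ω, r n ω ∂P) atTop (𝓝 0))
    (hf : ∀ᶠ n in atTop, ∀ ω, |f n ω| ≤ r n ω) :
    Tendsto (fun x : ℕ × Ω => f x.1 x.2) (probFilter P) (𝓝 0) := by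
  refine tendsto_probFilter_of_integral_le fun δ hδ => ⟨r, hr, hr0, hlim.eventually_le_const hδ, ?_⟩
  refine (tendsto_fst_probFilter.eventually hf).mono fun x hx => ?_
  have := hx x.2
  linarith

/-- Boundedness in probability, in the form: multiplication by `Y` preserves convergence in
probability to `0`. -/
def BddInProb (P : Measure Ω) (Y : ℕ × Ω → ℝ) : Prop :=
  ∀ X : ℕ × Ω → ℝ, Tendsto X (probFilter P) (𝓝 0) →
    Tendsto (fun x => X x * Y x) (probFilter P) (𝓝 0)

lemma BddInProb.mul {Y Y' : ℕ × Ω → ℝ} (hY : BddInProb P Y) (hY' : BddInProb P Y') :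
    BddInProb P (fun x => Y x * Y' x) := fun X hX => by
  simpa only [mul_assoc] using hY' _ (hY X hX)

lemma BddInProb.add {Y Y' : ℕ × Ω → ℝ} (hY : BddInProb P Y) (hY' : BddInProb P Y') :
    BddInProb P (fun x => Y x + Y' x) := fun X hX => by
  simpa only [mul_add, add_zero] using (hY X hX).add (hY' X hX)

lemma BddInProb.sum {ι : Type*} {A : Finset ι} {Y : ι → ℕ × Ω → ℝ} (hY : ∀ i ∈ A, BddInProb P (Y i)) :
    BddInProb P (fun x => ∑ i ∈ A, Y i x) := fun X hX => by
  simp only [Finset.mul_sum]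
  simpa using tendsto_finsetSum A fun i hi => hY i hi X hX

lemma BddInProb.of_abs_le {Y Y' : ℕ × Ω → ℝ} (hY : BddInProb P Y)
    (h : ∀ᶠ x in probFilter P, |Y' x| ≤ |Y x|) : BddInProb P Y' := fun X hX => by
  refine squeeze_zero_norm' (h.mono fun x hx => ?_)
    ((tendsto_zero_iff_norm_tendsto_zero).1 (hY X hX))
  rw [norm_mul, norm_mul]
  exact mul_le_mul_of_nonneg_left hx (norm_nonneg _)

lemma BddInProb.of_integral_le {Y r : ℕ → Ω → ℝ} (hr : ∀ n, Integrable (r n) P)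
    (hr0 : ∀ n ω, 0 ≤ r n ω) {C : ℝ} (hC : ∀ᶠ n in atTop, ∫ ω, r n ω ∂P ≤ C)
    (hY : ∀ᶠ n in atTop, ∀ ω, |Y n ω| ≤ r n ω) : BddInProb P (fun x => Y x.1 x.2) := fun X hX => by
  refine tendsto_probFilter_of_integral_le fun δ hδ => ?_
  have hc : (0 : ℝ) < δ / (|C| + 1) := by positivity
  refine ⟨fun n ω => δ / (|C| + 1) * r n ω, fun n => (hr n).const_mul _,
    fun n ω => mul_nonneg hc.le (hr0 n ω), hC.mono fun n hn => ?_, ?_⟩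
  · rw [integral_const_mul, div_mul_eq_mul_div, div_le_iff₀ (by positivity)]
    exact mul_le_mul_of_nonneg_left (hn.trans ((le_abs_self C).trans (by linarith))) hδ.le
  · have hX' : ∀ᶠ x in probFilter P, |X x| ≤ δ / (|C| + 1) := by
      have := (tendsto_zero_iff_norm_tendsto_zero.1 hX).eventually_le_const hc
      exact this
    filter_upwards [hX', tendsto_fst_probFilter.eventually hY] with x hx hy
    rw [abs_mul]
    exact (mul_le_mul hx (hy x.2) (abs_nonneg _) hc.le).trans (by linarith)

lemma BddInProb.of_integral_sq_le [IsFiniteMeasure P] {Y : ℕ → Ω → ℝ} (hY : ∀ n, MemLp (Y n) 2 P) {C : ℝ}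
    (hC : ∀ᶠ n in atTop, ∫ ω, Y n ω ^ 2 ∂P ≤ C) : BddInProb P (fun x => Y x.1 x.2) := by
  refine BddInProb.of_integral_le (r := fun n ω => Y n ω ^ 2 + 1) (C := C + P.real Set.univ)
    (fun n => (hY n).integrable_sq.add (integrable_const _)) (fun n ω => by positivity) ?_ ?_
  · filter_upwards [hC] with n hn
    rw [integral_add (hY n).integrable_sq (integrable_const _)]
    simpa using hn
  · filter_upwards with n ω
    nlinarith [sq_nonneg (|Y n ω| - 1), sq_abs (Y n ω)]

end

/-! ### Regularity of the criterion: measurability, mean score, modulus of the Hessian. -/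

section

variable {S : Type*} [MeasurableSpace S] {p : ℕ}

/-- Regularity of the population criterion of an M-estimator at `θ₀`, with envelope `h` for the
Hessian. -/
structure IsRegularCriterion (D : Measure S) (Θ : Set (EuclideanSpace ℝ (Fin p)))
    (θ₀ : EuclideanSpace ℝ (Fin p)) (m : EuclideanSpace ℝ (Fin p) → S → ℝ) (h : S → ℝ) : Prop where
  mem_interior : θ₀ ∈ interior Θ
  measurable : ∀ θ ∈ Θ, Measurable (m θ)
  integrable : ∀ θ ∈ Θ, Integrable (m θ) D
  contDiffOn : ∀ z, ContDiffOn ℝ 2 (fun θ => m θ z) (interior Θ)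
  memLp_grad : MemLp (grad m θ₀) 2 D
  integrable_env : Integrable h D
  hess_le : ∃ U ∈ 𝓝 θ₀, ∀ᵐ z ∂D, ∀ θ ∈ U, ‖hess m θ z‖ ≤ h z
  isInvertible : (∫ z, hess m θ₀ z ∂D).IsInvertible
  integral_le : ∀ θ ∈ Θ, ∫ z, m θ z ∂D ≤ ∫ z, m θ₀ z ∂D

variable {D : Measure S} [IsProbabilityMeasure D] {Θ : Set (EuclideanSpace ℝ (Fin p))}
  {θ₀ : EuclideanSpace ℝ (Fin p)} {m : EuclideanSpace ℝ (Fin p) → S → ℝ} {h : S → ℝ}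

lemma grad_eq (θ : EuclideanSpace ℝ (Fin p)) (z : S) : grad m θ z
    = (InnerProductSpace.toDual ℝ (EuclideanSpace ℝ (Fin p))).symm (fderiv ℝ (fun t => m t z) θ) :=
  rfl

lemma IsRegularCriterion.differentiableAt (H : IsRegularCriterion D Θ θ₀ m h) (z : S)
    {θ : EuclideanSpace ℝ (Fin p)} (hθ : θ ∈ interior Θ) : DifferentiableAt ℝ (fun t => m t z) θ :=
  ((H.contDiffOn z).differentiableOn (by norm_num)).differentiableAt (isOpen_interior.mem_nhds hθ)

lemma IsRegularCriterion.contDiffOn_grad (H : IsRegularCriterion D Θ θ₀ m h) (z : S) :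
    ContDiffOn ℝ 1 (fun θ => grad m θ z) (interior Θ) :=
  (InnerProductSpace.toDual ℝ (EuclideanSpace ℝ (Fin p))).symm.contDiff.comp_contDiffOn
    ((H.contDiffOn z).fderiv_of_isOpen isOpen_interior (by norm_num))

lemma IsRegularCriterion.hasFDerivAt_grad (H : IsRegularCriterion D Θ θ₀ m h) (z : S)
    {θ : EuclideanSpace ℝ (Fin p)} (hθ : θ ∈ interior Θ) :
    HasFDerivAt (fun t => grad m t z) (hess m θ z) θ :=
  (((H.contDiffOn_grad z).differentiableOn (by norm_num)).differentiableAt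
    (isOpen_interior.mem_nhds hθ)).hasFDerivAt

lemma IsRegularCriterion.continuousOn_hess (H : IsRegularCriterion D Θ θ₀ m h) (z : S) :
    ContinuousOn (fun θ => hess m θ z) (interior Θ) :=
  (H.contDiffOn_grad z).continuousOn_fderiv_of_isOpen isOpen_interior (by norm_num)

/-- Derivatives in a parameter are measurable in the other variable. -/
lemma measurable_fderiv_param {G : Type*} [NormedAddCommGroup G] [NormedSpace ℝ G]
    [FiniteDimensional ℝ G] [MeasurableSpace G] [BorelSpace G]
    {F : EuclideanSpace ℝ (Fin p) → S → G} {θ : EuclideanSpace ℝ (Fin p)}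
    (hF : ∀ᶠ t in 𝓝 θ, Measurable (F t)) (hd : ∀ z, DifferentiableAt ℝ (fun t => F t z) θ) :
    Measurable fun z => fderiv ℝ (fun t => F t z) θ := by
  have hv : ∀ v, Measurable fun z => fderiv ℝ (fun t => F t z) θ v := by
    intro v
    have hlim : Tendsto (fun j : ℕ => θ + ((j : ℝ))⁻¹ • v) atTop (𝓝 θ) := by
      simpa using ((tendsto_inv_atTop_nhds_zero_nat (𝕜 := ℝ)).smul_const v).const_add θ
    obtain ⟨J, hJ⟩ := eventually_atTop.1 (hlim.eventually hF)
    -- The directional derivative is a limit of difference quotients with step `1/(j + J)`. The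
    -- shift by `J` keeps every evaluation point in the region where `F` is measurable.
    refine measurable_of_tendsto_metrizable (f := fun (j : ℕ) z =>
      ((j + J : ℕ) : ℝ) • (F (θ + (((j + J : ℕ) : ℝ))⁻¹ • v) z - F θ z)) (fun j => ?_) ?_
    · exact ((hJ (j + J) (by omega)).sub hF.self_of_nhds).const_smul _
    · rw [tendsto_pi_nhds]
      intro z
      refine (hd z).hasFDerivAt.lim v ?_
      simp only [Real.norm_natCast]
      exact tendsto_natCast_atTop_atTop.comp (tendsto_add_atTop_nat J)
  have heq : ∀ L : EuclideanSpace ℝ (Fin p) →L[ℝ] G, L = ∑ i : Fin p,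
      ContinuousLinearMap.smulRightL ℝ _ _ (EuclideanSpace.proj i)
        (L (EuclideanSpace.basisFun (Fin p) ℝ i)) := by
    intro L
    ext v
    conv_lhs => rw [← (EuclideanSpace.basisFun (Fin p) ℝ).sum_repr v, map_sum]
    simp
  have : (fun z => fderiv ℝ (fun t => F t z) θ) = fun z => ∑ i : Fin p,
      ContinuousLinearMap.smulRightL ℝ _ _ (EuclideanSpace.proj i)
        (fderiv ℝ (fun t => F t z) θ (EuclideanSpace.basisFun (Fin p) ℝ i)) := by
    ext1 z
    exact heq _
  rw [this]
  exact Finset.measurable_fun_sum _ fun i _ => (ContinuousLinearMap.continuous _).measurable.comp (hv _)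

lemma IsRegularCriterion.measurable_fderiv (H : IsRegularCriterion D Θ θ₀ m h)
    {θ : EuclideanSpace ℝ (Fin p)} (hθ : θ ∈ interior Θ) :
    Measurable fun z => fderiv ℝ (fun t => m t z) θ := by
  refine measurable_fderiv_param ?_ fun z => H.differentiableAt z hθ
  filter_upwards [isOpen_interior.mem_nhds hθ] with t ht
  exact H.measurable t (interior_subset ht)

lemma IsRegularCriterion.measurable_grad (H : IsRegularCriterion D Θ θ₀ m h)
    {θ : EuclideanSpace ℝ (Fin p)} (hθ : θ ∈ interior Θ) : Measurable (grad m θ) :=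
  (LinearIsometryEquiv.continuous _).measurable.comp (H.measurable_fderiv hθ)

lemma IsRegularCriterion.measurable_hess (H : IsRegularCriterion D Θ θ₀ m h)
    {θ : EuclideanSpace ℝ (Fin p)} (hθ : θ ∈ interior Θ) : Measurable (hess m θ) := by
  refine measurable_fderiv_param ?_ fun z => (H.hasFDerivAt_grad z hθ).differentiableAt
  filter_upwards [isOpen_interior.mem_nhds hθ] with t ht
  exact H.measurable_grad ht

/-- A ball on which both differentiability and the envelope are available. -/
lemma IsRegularCriterion.exists_ball (H : IsRegularCriterion D Θ θ₀ m h) :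
    ∃ r : ℝ, 0 < r ∧ Metric.ball θ₀ r ⊆ interior Θ ∧
      ∀ᵐ z ∂D, ∀ θ ∈ Metric.ball θ₀ r, ‖hess m θ z‖ ≤ h z := by
  obtain ⟨U, hU, hUh⟩ := H.hess_le
  obtain ⟨r, hr, hrs⟩ := Metric.mem_nhds_iff.1
    (inter_mem (isOpen_interior.mem_nhds H.mem_interior) hU)
  exact ⟨r, hr, fun θ hθ => (hrs hθ).1, hUh.mono fun z hz θ hθ => hz θ (hrs hθ).2⟩

lemma IsRegularCriterion.norm_grad_sub_le (H : IsRegularCriterion D Θ θ₀ m h) {r : ℝ} {z : S}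
    (hr : Metric.ball θ₀ r ⊆ interior Θ) (hz : ∀ θ ∈ Metric.ball θ₀ r, ‖hess m θ z‖ ≤ h z)
    {θ : EuclideanSpace ℝ (Fin p)} (hθ : θ ∈ Metric.ball θ₀ r) :
    ‖grad m θ z - grad m θ₀ z‖ ≤ h z * ‖θ - θ₀‖ :=
  (convex_ball θ₀ r).norm_image_sub_le_of_norm_hasFDerivWithin_le
    (fun _ ht => (H.hasFDerivAt_grad z (hr ht)).hasFDerivWithinAt) hz
    (Metric.mem_ball_self ((dist_nonneg).trans_lt (Metric.mem_ball.1 hθ))) hθ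

/-- First-order condition at an interior maximum of the population criterion. Differentiation under
the integral is allowed because the Hessian envelope bounds the gradient near `θ₀` through the mean
value inequality. -/
lemma IsRegularCriterion.integral_grad (H : IsRegularCriterion D Θ θ₀ m h) :
    ∫ z, grad m θ₀ z ∂D = 0 := by
  obtain ⟨r, hr, hrΘ, hrh⟩ := H.exists_ball
  have hgi : Integrable (grad m θ₀) D := H.memLp_grad.integrable (by norm_num)
  have hder := hasFDerivAt_integral_of_dominated_of_fderiv_le (μ := D) (F := m) (x₀ := θ₀)
    (F' := fun θ z => fderiv ℝ (fun t => m t z) θ) (s := Metric.ball θ₀ r)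
    (bound := fun z => ‖grad m θ₀ z‖ + |h z| * r) (Metric.ball_mem_nhds θ₀ hr)
    (by filter_upwards [isOpen_interior.mem_nhds H.mem_interior] with _ ht
        exact (H.measurable _ (interior_subset ht)).aestronglyMeasurable)
    (H.integrable θ₀ (interior_subset H.mem_interior))
    (H.measurable_fderiv H.mem_interior).aestronglyMeasurable
    (by
      filter_upwards [hrh] with z hz θ hθ
      have h1 := H.norm_grad_sub_le hrΘ hz hθ
      have h2 : ‖fderiv ℝ (fun t => m t z) θ‖ = ‖grad m θ z‖ := by
        rw [grad_eq, LinearIsometryEquiv.norm_map]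
      have h3 : ‖θ - θ₀‖ ≤ r := (mem_ball_iff_norm.1 hθ).le
      have h4 : h z * ‖θ - θ₀‖ ≤ |h z| * r :=
        mul_le_mul (le_abs_self _) h3 (norm_nonneg _) (abs_nonneg _)
      rw [h2]
      have h5 := norm_le_norm_add_norm_sub' (grad m θ z) (grad m θ₀ z)
      linarith)
    (hgi.norm.add (H.integrable_env.abs.mul_const r))
    (ae_of_all _ fun z θ hθ => (H.differentiableAt z (hrΘ hθ)).hasFDerivAt)
  have hmax : IsLocalMax (fun θ => ∫ z, m θ z ∂D) θ₀ := by
    filter_upwards [isOpen_interior.mem_nhds H.mem_interior] with t ht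
    exact H.integral_le t (interior_subset ht)
  have h0 := hmax.hasFDerivAt_eq_zero hder
  have hfi : Integrable (fun z => fderiv ℝ (fun t => m t z) θ₀) D :=
    hgi.norm.mono' (H.measurable_fderiv H.mem_interior).aestronglyMeasurable
      (ae_of_all _ fun z => by rw [grad_eq, LinearIsometryEquiv.norm_map])
  refine ext_inner_left ℝ fun v => ?_
  rw [← integral_inner hgi, inner_zero_right]
  have h1 : ∀ z, inner ℝ v (grad m θ₀ z) = fderiv ℝ (fun t => m t z) θ₀ v := fun z => by
    rw [real_inner_comm, grad, inner_gradient_left]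
  simp_rw [h1]
  rw [← ContinuousLinearMap.integral_apply hfi, h0]
  rfl

lemma IsRegularCriterion.integrable_hess (H : IsRegularCriterion D Θ θ₀ m h) :
    Integrable (hess m θ₀) D := by
  obtain ⟨r, hr, -, hrh⟩ := H.exists_ball
  refine H.integrable_env.mono' (H.measurable_hess H.mem_interior).aestronglyMeasurable ?_
  filter_upwards [hrh] with z hz using hz θ₀ (Metric.mem_ball_self hr)

open scoped ENNReal in
/-- The local modulus of continuity of the Hessian is dominated by a function with small integral. -/
lemma IsRegularCriterion.exists_modulus (H : IsRegularCriterion D Θ θ₀ m h) {δ : ℝ≥0∞} (hδ : 0 < δ) :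
    ∃ (r : ℝ) (ω : S → ℝ≥0∞), 0 < r ∧ Metric.ball θ₀ r ⊆ interior Θ ∧ Measurable ω ∧
      ∫⁻ z, ω z ∂D ≤ δ ∧ ∀ z, ∀ θ ∈ Metric.ball θ₀ r, ‖hess m θ z - hess m θ₀ z‖ₑ ≤ ω z := by
  obtain ⟨r, hr, hrΘ, hrh⟩ := H.exists_ball
  let q := TopologicalSpace.denseSeq (EuclideanSpace ℝ (Fin p))
  have hq : DenseRange q := TopologicalSpace.denseRange_denseSeq _
  let ρ : ℕ → ℝ := fun j => r * ((j : ℝ) + 1)⁻¹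
  have hρ : ∀ j, 0 < ρ j := fun j => by positivity
  have hρr : ∀ j, ρ j ≤ r := fun j => mul_le_of_le_one_right hr.le
    (inv_le_one_of_one_le₀ (by linarith [show (0 : ℝ) ≤ j from Nat.cast_nonneg j]))
  have hball : ∀ j, Metric.ball θ₀ (ρ j) ⊆ Metric.ball θ₀ r := fun j =>
    Metric.ball_subset_ball (hρr j)
  let g : EuclideanSpace ℝ (Fin p) → S → ℝ≥0∞ := fun θ z => ‖hess m θ z - hess m θ₀ z‖ₑ
  -- A supremum over a countable dense set is measurable, and continuity of the Hessian later
  -- extends the bound to the whole ball. Its integral tends to 0 by dominated convergence, with `2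
  -- h` as dominating function.
  let ω : ℕ → S → ℝ≥0∞ := fun j z =>
    ⨆ i : ℕ, (Metric.ball θ₀ (ρ j)).indicator (fun θ => g θ z) (q i)
  have hg : ∀ z, ContinuousOn (fun θ => g θ z) (interior Θ) := fun z =>
    ((H.continuousOn_hess z).sub continuousOn_const).enorm
  have hωm : ∀ j, Measurable (ω j) := by
    refine fun j => Measurable.iSup fun i => ?_
    by_cases hi : q i ∈ Metric.ball θ₀ (ρ j)
    · simp only [Set.indicator_of_mem hi]
      exact ((H.measurable_hess (hrΘ (hball j hi))).sub (H.measurable_hess H.mem_interior)).enorm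
    · simp only [Set.indicator_of_notMem hi]
      exact measurable_const
  have hωb : ∀ j, ω j ≤ᵐ[D] fun z => ‖2 * h z‖ₑ := by
    intro j
    filter_upwards [hrh] with z hz
    refine iSup_le fun i => ?_
    by_cases hi : q i ∈ Metric.ball θ₀ (ρ j)
    · rw [Set.indicator_of_mem hi]
      have h1 := hz _ (hball j hi)
      have h2 := hz _ (Metric.mem_ball_self hr)
      refine enorm_le_iff_norm_le.2 ((norm_sub_le _ _).trans ?_)
      rw [Real.norm_of_nonneg (by linarith [norm_nonneg (hess m θ₀ z)])]
      linarith
    · rw [Set.indicator_of_notMem hi]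
      exact zero_le
  have hωlim : ∀ z, Tendsto (fun j => ω j z) atTop (𝓝 0) := by
    intro z
    rw [ENNReal.tendsto_nhds_zero]
    intro ε hε
    have hc : ContinuousAt (fun θ => g θ z) θ₀ :=
      (hg z).continuousAt (isOpen_interior.mem_nhds H.mem_interior)
    have hg0 : g θ₀ z = 0 := by
      change ‖hess m θ₀ z - hess m θ₀ z‖ₑ = 0
      rw [← edist_eq_enorm_sub, edist_self]
    have h1 : ∀ᶠ θ in 𝓝 θ₀, g θ z < ε := hc.eventually_lt_const
      (show g θ₀ z < ε by rw [hg0]; exact hε)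
    obtain ⟨d, hd, hdε⟩ := Metric.mem_nhds_iff.1 h1
    have hρlim : Tendsto ρ atTop (𝓝 0) := by
      have := (tendsto_one_div_add_atTop_nhds_zero_nat (𝕜 := ℝ)).const_mul r
      simpa [ρ] using this
    filter_upwards [hρlim.eventually_lt_const hd] with j hj
    refine iSup_le fun i => ?_
    by_cases hi : q i ∈ Metric.ball θ₀ (ρ j)
    · rw [Set.indicator_of_mem hi]
      exact (hdε (Metric.ball_subset_ball hj.le hi) : g (q i) z < ε).le
    · rw [Set.indicator_of_notMem hi]
      exact zero_le
  have hint := tendsto_lintegral_of_dominated_convergence (μ := D) (f := fun _ => 0)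
    (fun z => ‖2 * h z‖ₑ) hωm hωb
    (H.integrable_env.const_mul 2).2.ne (ae_of_all _ hωlim)
  rw [lintegral_zero] at hint
  obtain ⟨j, hj⟩ := (hint.eventually_le_const hδ).exists
  refine ⟨ρ j, ω j, hρ j, (hball j).trans hrΘ, hωm j, hj, fun z θ hθ => ?_⟩
  have hcl : θ ∈ closure (Metric.ball θ₀ (ρ j) ∩ Set.range q) :=
    hq.open_subset_closure_inter Metric.isOpen_ball hθ
  refine ContinuousWithinAt.closure_le (f := fun θ => g θ z) (g := fun _ => ω j z) hcl
    (((hg z).continuousAt (isOpen_interior.mem_nhds (hrΘ (hball j hθ)))).continuousWithinAt)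
    continuousWithinAt_const ?_
  rintro _ ⟨hθ', i, rfl⟩
  refine le_trans ?_ (le_iSup _ i)
  rw [Set.indicator_of_mem hθ']

end

/-! ### Moments and laws of large numbers for empirical means. -/

section

variable {Ω S : Type*} [MeasurableSpace Ω] [MeasurableSpace S] {P : Measure Ω}
  [IsProbabilityMeasure P] {D : Measure S} [IsProbabilityMeasure D] {Z : ℕ → Ω → S}

lemma empMean_sample {F : Type*} [AddCommGroup F] [Module ℝ F] (n : ℕ) (ω : Ω) (f : S → F) :
    empMean (sample Z n ω) f = (n : ℝ)⁻¹ • ∑ i : Fin n, f (Z i ω) := rfl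

lemma IsIID.integrable_empMean (hZ : IsIID P D Z) {g : S → ℝ} (hg : Integrable g D) (n : ℕ) :
    Integrable (fun ω => empMean (sample Z n ω) g) P := by
  simp only [empMean_sample, smul_eq_mul]
  refine Integrable.const_mul (integrable_finsetSum _ fun i _ => ?_) _
  exact (hZ.measurePreserving i).integrable_comp_of_integrable hg

lemma IsIID.integral_empMean (hZ : IsIID P D Z) {g : S → ℝ} (hg : Integrable g D) {n : ℕ}
    (hn : 1 ≤ n) : ∫ ω, empMean (sample Z n ω) g ∂P = ∫ z, g z ∂D := by
  have hn' : (n : ℝ) ≠ 0 := by exact_mod_cast (show n ≠ 0 by omega)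
  simp only [empMean_sample, smul_eq_mul]
  have hgi : ∀ i : Fin n, Integrable (fun ω => g (Z i ω)) P := fun i =>
    (hZ.measurePreserving i).integrable_comp_of_integrable hg
  rw [integral_const_mul, integral_finsetSum _ fun i _ => hgi i]
  simp_rw [hZ.integral_comp hg.1]
  simp [hn']

lemma IsIID.memLp_empMean (hZ : IsIID P D Z) {g : S → ℝ} (hg : MemLp g 2 D) (n : ℕ) :
    MemLp (fun ω => empMean (sample Z n ω) g) 2 P := by
  simp only [empMean_sample, smul_eq_mul]
  exact (memLp_finsetSum _ fun (i : Fin n) _ => hZ.memLp_comp hg i).const_mul _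

lemma IsIID.integral_sum_sq (hZ : IsIID P D Z) {g : S → ℝ} (hg : MemLp g 2 D)
    (hg0 : ∫ z, g z ∂D = 0) (n : ℕ) :
    ∫ ω, (∑ i : Fin n, g (Z i ω)) ^ 2 ∂P = n * ∫ z, g z ^ 2 ∂D := by
  have hgi : ∀ i : Fin n, MemLp (fun ω => g (Z i ω)) 2 P := fun i => hZ.memLp_comp hg i
  have hsum : MemLp (fun ω => ∑ i : Fin n, g (Z i ω)) 2 P := memLp_finsetSum _ fun i _ => hgi i
  have h0 : ∫ ω, ∑ i : Fin n, g (Z i ω) ∂P = 0 := by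
    rw [integral_finsetSum _ fun i _ => (hgi i).integrable (by norm_num)]
    simp [hZ.integral_comp hg.1, hg0]
  have hvar : cov[g, g; D] = ∫ z, g z ^ 2 ∂D := by
    rw [covariance_self hg.1.aemeasurable, variance_of_integral_eq_zero hg.1.aemeasurable hg0]
  rw [← variance_of_integral_eq_zero hsum.1.aemeasurable h0, ← covariance_self hsum.1.aemeasurable,
    covariance_fun_sum_fun_sum hgi hgi]
  simp_rw [hZ.covariance_comp hg hg, Fin.val_inj]
  simp [hvar]

lemma IsIID.integral_empMean_sq (hZ : IsIID P D Z) {g : S → ℝ} (hg : MemLp g 2 D)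
    (hg0 : ∫ z, g z ∂D = 0) {n : ℕ} (hn : 1 ≤ n) :
    ∫ ω, empMean (sample Z n ω) g ^ 2 ∂P = (n : ℝ)⁻¹ * ∫ z, g z ^ 2 ∂D := by
  have hn' : (n : ℝ) ≠ 0 := by exact_mod_cast (show n ≠ 0 by omega)
  simp only [empMean_sample, smul_eq_mul, mul_pow]
  rw [integral_const_mul, hZ.integral_sum_sq hg hg0]
  field_simp

lemma IsIID.bddInProb_sqrt_mul_empMean (hZ : IsIID P D Z) {g : S → ℝ} (hg : MemLp g 2 D)
    (hg0 : ∫ z, g z ∂D = 0) :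
    BddInProb P fun x => √(x.1 : ℝ) * empMean (sample Z x.1 x.2) g := by
  refine BddInProb.of_integral_sq_le (Y := fun n ω => √(n : ℝ) * empMean (sample Z n ω) g)
    (C := ∫ z, g z ^ 2 ∂D) (fun n => (hZ.memLp_empMean hg n).const_mul _) ?_
  filter_upwards [eventually_ge_atTop 1] with n hn
  have hn' : (n : ℝ) ≠ 0 := by exact_mod_cast (show n ≠ 0 by omega)
  simp only [mul_pow, Real.sq_sqrt (Nat.cast_nonneg n)]
  rw [integral_const_mul, hZ.integral_empMean_sq hg hg0 hn, mul_inv_cancel_left₀ hn']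

lemma IsIID.bddInProb_empMean (hZ : IsIID P D Z) {g : S → ℝ} (hg : Integrable g D)
    (hg0 : ∀ z, 0 ≤ g z) : BddInProb P fun x => empMean (sample Z x.1 x.2) g := by
  have h0 : ∀ n ω, 0 ≤ empMean (sample Z n ω) g := fun n ω =>
    smul_nonneg (by positivity) (Finset.sum_nonneg fun i _ => hg0 _)
  refine BddInProb.of_integral_le (Y := fun n ω => empMean (sample Z n ω) g)
    (fun n => hZ.integrable_empMean hg n) h0 (C := ∫ z, g z ∂D) ?_
    (Eventually.of_forall fun n ω => (abs_of_nonneg (h0 n ω)).le)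
  filter_upwards [eventually_ge_atTop 1] with n hn
  exact (hZ.integral_empMean hg hn).le

lemma exists_integral_truncation_le {g : S → ℝ} (hg : Integrable g D) {ε : ℝ} (hε : 0 < ε) :
    ∃ M : ℕ, ∫ z, {z | (M : ℝ) < |g z|}.indicator (fun z => |g z|) z ∂D ≤ ε := by
  have h := tendsto_integral_of_dominated_convergence (μ := D)
    (F := fun (M : ℕ) z => {z | (M : ℝ) < |g z|}.indicator (fun z => |g z|) z) (f := fun _ => 0)
    (fun z => |g z|) (fun M => ?_) hg.abs (fun M => ae_of_all _ fun z => ?_)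
    (ae_of_all _ fun z => ?_)
  · rw [integral_zero] at h
    exact (h.eventually_le_const hε).exists
  · exact hg.abs.1.indicator₀ (nullMeasurableSet_lt aemeasurable_const hg.abs.1.aemeasurable)
  · rw [Real.norm_eq_abs]
    by_cases hz : (M : ℝ) < |g z|
    · rw [Set.indicator_of_mem (by exact hz), abs_abs]
    · rw [Set.indicator_of_notMem (by exact hz), abs_zero]; exact abs_nonneg _
  · refine tendsto_const_nhds.congr' ?_
    obtain ⟨N, hN⟩ := exists_nat_ge |g z|
    filter_upwards [eventually_ge_atTop N] with M hM
    have : ¬ (M : ℝ) < |g z| := not_lt.2 (hN.trans (by exact_mod_cast hM))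
    rw [Set.indicator_of_notMem (by exact this)]

/-- For integrable `h`, `n⁻² ∑ h(Z_i)² → 0` in probability. -/
lemma IsIID.tendsto_sum_sq_div_sq (hZ : IsIID P D Z) {h : S → ℝ} (hh : Integrable h D) :
    Tendsto (fun x : ℕ × Ω => (x.1 : ℝ)⁻¹ * empMean (sample Z x.1 x.2) (fun z => h z ^ 2))
      (probFilter P) (𝓝 0) := by
  -- Let `g` be `|h|` where it exceeds `M` and 0 elsewhere. Then `|h| ≤ M + g`, and since the `ℓ²`
  -- norm is at most the `ℓ¹` norm, the square root is at most `M/√n + mean g`. The first term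
  -- vanishes, and the second has expectation at most `δ` for a suitable `M`; no second moment of
  -- `h` is needed.
  have hsqrt : Tendsto (fun x : ℕ × Ω =>
      √((x.1 : ℝ)⁻¹ * empMean (sample Z x.1 x.2) (fun z => h z ^ 2))) (probFilter P) (𝓝 0) := by
    refine tendsto_probFilter_of_integral_le fun δ hδ => ?_
    obtain ⟨M, hM⟩ := exists_integral_truncation_le hh hδ
    let g : S → ℝ := fun z => {z | (M : ℝ) < |h z|}.indicator (fun z => |h z|) z
    have hg0 : ∀ z, 0 ≤ g z := fun z => Set.indicator_nonneg (fun _ _ => abs_nonneg _) z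
    have hgi : Integrable g D := hh.abs.indicator₀
      (nullMeasurableSet_lt aemeasurable_const hh.abs.1.aemeasurable)
    refine ⟨fun n ω => empMean (sample Z n ω) g, fun n => hZ.integrable_empMean hgi n,
      fun n ω => smul_nonneg (by positivity) (Finset.sum_nonneg fun i _ => hg0 _), ?_, ?_⟩
    · filter_upwards [eventually_ge_atTop 1] with n hn
      rw [hZ.integral_empMean hgi hn]
      exact hM
    · have hlim : Tendsto (fun n : ℕ => (M : ℝ) * √((n : ℝ)⁻¹)) atTop (𝓝 0) := by
        have := (tendsto_inv_atTop_nhds_zero_nat (𝕜 := ℝ)).sqrt.const_mul (M : ℝ)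
        simpa using this
      filter_upwards [tendsto_fst_probFilter.eventually (hlim.eventually_le_const hδ),
        tendsto_fst_probFilter.eventually (eventually_ge_atTop 1)] with x hx hx1
      have hn : (0 : ℝ) < x.1 := by exact_mod_cast hx1
      rw [abs_of_nonneg (Real.sqrt_nonneg _)]
      have hle : ∀ z, |h z| ≤ M + g z := fun z => by
        by_cases hz : (M : ℝ) < |h z|
        · simp only [g]
          rw [Set.indicator_of_mem (by exact hz)]
          linarith [show (0 : ℝ) ≤ M from Nat.cast_nonneg M]
        · linarith [hg0 z]
      have hs1 : √(∑ i : Fin x.1, h (Z i x.2) ^ 2)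
          ≤ √(∑ _i : Fin x.1, (M : ℝ) ^ 2) + ∑ i : Fin x.1, g (Z i x.2) := by
        have hS : 0 ≤ ∑ i : Fin x.1, g (Z i x.2) := Finset.sum_nonneg fun i _ => hg0 _
        refine Real.sqrt_le_iff.2 ⟨by positivity, ?_⟩
        have h1 : ∑ i : Fin x.1, h (Z i x.2) ^ 2 ≤ ∑ i : Fin x.1,
            ((M : ℝ) ^ 2 + 2 * (M * g (Z i x.2)) + g (Z i x.2) ^ 2) := by
          refine Finset.sum_le_sum fun i _ => ?_
          have := pow_le_pow_left₀ (abs_nonneg _) (hle (Z i x.2)) 2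
          rw [sq_abs] at this
          linarith
        refine h1.trans ?_
        rw [Finset.sum_add_distrib, Finset.sum_add_distrib, ← Finset.mul_sum, ← Finset.mul_sum]
        have h2 : ∑ i : Fin x.1, g (Z i x.2) ^ 2 ≤ (∑ i : Fin x.1, g (Z i x.2)) ^ 2 :=
          Finset.sum_sq_le_sq_sum_of_nonneg fun i _ => hg0 _
        have h3 : (M : ℝ) ≤ √(∑ _i : Fin x.1, (M : ℝ) ^ 2) := by
          refine Real.le_sqrt_of_sq_le ?_
          simp only [Finset.sum_const, Finset.card_univ, Fintype.card_fin, nsmul_eq_mul]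
          refine le_mul_of_one_le_left (sq_nonneg _) (by exact_mod_cast hx1)
        have h4 := Real.sq_sqrt (show 0 ≤ ∑ _i : Fin x.1, (M : ℝ) ^ 2 by positivity)
        have h5 := mul_le_mul_of_nonneg_right h3 hS
        nlinarith
      have e1 : √((x.1 : ℝ)⁻¹ * empMean (sample Z x.1 x.2) (fun z => h z ^ 2))
          = (x.1 : ℝ)⁻¹ * √(∑ i : Fin x.1, h (Z i x.2) ^ 2) := by
        rw [empMean_sample, smul_eq_mul, ← mul_assoc, Real.sqrt_mul (by positivity),
          Real.sqrt_mul_self (by positivity)]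
      have e2 : (x.1 : ℝ)⁻¹ * √(∑ _i : Fin x.1, (M : ℝ) ^ 2) = M * √((x.1 : ℝ)⁻¹) := by
        simp only [Finset.sum_const, Finset.card_univ, Fintype.card_fin, nsmul_eq_mul]
        rw [Real.sqrt_mul hn.le, Real.sqrt_sq (Nat.cast_nonneg M), Real.sqrt_inv]
        have := Real.mul_self_sqrt hn.le
        have hs : √(x.1 : ℝ) ≠ 0 := (Real.sqrt_pos.2 hn).ne'
        field_simp
        rw [pow_two, this]
      rw [e1]
      refine (mul_le_mul_of_nonneg_left hs1 (by positivity)).trans ?_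
      rw [mul_add, e2]
      simp only [empMean_sample, smul_eq_mul]
      linarith
  have := hsqrt.pow 2
  simp only [ne_eq, OfNat.ofNat_ne_zero, not_false_eq_true, zero_pow] at this
  refine this.congr fun x => Real.sq_sqrt (mul_nonneg (by positivity)
    (smul_nonneg (by positivity) (Finset.sum_nonneg fun i _ => sq_nonneg _)))

/-- Weak law of large numbers along `probFilter`. -/
lemma IsIID.tendsto_empMean (hZ : IsIID P D Z) {F : Type*} [NormedAddCommGroup F]
    [NormedSpace ℝ F] [CompleteSpace F] [MeasurableSpace F] [BorelSpace F] {f : S → F}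
    (hf : Measurable f) (hfi : Integrable f D) :
    Tendsto (fun x : ℕ × Ω => empMean (sample Z x.1 x.2) f) (probFilter P) (𝓝 (∫ z, f z ∂D)) := by
  have hint : ∀ i, Integrable (fun ω => f (Z i ω)) P := fun i =>
    (hZ.measurePreserving i).integrable_comp_of_integrable hfi
  have hid : ∀ i, IdentDistrib (fun ω => f (Z i ω)) (fun ω => f (Z 0 ω)) P P := fun i =>
    (IdentDistrib.mk (hZ.measurable i).aemeasurable (hZ.measurable 0).aemeasurable
      (by rw [hZ.law, hZ.law])).comp hf
  have hslln := strong_law_ae (μ := P) (fun i ω => f (Z i ω)) (hint 0)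
    (fun i j hij => (hZ.indep.indepFun hij).comp hf hf) hid
  have hmean : ∫ ω, f (Z 0 ω) ∂P = ∫ z, f z ∂D := by
    conv_rhs => rw [← hZ.law 0]
    rw [integral_map (hZ.measurable 0).aemeasurable (by rw [hZ.law 0]; exact hfi.1)]
  rw [← hmean]
  refine tendstoInMeasure_iff_tendsto_probFilter (f := fun n ω => empMean (sample Z n ω) f).1 ?_
  refine tendstoInMeasure_of_tendsto_ae (fun n => ?_) ?_
  · simp only [empMean_sample]
    have : Integrable (fun ω => ∑ i : Fin n, f (Z i ω)) P :=
      integrable_finsetSum _ fun i _ => hint i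
    exact (this.1.const_smul _)
  · filter_upwards [hslln] with ω hω
    refine hω.congr fun n => ?_
    rw [empMean_sample, Fin.sum_univ_eq_sum_range (fun i => f (Z i ω)) n]

end

/-! ### Asymptotic linearity of the M-estimator and its directional derivatives. -/

open Asymptotics
open scoped ENNReal

section

variable {Ω S : Type*} [MeasurableSpace Ω] [MeasurableSpace S] {P : Measure Ω}
  [IsProbabilityMeasure P] {D : Measure S} [IsProbabilityMeasure D] {Z : ℕ → Ω → S} {p : ℕ}
  {Θ : Set (EuclideanSpace ℝ (Fin p))} {θ₀ : EuclideanSpace ℝ (Fin p)}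
  {m : EuclideanSpace ℝ (Fin p) → S → ℝ} {h : S → ℝ}
  {th : ℕ × Ω → EuclideanSpace ℝ (Fin p)}

lemma enorm_empMean_sub_le {F : Type*} [NormedAddCommGroup F] [NormedSpace ℝ F] {n : ℕ}
    (hn : 1 ≤ n) (z : Fin n → S) (f g : S → F) :
    ‖empMean z f - empMean z g‖ₑ ≤ (n : ℝ≥0∞)⁻¹ * ∑ i, ‖f (z i) - g (z i)‖ₑ := by
  have hn' : ‖(n : ℝ)⁻¹‖ₑ = (n : ℝ≥0∞)⁻¹ := by
    rw [enorm_inv (by exact_mod_cast (show n ≠ 0 by omega))]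
    simp
  rw [empMean, empMean, ← smul_sub, ← Finset.sum_sub_distrib, enorm_smul, hn']
  gcongr
  exact enorm_sum_le _ _

/-- Uniform closeness of the empirical Hessians on shrinking neighbourhoods of `θ₀`. -/
lemma IsRegularCriterion.hess_uniform (H : IsRegularCriterion D Θ θ₀ m h) (hZ : IsIID P D Z)
    (hth : Tendsto th (probFilter P) (𝓝 θ₀)) {ε : ℝ} (hε : 0 < ε) :
    ∀ᶠ x in probFilter P, ∀ θ ∈ Metric.closedBall θ₀ ‖th x - θ₀‖,
      ‖empMean (sample Z x.1 x.2) (hess m θ) - empMean (sample Z x.1 x.2) (hess m θ₀)‖ ≤ ε := by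
  -- This supremum need not be measurable in the sample. It suffices that it is dominated by the
  -- empirical mean of the modulus `w`, since `probFilter` is built from outer probabilities.
  have key : Tendsto (fun x : ℕ × Ω => ⨆ θ ∈ Metric.closedBall θ₀ ‖th x - θ₀‖,
      ‖empMean (sample Z x.1 x.2) (hess m θ) - empMean (sample Z x.1 x.2) (hess m θ₀)‖ₑ)
      (probFilter P) (𝓝 0) := by
    refine tendsto_probFilter_of_lintegral_le fun δ hδ _ => ?_
    obtain ⟨r, w, hr, -, hw, hwδ, hwb⟩ := H.exists_modulus hδ
    have hwi : ∀ i : ℕ, Measurable fun ω => w (Z i ω) := fun i => hw.comp (hZ.measurable i)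
    have hws : ∀ n : ℕ, Measurable fun ω => ∑ i : Fin n, w (Z i ω) := fun n =>
      Finset.measurable_fun_sum _ fun i _ => hwi i
    refine ⟨fun n ω => (n : ℝ≥0∞)⁻¹ * ∑ i : Fin n, w (Z i ω), fun n =>
      ((hws n).const_mul _).aemeasurable, ?_, ?_⟩
    · refine Eventually.of_forall fun n => ?_
      rw [lintegral_const_mul _ (hws n),
        lintegral_finsetSum _ fun (i : Fin n) _ => hwi i]
      have : ∀ i : Fin n, ∫⁻ ω, w (Z i ω) ∂P = ∫⁻ z, w z ∂D := fun i =>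
        (hZ.measurePreserving i).lintegral_comp hw
      simp_rw [this]
      rw [Finset.sum_const, Finset.card_univ, Fintype.card_fin, nsmul_eq_mul, ← mul_assoc]
      refine le_trans ?_ hwδ
      exact mul_le_of_le_one_left zero_le (ENNReal.inv_mul_le_one _)
    · have hball := hth.eventually (Metric.ball_mem_nhds θ₀ hr)
      filter_upwards [hball, tendsto_fst_probFilter.eventually (eventually_ge_atTop 1)] with x hx hx1
      refine le_trans (iSup₂_le fun θ hθ => ?_) le_self_add
      refine (enorm_empMean_sub_le hx1 _ _ _).trans ?_
      gcongr with i
      refine hwb _ θ ?_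
      rw [Metric.mem_closedBall, ← dist_eq_norm] at hθ
      exact lt_of_le_of_lt hθ hx
  filter_upwards [key.eventually_le_const (ENNReal.ofReal_pos.2 hε)] with x hx θ hθ
  have h1 := (le_iSup₂ (f := fun θ (_ : θ ∈ Metric.closedBall θ₀ ‖th x - θ₀‖) =>
    ‖empMean (sample Z x.1 x.2) (hess m θ) - empMean (sample Z x.1 x.2) (hess m θ₀)‖ₑ) θ hθ).trans hx
  rw [← ofReal_norm, ENNReal.ofReal_le_ofReal_iff hε.le] at h1
  exact h1

lemma IsRegularCriterion.tendsto_hess (H : IsRegularCriterion D Θ θ₀ m h) (hZ : IsIID P D Z)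
    (hth : Tendsto th (probFilter P) (𝓝 θ₀)) :
    Tendsto (fun x => empMean (sample Z x.1 x.2) (hess m (th x))) (probFilter P)
      (𝓝 (∫ z, hess m θ₀ z ∂D)) := by
  have h1 := hZ.tendsto_empMean (H.measurable_hess H.mem_interior) H.integrable_hess
  have h2 : Tendsto (fun x => empMean (sample Z x.1 x.2) (hess m (th x))
      - empMean (sample Z x.1 x.2) (hess m θ₀)) (probFilter P) (𝓝 0) := by
    rw [Metric.nhds_basis_closedBall.tendsto_right_iff]
    intro ε hε
    filter_upwards [H.hess_uniform hZ hth hε] with x hx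
    rw [mem_closedBall_zero_iff]
    exact hx _ (by rw [Metric.mem_closedBall, dist_eq_norm])
  simpa using h2.add h1

lemma IsRegularCriterion.hasFDerivAt_empMean_grad (H : IsRegularCriterion D Θ θ₀ m h) {n : ℕ}
    (z : Fin n → S) {θ : EuclideanSpace ℝ (Fin p)} (hθ : θ ∈ interior Θ) :
    HasFDerivAt (fun t => empMean z (grad m t)) (empMean z (hess m θ)) θ :=
  HasFDerivAt.const_smul (f := fun t => ∑ i, grad m t (z i))
    (HasFDerivAt.fun_sum fun i _ => H.hasFDerivAt_grad (z i) hθ) (n : ℝ)⁻¹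

/-- The score equation, linearized. -/
lemma IsRegularCriterion.score_isLittleO (H : IsRegularCriterion D Θ θ₀ m h) (hZ : IsIID P D Z)
    (hth : Tendsto th (probFilter P) (𝓝 θ₀))
    (hfoc : ∀ᶠ x in probFilter P, empMean (sample Z x.1 x.2) (grad m (th x)) = 0) :
    (fun x => empMean (sample Z x.1 x.2) (grad m θ₀) + (∫ z, hess m θ₀ z ∂D) (th x - θ₀))
      =o[probFilter P] fun x => th x - θ₀ := by
  rw [isLittleO_iff]
  intro c hc
  obtain ⟨r, hr, hrΘ, -⟩ := H.exists_ball
  have hlln := (hZ.tendsto_empMean (H.measurable_hess H.mem_interior) H.integrable_hess).eventually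
    (Metric.closedBall_mem_nhds _ (half_pos hc))
  filter_upwards [hlln, H.hess_uniform hZ hth (half_pos hc), hfoc,
    hth.eventually (Metric.ball_mem_nhds θ₀ hr)] with x hx1 hx2 hx3 hx4
  have hsub : Metric.closedBall θ₀ ‖th x - θ₀‖ ⊆ interior Θ := by
    refine subset_trans ?_ hrΘ
    refine Metric.closedBall_subset_ball ?_
    rw [← dist_eq_norm]
    exact hx4
  have hmv := (convex_closedBall θ₀ ‖th x - θ₀‖).norm_image_sub_le_of_norm_hasFDerivWithin_le'
    (fun t ht => (H.hasFDerivAt_empMean_grad (sample Z x.1 x.2) (hsub ht)).hasFDerivWithinAt) hx2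
    (Metric.mem_closedBall_self (norm_nonneg _))
    (show th x ∈ Metric.closedBall θ₀ ‖th x - θ₀‖ by rw [Metric.mem_closedBall, dist_eq_norm])
  rw [hx3, zero_sub] at hmv
  rw [dist_eq_norm] at hx1
  have hop := ContinuousLinearMap.le_of_opNorm_le _ hx1 (th x - θ₀)
  rw [sub_apply] at hop
  have heq : empMean (sample Z x.1 x.2) (grad m θ₀) + (∫ z, hess m θ₀ z ∂D) (th x - θ₀)
      = -(-empMean (sample Z x.1 x.2) (grad m θ₀)
        - empMean (sample Z x.1 x.2) (hess m θ₀) (th x - θ₀))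
      - (empMean (sample Z x.1 x.2) (hess m θ₀) (th x - θ₀)
        - (∫ z, hess m θ₀ z ∂D) (th x - θ₀)) := by abel
  rw [heq]
  refine (norm_sub_le _ _).trans ?_
  rw [norm_neg]
  linarith

/-- The M-estimator is asymptotically linear. -/
lemma IsRegularCriterion.estimator_isLittleO (H : IsRegularCriterion D Θ θ₀ m h) (hZ : IsIID P D Z)
    (hth : Tendsto th (probFilter P) (𝓝 θ₀))
    (hfoc : ∀ᶠ x in probFilter P, empMean (sample Z x.1 x.2) (grad m (th x)) = 0) :
    (fun x => th x - θ₀) =O[probFilter P] (fun x => empMean (sample Z x.1 x.2) (grad m θ₀)) ∧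
    (fun x => (th x - θ₀) +
      (∫ z, hess m θ₀ z ∂D).inverse (empMean (sample Z x.1 x.2) (grad m θ₀)))
      =o[probFilter P] (fun x => empMean (sample Z x.1 x.2) (grad m θ₀)) := by
  set A := ∫ z, hess m θ₀ z ∂D with hA
  have hinv := H.isInvertible.inverse_comp_self
  have h1 : (fun x => (th x - θ₀) + A.inverse (empMean (sample Z x.1 x.2) (grad m θ₀)))
      =o[probFilter P] fun x => th x - θ₀ := by
    refine ((A.inverse.isBigO_comp _ _).trans_isLittleO (H.score_isLittleO hZ hth hfoc)).congr_left
      fun x => ?_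
    rw [map_add, add_comm]
    congr 1
    exact congrArg (fun L => L (th x - θ₀)) hinv
  -- The remainder is small relative to `th x - θ₀` itself and can be absorbed, so the rate is that
  -- of the score without any prior bound on the error.
  have h2 : (fun x => th x - θ₀) =O[probFilter P]
      (fun x => empMean (sample Z x.1 x.2) (grad m θ₀)) := by
    have h3 := h1.right_isBigO_sub
    simp only [sub_add_cancel_left] at h3
    exact h3.trans (((A.inverse.isBigO_comp _ _)).neg_left)
  exact ⟨h2, h1.trans_isBigO h2⟩

lemma IsRegularCriterion.memLp_inner_grad (H : IsRegularCriterion D Θ θ₀ m h)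
    (L : EuclideanSpace ℝ (Fin p) →L[ℝ] ℝ) : MemLp (fun z => L (grad m θ₀ z)) 2 D :=
  L.comp_memLp' H.memLp_grad

lemma IsRegularCriterion.integral_clm_grad (H : IsRegularCriterion D Θ θ₀ m h)
    (L : EuclideanSpace ℝ (Fin p) →L[ℝ] ℝ) : ∫ z, L (grad m θ₀ z) ∂D = 0 := by
  rw [L.integral_comp_comm (H.memLp_grad.integrable (by norm_num)), H.integral_grad, map_zero]

lemma clm_empMean {F G : Type*} [NormedAddCommGroup F] [NormedSpace ℝ F] [NormedAddCommGroup G]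
    [NormedSpace ℝ G] (L : F →L[ℝ] G) {n : ℕ} (z : Fin n → S) (f : S → F) :
    L (empMean z f) = empMean z fun s => L (f s) := by
  simp [empMean, map_sum]

/-- Each coordinate of the score is a centred square-integrable mean, and the Euclidean norm is at
most the sum of the absolute coordinates. -/
lemma IsRegularCriterion.bddInProb_score (H : IsRegularCriterion D Θ θ₀ m h) (hZ : IsIID P D Z) :
    BddInProb P fun x => √(x.1 : ℝ) * ‖empMean (sample Z x.1 x.2) (grad m θ₀)‖ := by
  have h1 : ∀ l : Fin p, BddInProb P fun x => |√(x.1 : ℝ) *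
      EuclideanSpace.proj l (empMean (sample Z x.1 x.2) (grad m θ₀))| := by
    intro l
    have := hZ.bddInProb_sqrt_mul_empMean (P := P)
      (H.memLp_inner_grad (EuclideanSpace.proj (𝕜 := ℝ) l))
      (H.integral_clm_grad (EuclideanSpace.proj (𝕜 := ℝ) l))
    refine this.of_abs_le (Eventually.of_forall fun x => ?_)
    rw [abs_abs, clm_empMean]
  refine (BddInProb.sum (A := Finset.univ) fun l _ => h1 l).of_abs_le
    (Eventually.of_forall fun x => ?_)
  rw [abs_of_nonneg (mul_nonneg (Real.sqrt_nonneg _) (norm_nonneg _)),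
    abs_of_nonneg (Finset.sum_nonneg fun l _ => abs_nonneg _)]
  simp_rw [abs_mul, abs_of_nonneg (Real.sqrt_nonneg _)]
  rw [← Finset.mul_sum]
  refine mul_le_mul_of_nonneg_left ?_ (Real.sqrt_nonneg _)
  conv_lhs => rw [← (EuclideanSpace.basisFun (Fin p) ℝ).sum_repr
    (empMean (sample Z x.1 x.2) (grad m θ₀))]
  refine (norm_sum_le _ _).trans (Finset.sum_le_sum fun l _ => ?_)
  rw [norm_smul]
  simp

/-- The influence function at `θ₀` of a differentiable functional of the M-estimator. -/
def influence (D : Measure S) (θ₀ : EuclideanSpace ℝ (Fin p))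
    (m : EuclideanSpace ℝ (Fin p) → S → ℝ) (f : EuclideanSpace ℝ (Fin p) → ℝ) (z : S) : ℝ :=
  - fderiv ℝ f θ₀ ((∫ z, hess m θ₀ z ∂D).inverse (grad m θ₀ z))

lemma influence_eq (f : EuclideanSpace ℝ (Fin p) → ℝ) : influence D θ₀ m f = fun z =>
    (-(fderiv ℝ f θ₀ ∘L (∫ z, hess m θ₀ z ∂D).inverse)) (grad m θ₀ z) := rfl

lemma IsRegularCriterion.memLp_influence (H : IsRegularCriterion D Θ θ₀ m h)
    (f : EuclideanSpace ℝ (Fin p) → ℝ) : MemLp (influence D θ₀ m f) 2 D := by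
  rw [influence_eq]
  exact H.memLp_inner_grad _

lemma IsRegularCriterion.integral_influence (H : IsRegularCriterion D Θ θ₀ m h)
    (f : EuclideanSpace ℝ (Fin p) → ℝ) : ∫ z, influence D θ₀ m f z ∂D = 0 := by
  rw [influence_eq]
  exact H.integral_clm_grad _

lemma tendsto_mul_of_isLittleO {f : ℕ × Ω → ℝ} {F : Type*} [NormedAddCommGroup F] {g : ℕ × Ω → F}
    (hf : f =o[probFilter P] g) (hg : BddInProb P fun x => √(x.1 : ℝ) * ‖g x‖) :
    Tendsto (fun x => √(x.1 : ℝ) * f x) (probFilter P) (𝓝 0) := by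
  have h0 : Tendsto (fun x => f x / ‖g x‖) (probFilter P) (𝓝 0) :=
    (hf.norm_right).tendsto_div_nhds_zero
  refine (hg _ h0).congr' ?_
  -- Where `g x = 0` the quotient carries no information, but there `f x` vanishes as well.
  filter_upwards [hf.isBigO.eq_zero_imp] with x hx
  by_cases hgx : g x = 0
  · simp [hx hgx]
  · have : ‖g x‖ ≠ 0 := norm_ne_zero_iff.2 hgx
    field_simp

/-- The delta method for the M-estimator. -/
lemma IsRegularCriterion.tendsto_delta (H : IsRegularCriterion D Θ θ₀ m h) (hZ : IsIID P D Z)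
    (hth : Tendsto th (probFilter P) (𝓝 θ₀))
    (hfoc : ∀ᶠ x in probFilter P, empMean (sample Z x.1 x.2) (grad m (th x)) = 0)
    {f : EuclideanSpace ℝ (Fin p) → ℝ} (hf : DifferentiableAt ℝ f θ₀) :
    Tendsto (fun x => √(x.1 : ℝ) * (f (th x) - f θ₀
      - empMean (sample Z x.1 x.2) (influence D θ₀ m f))) (probFilter P) (𝓝 0) := by
  obtain ⟨hO, ho⟩ := H.estimator_isLittleO hZ hth hfoc
  refine tendsto_mul_of_isLittleO (g := fun x => empMean (sample Z x.1 x.2) (grad m θ₀)) ?_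
    (H.bddInProb_score hZ)
  have h1 := (hf.hasFDerivAt.isLittleO.comp_tendsto hth).trans_isBigO hO
  have h2 := ((fderiv ℝ f θ₀).isBigO_comp _ _).trans_isLittleO ho
  refine (h1.add h2).congr_left fun x => ?_
  rw [influence_eq, ← clm_empMean]
  simp only [Function.comp_apply, map_add, neg_apply, ContinuousLinearMap.comp_apply]
  ring

/-- The squared error of the estimated directional derivatives is negligible on average. -/
lemma IsRegularCriterion.tendsto_mean_sq_dirDeriv (H : IsRegularCriterion D Θ θ₀ m h)
    (hZ : IsIID P D Z) (hth : Tendsto th (probFilter P) (𝓝 θ₀))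
    (hfoc : ∀ᶠ x in probFilter P, empMean (sample Z x.1 x.2) (grad m (th x)) = 0)
    {X : Type*} {η : EuclideanSpace ℝ (Fin p) → X → ℝ} {x₁ : X}
    (hη : ContDiffOn ℝ 1 (fun θ => η θ x₁) (interior Θ)) :
    Tendsto (fun x : ℕ × Ω => (x.1 : ℝ)⁻¹ * ∑ i : Fin x.1,
      (mestDirDeriv m η x₁ (sample Z x.1 x.2) (th x) i
        - influence D θ₀ m (fun θ => η θ x₁) (Z i x.2)) ^ 2) (probFilter P) (𝓝 0) := by
  obtain ⟨r, hr, hrΘ, hrh⟩ := H.exists_ball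
  let A : ℕ × Ω → EuclideanSpace ℝ (Fin p) →L[ℝ] ℝ := fun x =>
    fderiv ℝ (fun θ => η θ x₁) (th x) ∘L (empMean (sample Z x.1 x.2) (hess m (th x))).inverse
  let A₀ : EuclideanSpace ℝ (Fin p) →L[ℝ] ℝ :=
    fderiv ℝ (fun θ => η θ x₁) θ₀ ∘L (∫ z, hess m θ₀ z ∂D).inverse
  have hA : Tendsto A (probFilter P) (𝓝 A₀) := by
    have h1 : Tendsto (fun x => fderiv ℝ (fun θ => η θ x₁) (th x)) (probFilter P)
        (𝓝 (fderiv ℝ (fun θ => η θ x₁) θ₀)) :=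
      ((hη.continuousOn_fderiv_of_isOpen isOpen_interior (by norm_num)).continuousAt
        (isOpen_interior.mem_nhds H.mem_interior)).tendsto.comp hth
    have h2 := (H.isInvertible.contDiffAt_map_inverse (n := 0)).continuousAt.tendsto.comp
      (H.tendsto_hess hZ hth)
    exact ((continuous_fst.clm_comp continuous_snd).tendsto (_, _)).comp (h1.prodMk_nhds h2)
  obtain ⟨hO, -⟩ := H.estimator_isLittleO hZ hth hfoc
  have hbdd : BddInProb P fun x => √(x.1 : ℝ) * ‖th x - θ₀‖ := by
    obtain ⟨c, hc⟩ := hO.bound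
    have hs := H.bddInProb_score hZ
    have hcs : BddInProb P fun x =>
        c * (√(x.1 : ℝ) * ‖empMean (sample Z x.1 x.2) (grad m θ₀)‖) := fun Y hY => by
      have := (hs Y hY).const_mul c
      rw [mul_zero] at this
      refine this.congr fun x => by ring
    refine hcs.of_abs_le (hc.mono fun x hx => ?_)
    rw [abs_of_nonneg (by positivity)]
    refine le_trans ?_ (le_abs_self _)
    have := mul_le_mul_of_nonneg_left hx (Real.sqrt_nonneg (x.1 : ℝ))
    linarith
  have hgi : Integrable (fun z => ‖grad m θ₀ z‖ ^ 2) D := H.memLp_grad.norm.integrable_sq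
  -- Error from evaluating the gradient at `th x`: the mean value inequality leaves `‖th x - θ₀‖²`
  -- times the mean of `h²`, which may have infinite expectation. The factor `n` is moved so that `n
  -- ‖th x - θ₀‖²` is bounded in probability and `n⁻¹ · mean h²` tends to 0.
  have hlim1 : Tendsto (fun x : ℕ × Ω => 2 * ‖A x‖ ^ 2 *
      ((x.1 : ℝ)⁻¹ * empMean (sample Z x.1 x.2) (fun z => h z ^ 2)
        * ((√(x.1 : ℝ) * ‖th x - θ₀‖) * (√(x.1 : ℝ) * ‖th x - θ₀‖)))) (probFilter P) (𝓝 0) := by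
    have h1 := (hbdd.mul hbdd) _ (hZ.tendsto_sum_sq_div_sq H.integrable_env)
    simpa using ((hA.norm.pow 2).const_mul 2).mul h1
  -- Error from estimating the linear functional applied to the gradients at `θ₀`.
  have hlim2 : Tendsto (fun x : ℕ × Ω => 2 * (‖A x - A₀‖ ^ 2 *
      empMean (sample Z x.1 x.2) (fun z => ‖grad m θ₀ z‖ ^ 2))) (probFilter P) (𝓝 0) := by
    have h0 : Tendsto (fun x => ‖A x - A₀‖ ^ 2) (probFilter P) (𝓝 0) := by
      have := (hA.sub_const A₀).norm.pow 2
      simpa using this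
    simpa using ((hZ.bddInProb_empMean hgi fun z => sq_nonneg _) _ h0).const_mul 2
  have henv : ∀ᶠ x in probFilter P, ∀ i : ℕ, ∀ θ ∈ Metric.ball θ₀ r,
      ‖hess m θ (Z i x.2)‖ ≤ h (Z i x.2) := by
    refine eventually_probFilter_of_ae
      (p := fun _ ω => ∀ i : ℕ, ∀ θ ∈ Metric.ball θ₀ r, ‖hess m θ (Z i ω)‖ ≤ h (Z i ω)) ?_
    exact Eventually.of_forall fun _ => ae_all_iff.2 fun i =>
      (hZ.measurePreserving i).quasiMeasurePreserving.ae hrh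
  refine squeeze_zero_norm' ?_ (by simpa using hlim1.add hlim2)
  filter_upwards [henv, hth.eventually (Metric.ball_mem_nhds θ₀ hr),
    tendsto_fst_probFilter.eventually (eventually_ge_atTop 1)] with x hx1 hx2 hx3
  have hn : (0 : ℝ) < x.1 := by exact_mod_cast hx3
  rw [Real.norm_of_nonneg (mul_nonneg (by positivity) (Finset.sum_nonneg fun i _ => sq_nonneg _))]
  have hterm : ∀ i : Fin x.1, (mestDirDeriv m η x₁ (sample Z x.1 x.2) (th x) i
        - influence D θ₀ m (fun θ => η θ x₁) (Z i x.2)) ^ 2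
      ≤ 2 * ‖A x‖ ^ 2 * ‖th x - θ₀‖ ^ 2 * h (Z i x.2) ^ 2
        + 2 * ‖A x - A₀‖ ^ 2 * ‖grad m θ₀ (Z i x.2)‖ ^ 2 := by
    intro i
    have e : mestDirDeriv m η x₁ (sample Z x.1 x.2) (th x) i
        - influence D θ₀ m (fun θ => η θ x₁) (Z i x.2)
        = - (A x (grad m (th x) (Z i x.2) - grad m θ₀ (Z i x.2))
          + (A x - A₀) (grad m θ₀ (Z i x.2))) := by
      simp only [mestDirDeriv, influence, inner_gradient_left, A, A₀, map_sub, sub_apply,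
        ContinuousLinearMap.comp_apply, sample]
      ring
    have b1 : |A x (grad m (th x) (Z i x.2) - grad m θ₀ (Z i x.2))|
        ≤ ‖A x‖ * (h (Z i x.2) * ‖th x - θ₀‖) :=
      ((A x).le_opNorm _).trans (mul_le_mul_of_nonneg_left
        (H.norm_grad_sub_le hrΘ (hx1 i) hx2) (norm_nonneg _))
    have b2 : |(A x - A₀) (grad m θ₀ (Z i x.2))| ≤ ‖A x - A₀‖ * ‖grad m θ₀ (Z i x.2)‖ :=
      (A x - A₀).le_opNorm _
    rw [e, neg_sq]
    have c1 := sq_le_sq' (by linarith [(abs_le.1 b1).1]) (abs_le.1 b1).2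
    have c2 := sq_le_sq' (by linarith [(abs_le.1 b2).1]) (abs_le.1 b2).2
    refine (add_sq_le).trans ?_
    rw [mul_pow, mul_pow] at c1
    rw [mul_pow] at c2
    linarith
  refine (mul_le_mul_of_nonneg_left (Finset.sum_le_sum fun i _ => hterm i) (by positivity)).trans
    (le_of_eq ?_)
  rw [Finset.sum_add_distrib, ← Finset.mul_sum, ← Finset.mul_sum]
  simp only [empMean_sample, smul_eq_mul]
  have hs := Real.mul_self_sqrt hn.le
  have e3 : √(x.1 : ℝ) * ‖th x - θ₀‖ * (√(x.1 : ℝ) * ‖th x - θ₀‖) = x.1 * ‖th x - θ₀‖ ^ 2 := by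
    rw [mul_mul_mul_comm, hs, pow_two]
  rw [e3]
  field_simp

end

/-! ### Consistency, the score equation, and a weak law for triangular arrays. -/

section

variable {Ω S : Type*} [MeasurableSpace Ω] [MeasurableSpace S] {P : Measure Ω}
  [IsProbabilityMeasure P] {D : Measure S} [IsProbabilityMeasure D] {Z : ℕ → Ω → S} {p : ℕ}
  {Θ : Set (EuclideanSpace ℝ (Fin p))} {θ₀ : EuclideanSpace ℝ (Fin p)}
  {m : EuclideanSpace ℝ (Fin p) → S → ℝ} {h : S → ℝ}

/-- Consistency of the M-estimator. -/
lemma tendsto_estimator (hθ₀ : θ₀ ∈ Θ)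
    (hsep : ∀ ε : ℝ, 0 < ε → ∃ δ : ℝ, 0 < δ ∧ ∀ θ ∈ Θ, ε ≤ ‖θ - θ₀‖ →
      (∫ z, m θ z ∂D) ≤ (∫ z, m θ₀ z ∂D) - δ)
    (hulln : ∀ ε : ℝ, 0 < ε → Tendsto (fun n : ℕ => P {ω | ∃ θ ∈ Θ,
      ε ≤ |empMean (sample Z n ω) (m θ) - (∫ z, m θ z ∂D)|}) atTop (𝓝 0))
    {th : ℕ × Ω → EuclideanSpace ℝ (Fin p)}
    (hmax : ∀ᶠ x in probFilter P, th x ∈ Θ ∧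
      IsMaxOn (fun θ => empMean (sample Z x.1 x.2) (m θ)) Θ (th x)) :
    Tendsto th (probFilter P) (𝓝 θ₀) := by
  rw [Metric.nhds_basis_ball.tendsto_right_iff]
  intro ε hε
  obtain ⟨δ, hδ, hδs⟩ := hsep ε hε
  have hu : ∀ᶠ x in probFilter P, ¬ ∃ θ ∈ Θ,
      δ / 2 ≤ |empMean (sample Z x.1 x.2) (m θ) - (∫ z, m θ z ∂D)| := by
    rw [eventually_probFilter]
    simpa only [not_not] using hulln (δ / 2) (half_pos hδ)
  filter_upwards [hu, hmax] with x hx1 hx2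
  push Not at hx1
  rw [mem_ball_iff_norm]
  by_contra! hcon
  have h1 := hδs _ hx2.1 hcon
  have h2 : empMean (sample Z x.1 x.2) (m θ₀) ≤ empMean (sample Z x.1 x.2) (m (th x)) :=
    isMaxOn_iff.1 hx2.2 θ₀ hθ₀
  have h3 := (abs_lt.1 (hx1 θ₀ hθ₀)).1
  have h4 := (abs_lt.1 (hx1 _ hx2.1)).2
  linarith

/-- First-order condition for the M-estimator. -/
lemma IsRegularCriterion.score_eq_zero (H : IsRegularCriterion D Θ θ₀ m h) {n : ℕ} (z : Fin n → S)
    {θ : EuclideanSpace ℝ (Fin p)} (hθ : θ ∈ interior Θ)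
    (hmax : IsMaxOn (fun t => empMean z (m t)) Θ θ) : empMean z (grad m θ) = 0 := by
  have hder : HasFDerivAt (fun t => empMean z (m t))
      ((n : ℝ)⁻¹ • ∑ i, fderiv ℝ (fun t => m t (z i)) θ) θ :=
    HasFDerivAt.const_smul (f := fun t => ∑ i, m t (z i))
      (HasFDerivAt.fun_sum fun i _ => (H.differentiableAt (z i) hθ).hasFDerivAt) (n : ℝ)⁻¹
  have h0 := (hmax.isLocalMax (mem_interior_iff_mem_nhds.1 hθ)).hasFDerivAt_eq_zero hder
  refine ext_inner_right ℝ fun v => ?_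
  rw [inner_zero_left, empMean, inner_smul_left, sum_inner]
  simp only [grad, inner_gradient_left]
  have := congrArg (fun L : EuclideanSpace ℝ (Fin p) →L[ℝ] ℝ => L v) h0
  simpa using this

lemma exists_bounded_approx {ψ : S → ℝ} (hψ : MemLp ψ 2 D) {ε : ℝ} (hε : 0 < ε) :
    ∃ (φ : S → ℝ) (B : ℝ), 0 ≤ B ∧ AEStronglyMeasurable φ D ∧ (∀ z, |φ z| ≤ B) ∧
      ∫ z, (ψ z - φ z) ^ 2 ∂D ≤ ε := by
  obtain ⟨M, hM⟩ := exists_integral_truncation_le hψ.integrable_sq hε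
  have hns : NullMeasurableSet {z | (M : ℝ) < |ψ z ^ 2|} D :=
    nullMeasurableSet_lt aemeasurable_const (hψ.1.pow 2).aemeasurable.norm
  refine ⟨{z | (M : ℝ) < |ψ z ^ 2|}ᶜ.indicator ψ, √M, Real.sqrt_nonneg _,
    hψ.1.indicator₀ hns.compl, fun z => ?_, ?_⟩
  · by_cases hz : (M : ℝ) < |ψ z ^ 2|
    · rw [Set.indicator_of_notMem (by simpa using hz), abs_zero]
      exact Real.sqrt_nonneg _
    · rw [Set.indicator_of_mem (by simpa using hz)]
      refine Real.abs_le_sqrt ?_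
      rw [abs_of_nonneg (sq_nonneg _)] at hz
      exact not_lt.1 hz
  · refine le_of_eq_of_le (integral_congr_ae (ae_of_all _ fun z => ?_)) hM
    by_cases hz : (M : ℝ) < |ψ z ^ 2|
    · simp only
      rw [Set.indicator_of_notMem (by simpa using hz), Set.indicator_of_mem (by exact hz),
        sub_zero, abs_of_nonneg (sq_nonneg _)]
    · simp only
      rw [Set.indicator_of_mem (by simpa using hz), Set.indicator_of_notMem (by exact hz)]
      simp

/-- A weak law of large numbers for products with a triangular array. -/
lemma IsIID.tendsto_empMean_mul (hZ : IsIID P D Z) {ψ : S → ℝ} (hψ : MemLp ψ 2 D)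
    {τ : ℕ → S → ℝ} (hτ : ∀ n, MemLp (τ n) 2 D) (hτ1 : ∀ n, ∫ z, τ n z ^ 2 ∂D ≤ 1) :
    Tendsto (fun x : ℕ × Ω => empMean (sample Z x.1 x.2) (fun z => ψ z * τ x.1 z)
      - ∫ z, ψ z * τ x.1 z ∂D) (probFilter P) (𝓝 0) := by
  refine tendsto_probFilter_of_integral_le fun δ hδ => ?_
  obtain ⟨φ, B, hB, hφm, hφB, hφψ⟩ := exists_bounded_approx hψ (show 0 < δ ^ 2 / 4 by positivity)
  have hφ : MemLp φ 2 D := MemLp.of_bound hφm B (ae_of_all _ hφB)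
  have hχ : MemLp (fun z => ψ z - φ z) 2 D := hψ.sub hφ
  have hχτ : ∀ n, Integrable (fun z => (ψ z - φ z) * τ n z) D := fun n => hχ.integrable_mul (hτ n)
  have hφτ : ∀ n, MemLp (fun z => φ z * τ n z) 2 D := fun n => by
    refine ((hτ n).const_mul B).mono (hφm.mul (hτ n).1) (ae_of_all _ fun z => ?_)
    rw [norm_mul, norm_mul, Real.norm_of_nonneg hB]
    exact mul_le_mul_of_nonneg_right (hφB z) (norm_nonneg _)
  have hφτi : ∀ n, Integrable (fun z => φ z * τ n z) D := fun n => (hφτ n).integrable (by norm_num)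
  have hL1 : ∀ n, ∫ z, |(ψ z - φ z) * τ n z| ∂D ≤ δ / 2 := fun n => by
    -- Weighted arithmetic–geometric inequality, the weight chosen so that `∫ (ψ - φ)² ≤ δ²/4` and
    -- `∫ τ² ≤ 1` make each of the two terms at most `δ / 4`.
    have h1 : ∫ z, |(ψ z - φ z) * τ n z| ∂D
        ≤ ∫ z, (δ⁻¹ * (ψ z - φ z) ^ 2 + δ / 4 * τ n z ^ 2) ∂D := by
      refine integral_mono (hχτ n).abs ((hχ.integrable_sq.const_mul _).add
        ((hτ n).integrable_sq.const_mul _)) fun z => ?_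
      have h2 : δ⁻¹ * (|ψ z - φ z| - δ / 2 * |τ n z|) ^ 2
          = δ⁻¹ * |ψ z - φ z| ^ 2 + δ / 4 * |τ n z| ^ 2 - |ψ z - φ z| * |τ n z| := by
        field_simp
        ring
      have h3 : 0 ≤ δ⁻¹ * (|ψ z - φ z| - δ / 2 * |τ n z|) ^ 2 := by positivity
      rw [h2, sq_abs, sq_abs] at h3
      simp only [abs_mul]
      linarith
    rw [integral_add (hχ.integrable_sq.const_mul _) ((hτ n).integrable_sq.const_mul _),
      integral_const_mul, integral_const_mul] at h1
    have h4 : δ⁻¹ * ∫ z, (ψ z - φ z) ^ 2 ∂D ≤ δ⁻¹ * (δ ^ 2 / 4) := by gcongr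
    have h5 : δ / 4 * ∫ z, τ n z ^ 2 ∂D ≤ δ / 4 * 1 := by gcongr; exact hτ1 n
    have h6 : δ⁻¹ * (δ ^ 2 / 4) = δ / 4 := by field_simp
    linarith
  -- With `φ` bounded by `B`, the variance of `φ τ_n` is at most `B²` uniformly in `n`, so the
  -- second moment of the centred mean is at most `B²/n`.
  have hmain : Tendsto (fun x : ℕ × Ω => empMean (sample Z x.1 x.2) (fun z => φ z * τ x.1 z)
      - ∫ z, φ z * τ x.1 z ∂D) (probFilter P) (𝓝 0) := by
    have hcm : ∀ n, MemLp (fun z => φ z * τ n z - ∫ z, φ z * τ n z ∂D) 2 D := fun n =>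
      (hφτ n).sub (memLp_const _)
    have hc0 : ∀ n, ∫ z, (φ z * τ n z - ∫ z, φ z * τ n z ∂D) ∂D = 0 := fun n => by
      rw [integral_sub (hφτi n) (integrable_const _)]; simp
    have hcv : ∀ n, ∫ z, (φ z * τ n z - ∫ z, φ z * τ n z ∂D) ^ 2 ∂D ≤ B ^ 2 := fun n => by
      rw [← variance_eq_integral (hφτ n).1.aemeasurable]
      refine (variance_le_expectation_sq (hφτ n).1).trans ?_
      have h1 : ∫ z, ((fun z => φ z * τ n z) ^ 2) z ∂D ≤ ∫ z, B ^ 2 * τ n z ^ 2 ∂D := by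
        refine integral_mono (hφτ n).integrable_sq ((hτ n).integrable_sq.const_mul _) fun z => ?_
        simp only [Pi.pow_apply, mul_pow]
        have := pow_le_pow_left₀ (abs_nonneg _) (hφB z) 2
        rw [sq_abs] at this
        exact mul_le_mul_of_nonneg_right this (sq_nonneg _)
      rw [integral_const_mul] at h1
      exact h1.trans (mul_le_of_le_one_right (sq_nonneg _) (hτ1 n))
    have hsq : Tendsto (fun x : ℕ × Ω => (empMean (sample Z x.1 x.2)
        (fun z => φ z * τ x.1 z - ∫ z, φ z * τ x.1 z ∂D)) ^ 2) (probFilter P) (𝓝 0) := by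
      refine tendsto_probFilter_of_tendsto_integral
        (f := fun n ω => (empMean (sample Z n ω) (fun z => φ z * τ n z - ∫ z, φ z * τ n z ∂D)) ^ 2)
        (r := fun n ω => (empMean (sample Z n ω) (fun z => φ z * τ n z - ∫ z, φ z * τ n z ∂D)) ^ 2)
        (fun n => (hZ.memLp_empMean (hcm n) n).integrable_sq) (fun n ω => sq_nonneg _) ?_
        (Eventually.of_forall fun n ω => (abs_of_nonneg (sq_nonneg _)).le)
      have hlim : Tendsto (fun n : ℕ => (n : ℝ)⁻¹ * B ^ 2) atTop (𝓝 0) := by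
        simpa using (tendsto_inv_atTop_nhds_zero_nat (𝕜 := ℝ)).mul_const (B ^ 2)
      refine squeeze_zero' (Eventually.of_forall fun n => integral_nonneg fun ω => sq_nonneg _) ?_ hlim
      filter_upwards [eventually_ge_atTop 1] with n hn
      rw [hZ.integral_empMean_sq (hcm n) (hc0 n) hn]
      exact mul_le_mul_of_nonneg_left (hcv n) (by positivity)
    have habs : Tendsto (fun x : ℕ × Ω => |empMean (sample Z x.1 x.2)
        (fun z => φ z * τ x.1 z - ∫ z, φ z * τ x.1 z ∂D)|) (probFilter P) (𝓝 0) := by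
      simpa [Real.sqrt_sq_eq_abs] using hsq.sqrt
    refine ((tendsto_zero_iff_abs_tendsto_zero _).2 habs).congr' ?_
    filter_upwards [tendsto_fst_probFilter.eventually (eventually_ge_atTop 1)] with x hx
    have hn : (x.1 : ℝ) ≠ 0 := by exact_mod_cast (show x.1 ≠ 0 by omega)
    simp only [empMean_sample, smul_eq_mul, Finset.sum_sub_distrib, Finset.sum_const,
      Finset.card_univ, Fintype.card_fin, nsmul_eq_mul]
    field_simp
  refine ⟨fun n ω => empMean (sample Z n ω) (fun z => |(ψ z - φ z) * τ n z|)
      + ∫ z, |(ψ z - φ z) * τ n z| ∂D,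
    fun n => (hZ.integrable_empMean (hχτ n).abs n).add (integrable_const _), fun n ω => ?_, ?_, ?_⟩
  · exact add_nonneg (smul_nonneg (by positivity) (Finset.sum_nonneg fun i _ => abs_nonneg _))
      (integral_nonneg fun z => abs_nonneg _)
  · filter_upwards [eventually_ge_atTop 1] with n hn
    rw [integral_add (hZ.integrable_empMean (hχτ n).abs n) (integrable_const _),
      hZ.integral_empMean (hχτ n).abs hn]
    have := hL1 n
    simp only [integral_const, probReal_univ, smul_eq_mul, one_mul]
    linarith
  · have hm := ((tendsto_zero_iff_abs_tendsto_zero _).1 hmain).eventually_le_const hδ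
    filter_upwards [hm] with x hx
    have e1 : empMean (sample Z x.1 x.2) (fun z => ψ z * τ x.1 z)
        = empMean (sample Z x.1 x.2) (fun z => φ z * τ x.1 z)
          + empMean (sample Z x.1 x.2) (fun z => (ψ z - φ z) * τ x.1 z) := by
      simp only [empMean_sample, smul_eq_mul, ← mul_add, ← Finset.sum_add_distrib]
      congr 1
      exact Finset.sum_congr rfl fun i _ => by ring
    have e2 : ∫ z, ψ z * τ x.1 z ∂D
        = ∫ z, φ z * τ x.1 z ∂D + ∫ z, (ψ z - φ z) * τ x.1 z ∂D := by
      rw [← integral_add (hφτi _) (hχτ _)]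
      exact integral_congr_ae (ae_of_all _ fun z => by ring)
    have b1 : |empMean (sample Z x.1 x.2) (fun z => (ψ z - φ z) * τ x.1 z)|
        ≤ empMean (sample Z x.1 x.2) (fun z => |(ψ z - φ z) * τ x.1 z|) := by
      simp only [empMean_sample, smul_eq_mul]
      rw [abs_mul, abs_of_nonneg (show (0 : ℝ) ≤ (x.1 : ℝ)⁻¹ by positivity)]
      exact mul_le_mul_of_nonneg_left (Finset.abs_sum_le_sum_abs _ _) (by positivity)
    have b2 : |∫ z, (ψ z - φ z) * τ x.1 z ∂D| ≤ ∫ z, |(ψ z - φ z) * τ x.1 z| ∂D :=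
      abs_integral_le_integral_abs
    have hx' : |empMean (sample Z x.1 x.2) (fun z => φ z * τ x.1 z) - ∫ z, φ z * τ x.1 z ∂D| ≤ δ := hx
    rw [e1, e2]
    rw [abs_le] at *
    constructor <;> linarith [b1.1, b1.2, b2.1, b2.2, hx'.1, hx'.2]

end

/-! ### Uniform square-integrability of normalized sums. -/

section

variable {Ω S : Type*} [MeasurableSpace Ω] [MeasurableSpace S] {P : Measure Ω}
  [IsProbabilityMeasure P] {D : Measure S} [IsProbabilityMeasure D] {Z : ℕ → Ω → S}

lemma eLpNorm_two_eq_sqrt {f : Ω → ℝ} (hf : MemLp f 2 P) :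
    eLpNorm f 2 P = ENNReal.ofReal √(∫ ω, f ω ^ 2 ∂P) := by
  rw [hf.eLpNorm_eq_integral_rpow_norm (by norm_num) (by norm_num), Real.sqrt_eq_rpow]
  norm_num

/-- On a small set the approximant is controlled by its fourth moment, through `g² ≤ (2a)⁻¹ + (a/2)
g⁴`, and the remainder is small in `L²` on every set. -/
lemma unifIntegrable_two_of_approx {f : ℕ → Ω → ℝ} (hf : ∀ n, MemLp (f n) 2 P)
    (h : ∀ ε : ℝ, 0 < ε → ∃ (g : ℕ → Ω → ℝ) (K : ℝ), (∀ n, MemLp (g n) 2 P ∧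
      Integrable (fun ω => g n ω ^ 4) P ∧ ∫ ω, g n ω ^ 4 ∂P ≤ K) ∧
      ∀ n, ∫ ω, (f n ω - g n ω) ^ 2 ∂P ≤ ε) : UnifIntegrable f 2 P := by
  intro ε hε
  have hq : 0 < (ε / 2) ^ 2 := by positivity
  obtain ⟨g, K, hg, hfg⟩ := h _ hq
  have hK : 0 ≤ K := (integral_nonneg fun ω => by positivity).trans (hg 0).2.2
  set q := (ε / 2) ^ 2 with hqdef
  -- With `a K ≤ q` the fourth-moment term is at most `q / 2`; on sets of probability at most `a q`
  -- the constant term `(2a)⁻¹` also contributes at most `q / 2`.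
  let a := q / (K + 1)
  have ha : 0 < a := by positivity
  have haK : a * K ≤ q := by
    simp only [a]
    rw [div_mul_eq_mul_div, div_le_iff₀ (by positivity)]
    nlinarith
  refine ⟨a * q, by positivity, fun n s hs hPs => ?_⟩
  obtain ⟨hg2, hg4, hgK⟩ := hg n
  have hd : MemLp (fun ω => f n ω - g n ω) 2 P := (hf n).sub hg2
  have hPs' : P.real s ≤ a * q := ENNReal.toReal_le_of_le_ofReal (by positivity) hPs
  have h1 : eLpNorm (s.indicator (g n)) 2 P ≤ ENNReal.ofReal (ε / 2) := by
    rw [eLpNorm_two_eq_sqrt (hg2.indicator hs)]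
    refine ENNReal.ofReal_le_ofReal ?_
    rw [Real.sqrt_le_left (by positivity)]
    have hbound : ∫ ω, s.indicator (g n) ω ^ 2 ∂P
        ≤ ∫ ω, ((2 * a)⁻¹ * s.indicator (fun _ => (1 : ℝ)) ω + a / 2 * g n ω ^ 4) ∂P := by
      refine integral_mono (hg2.indicator hs).integrable_sq
        ((((integrable_const (1 : ℝ)).indicator hs).const_mul _).add (hg4.const_mul _)) fun ω => ?_
      by_cases hω : ω ∈ s
      · simp only [Set.indicator_of_mem hω]
        have e : a / 2 * (g n ω ^ 2 - a⁻¹) ^ 2 = a / 2 * g n ω ^ 4 - g n ω ^ 2 + (2 * a)⁻¹ := by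
          field_simp
          ring
        have : 0 ≤ a / 2 * (g n ω ^ 2 - a⁻¹) ^ 2 := by positivity
        linarith
      · simp only [Set.indicator_of_notMem hω]
        rw [zero_pow two_ne_zero]
        positivity
    refine hbound.trans ?_
    rw [integral_add (((integrable_const (1 : ℝ)).indicator hs).const_mul _) (hg4.const_mul _),
      integral_const_mul, integral_const_mul, integral_indicator hs]
    simp only [integral_const, MeasurableSet.univ, measureReal_restrict_apply, Set.univ_inter,
      smul_eq_mul, mul_one]
    have e1 : (2 * a)⁻¹ * P.real s ≤ (2 * a)⁻¹ * (a * q) := by gcongr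
    have e2 : (2 * a)⁻¹ * (a * q) = q / 2 := by field_simp
    have e3 : a / 2 * ∫ ω, g n ω ^ 4 ∂P ≤ a / 2 * K := by gcongr
    linarith
  have h2 : eLpNorm (s.indicator fun ω => f n ω - g n ω) 2 P ≤ ENNReal.ofReal (ε / 2) := by
    refine (eLpNorm_indicator_le _).trans ?_
    rw [eLpNorm_two_eq_sqrt hd]
    refine ENNReal.ofReal_le_ofReal ?_
    rw [Real.sqrt_le_left (by positivity)]
    exact hfg n
  have e : s.indicator (f n) = s.indicator (g n) + s.indicator fun ω => f n ω - g n ω := by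
    ext ω
    by_cases hω : ω ∈ s <;> simp [hω]
  rw [e]
  refine (eLpNorm_add_le (hg2.indicator hs).1 (hd.indicator hs).1 (by norm_num)).trans ?_
  refine (add_le_add h1 h2).trans (le_of_eq ?_)
  rw [← ENNReal.ofReal_add (by positivity) (by positivity), add_halves]

/-- By Hoeffding's lemma the centred bounded summands are sub-Gaussian, and for `n ≥ 1` the
normalized sum has the same sub-Gaussian parameter whatever `n` is; this bounds all fourth moments
at once. -/
lemma IsIID.integral_pow_four_le (hZ : IsIID P D Z) {φ : S → ℝ} {B : ℝ}
    (hφm : AEStronglyMeasurable φ D) (hφB : ∀ z, |φ z| ≤ B) :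
    ∃ K : ℝ, ∀ n : ℕ, Integrable (fun ω =>
        (√(n : ℝ) * empMean (sample Z n ω) (fun z => φ z - ∫ z, φ z ∂D)) ^ 4) P ∧
      ∫ ω, (√(n : ℝ) * empMean (sample Z n ω) (fun z => φ z - ∫ z, φ z ∂D)) ^ 4 ∂P ≤ K := by
  let c : NNReal := (‖B - -B‖₊ / 2) ^ 2
  have hX : ∀ i, HasSubgaussianMGF (fun ω => φ (Z i ω) - ∫ z, φ z ∂D) c P := by
    intro i
    have := hasSubgaussianMGF_of_mem_Icc (μ := P) (X := fun ω => φ (Z i ω)) (a := -B) (b := B)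
      (hφm.comp_measurePreserving (hZ.measurePreserving i)).aemeasurable
      (ae_of_all _ fun ω => abs_le.1 (hφB _))
    rwa [hZ.integral_comp hφm] at this
  have hind : iIndepFun (fun i ω => φ (Z i ω) - ∫ z, φ z ∂D) P :=
    hZ.indep.comp₀ (fun _ z => φ z - ∫ z, φ z ∂D) (fun i => (hZ.measurable i).aemeasurable)
      fun i => by rw [hZ.law i]; exact hφm.aemeasurable.sub_const _
  let Y : ℕ → Ω → ℝ := fun n ω =>
    √(n : ℝ) * empMean (sample Z n ω) (fun z => φ z - ∫ z, φ z ∂D)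
  have hY : ∀ n, 1 ≤ n → HasSubgaussianMGF (Y n) c P := by
    intro n hn
    have hn' : (n : ℝ) ≠ 0 := by exact_mod_cast (show n ≠ 0 by omega)
    have h1 := (HasSubgaussianMGF.sum_of_iIndepFun hind (s := Finset.range n) (c := fun _ => c)
      fun i _ => hX i).const_mul (√(n : ℝ) * (n : ℝ)⁻¹)
    have e1 : (fun ω => √(n : ℝ) * (n : ℝ)⁻¹ *
        ∑ i ∈ Finset.range n, (φ (Z i ω) - ∫ z, φ z ∂D)) = Y n := by
      ext ω
      simp only [Y, empMean_sample, smul_eq_mul, mul_assoc]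
      rw [Fin.sum_univ_eq_sum_range (fun i => φ (Z i ω) - ∫ z, φ z ∂D) n]
    rw [e1] at h1
    convert h1 using 1
    refine NNReal.eq ?_
    change (c : ℝ) = (√(n : ℝ) * (n : ℝ)⁻¹) ^ 2 * ((∑ _i ∈ Finset.range n, c : NNReal) : ℝ)
    rw [mul_pow, Real.sq_sqrt (Nat.cast_nonneg n), Finset.sum_const, Finset.card_range,
      nsmul_eq_mul, NNReal.coe_mul, NNReal.coe_natCast]
    field_simp
  -- Here `24 = 4!` comes from `|y|⁴/4! ≤ exp |y| ≤ exp y + exp (-y)`, and each exponential moment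
  -- at `±1` is at most `exp (c / 2)`.
  refine ⟨24 * (2 * Real.exp (c / 2)), fun n => ?_⟩
  rcases Nat.eq_zero_or_pos n with rfl | hn
  · simp only [CharP.cast_eq_zero, Real.sqrt_zero, zero_mul]
    simp
    positivity
  have hs := hY n hn
  have hpt : ∀ ω, Y n ω ^ 4 ≤ 24 * (Real.exp (1 * Y n ω) + Real.exp (-1 * Y n ω)) := by
    intro ω
    have h1 := Real.pow_div_factorial_le_exp |Y n ω| (abs_nonneg _) 4
    have h2 : |Y n ω| ^ 4 = Y n ω ^ 4 := by
      rw [show (4 : ℕ) = 2 * 2 by norm_num, pow_mul, sq_abs, ← pow_mul]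
    rw [h2] at h1
    have h3 : Real.exp |Y n ω| ≤ Real.exp (1 * Y n ω) + Real.exp (-1 * Y n ω) := by
      rcases abs_cases (Y n ω) with ⟨h, _⟩ | ⟨h, _⟩ <;> rw [h]
      · simp [Real.exp_nonneg]
      · simp [Real.exp_nonneg]
    have h4 : ((Nat.factorial 4 : ℕ) : ℝ) = 24 := by norm_num [Nat.factorial]
    rw [h4, div_le_iff₀ (by norm_num)] at h1
    linarith
  have hint1 := (hs.integrable_exp_mul 1).add (hs.integrable_exp_mul (-1))
  have hYm : AEStronglyMeasurable (Y n) P :=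
    (hZ.memLp_empMean (MemLp.of_bound (hφm.sub aestronglyMeasurable_const) (B + |∫ z, φ z ∂D|)
      (ae_of_all _ fun z => (norm_sub_le _ _).trans (add_le_add (hφB z) le_rfl))) n).1.const_mul _
  have hint : Integrable (fun ω => Y n ω ^ 4) P := by
    refine (hint1.const_mul 24).mono' (hYm.pow 4) (ae_of_all _ fun ω => ?_)
    rw [Real.norm_of_nonneg (by positivity)]
    exact hpt ω
  refine ⟨hint, (integral_mono hint (hint1.const_mul 24) hpt).trans ?_⟩
  rw [integral_const_mul]
  refine mul_le_mul_of_nonneg_left ?_ (by norm_num)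
  have h5 : ∫ ω, ((fun ω => Real.exp (1 * Y n ω)) + fun ω => Real.exp (-1 * Y n ω)) ω ∂P
      = mgf (Y n) P 1 + mgf (Y n) P (-1) :=
    integral_add (hs.integrable_exp_mul 1) (hs.integrable_exp_mul (-1))
  rw [h5]
  have h6 := hs.mgf_le 1
  have h7 := hs.mgf_le (-1)
  norm_num at h6 h7
  linarith

/-- Normalized sums of centred square-integrable variables are uniformly square-integrable. -/
lemma IsIID.unifIntegrable_sqrt_mul_empMean (hZ : IsIID P D Z) {ψ : S → ℝ} (hψ : MemLp ψ 2 D)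
    (hψ0 : ∫ z, ψ z ∂D = 0) :
    UnifIntegrable (fun (n : ℕ) ω => √(n : ℝ) * empMean (sample Z n ω) ψ) 2 P := by
  refine unifIntegrable_two_of_approx (fun n => (hZ.memLp_empMean hψ n).const_mul _) fun ε hε => ?_
  obtain ⟨φ, B, hB, hφm, hφB, hφψ⟩ := exists_bounded_approx hψ hε
  have hφ : MemLp φ 2 D := MemLp.of_bound hφm B (ae_of_all _ hφB)
  have hφc : MemLp (fun z => φ z - ∫ z, φ z ∂D) 2 D := hφ.sub (memLp_const _)
  have hφi : Integrable φ D := hφ.integrable (by norm_num)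
  have hψi : Integrable ψ D := hψ.integrable (by norm_num)
  obtain ⟨K, hK⟩ := hZ.integral_pow_four_le hφm hφB
  refine ⟨fun n ω => √(n : ℝ) * empMean (sample Z n ω) (fun z => φ z - ∫ z, φ z ∂D), K,
    fun n => ⟨(hZ.memLp_empMean hφc n).const_mul _, hK n⟩, fun n => ?_⟩
  -- Since `ψ` has mean zero, `χ` is `ψ - φ` minus its mean. Its second moment is therefore a
  -- variance, at most `∫ (ψ - φ)²`.
  let χ : S → ℝ := fun z => ψ z - (φ z - ∫ z, φ z ∂D)
  have hχ : MemLp χ 2 D := hψ.sub hφc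
  have hχ0 : ∫ z, χ z ∂D = 0 := by
    have hφci : Integrable (fun z => φ z - ∫ z, φ z ∂D) D := hφi.sub (integrable_const _)
    simp only [χ]
    rw [integral_sub hψi hφci, integral_sub hφi (integrable_const _), hψ0]
    simp
  have e : ∀ ω, √(n : ℝ) * empMean (sample Z n ω) ψ
      - √(n : ℝ) * empMean (sample Z n ω) (fun z => φ z - ∫ z, φ z ∂D)
      = √(n : ℝ) * empMean (sample Z n ω) χ := fun ω => by
    simp only [empMean_sample, smul_eq_mul, χ, Finset.sum_sub_distrib]
    ring
  simp_rw [e, mul_pow]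
  rw [integral_const_mul, Real.sq_sqrt (Nat.cast_nonneg n)]
  rcases Nat.eq_zero_or_pos n with rfl | hn
  · simpa using hε.le
  have hn' : (n : ℝ) ≠ 0 := by exact_mod_cast (show n ≠ 0 by omega)
  rw [hZ.integral_empMean_sq hχ hχ0 hn, mul_inv_cancel_left₀ hn']
  have hd : MemLp (fun z => ψ z - φ z) 2 D := hψ.sub hφ
  have hd1 : ∫ z, (ψ z - φ z) ∂D = - ∫ z, φ z ∂D := by
    rw [integral_sub hψi hφi, hψ0, zero_sub]
  have e2 : ∫ z, χ z ^ 2 ∂D = Var[fun z => ψ z - φ z; D] := by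
    rw [variance_eq_integral hd.1.aemeasurable, hd1]
    refine integral_congr_ae (ae_of_all _ fun z => ?_)
    simp only [χ]
    ring
  rw [e2]
  exact (variance_le_expectation_sq hd.1).trans hφψ

end

/-! ### The mean of products of directional derivatives. -/

lemma abs_covariance_le_sqrt {Ω : Type*} [MeasurableSpace Ω] {P : Measure Ω}
    [IsProbabilityMeasure P] {X Y : Ω → ℝ} (hX : MemLp X 2 P) (hY : MemLp Y 2 P) :
    |cov[X, Y; P]| ≤ √Var[X; P] * √Var[Y; P] := by
  have h : ∀ c : ℝ, 0 ≤ Var[Y; P] * (c * c) + 2 * cov[X, Y; P] * c + Var[X; P] := fun c => by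
    have h1 := variance_nonneg (fun ω => X ω + c * Y ω) P
    rw [variance_fun_add hX (hY.const_mul c), variance_const_mul, covariance_const_mul_right] at h1
    linarith
  have hd := discrim_le_zero h
  rw [discrim] at hd
  rw [← Real.sqrt_mul (variance_nonneg X P)]
  refine Real.abs_le_sqrt ?_
  linarith

lemma BddInProb.of_tendsto {Ω : Type*} [MeasurableSpace Ω] {P : Measure Ω} {Y : ℕ × Ω → ℝ} {c : ℝ}
    (hY : Tendsto Y (probFilter P) (𝓝 c)) : BddInProb P Y := fun X hX => by
  simpa using hX.mul hY

lemma abs_mean_mul_le {n : ℕ} (u v : Fin n → ℝ) :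
    |(n : ℝ)⁻¹ * ∑ i, u i * v i|
      ≤ √(((n : ℝ)⁻¹ * ∑ i, u i ^ 2) * ((n : ℝ)⁻¹ * ∑ i, v i ^ 2)) := by
  refine Real.abs_le_sqrt ?_
  have := Finset.sum_mul_sq_le_sq_mul_sq Finset.univ u v
  rw [mul_pow, mul_mul_mul_comm, ← pow_two]
  exact mul_le_mul_of_nonneg_left this (by positivity)

lemma sum_sub_mean_sq_le {n : ℕ} (t : Fin n → ℝ) :
    ∑ i, (t i - (n : ℝ)⁻¹ * ∑ l, t l) ^ 2 ≤ ∑ i, t i ^ 2 := by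
  rcases Nat.eq_zero_or_pos n with rfl | hn
  · simp
  have hn' : (n : ℝ) ≠ 0 := by exact_mod_cast hn.ne'
  have h : ∑ i, (t i - (n : ℝ)⁻¹ * ∑ l, t l) ^ 2 = ∑ i, t i ^ 2 - (n : ℝ)⁻¹ * (∑ l, t l) ^ 2 := by
    simp only [sub_sq, Finset.sum_add_distrib, Finset.sum_sub_distrib, Finset.sum_const,
      Finset.card_univ, Fintype.card_fin, nsmul_eq_mul]
    rw [← Finset.sum_mul, ← Finset.mul_sum]
    field_simp
    ring
  rw [h]
  have : 0 ≤ (n : ℝ)⁻¹ * (∑ l, t l) ^ 2 := by positivity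
  linarith

section

variable {Ω S : Type*} [MeasurableSpace Ω] [MeasurableSpace S] {P : Measure Ω}
  [IsProbabilityMeasure P] {D : Measure S} [IsProbabilityMeasure D] {Z : ℕ → Ω → S}
  {k : ℕ → ℕ} {T : (n : ℕ) → (Fin (k n) → S) → ℝ}

/-- The growth conditions on the subsample sizes and tree kernels under which the Hájek projection
dominates the forest. -/
structure IsForestRegime (D : Measure S) (T : (n : ℕ) → (Fin (k n) → S) → ℝ) : Prop where
  kernel : ∀ n, IsTreeKernel D (T n)
  one_le : ∀ n, 1 ≤ k n
  zeta_pos : ∀ᶠ n in atTop, 0 < zeta D (T n) 1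
  tendsto_zeta : Tendsto (fun n : ℕ => zeta D (T n) (k n) / (n * zeta D (T n) 1)) atTop (𝓝 0)
  tendsto_div : Tendsto (fun n : ℕ => (k n : ℝ) / n) atTop (𝓝 0)

/-- The first-order projection of the tree, standardized. -/
def stdProj (D : Measure S) (T : (n : ℕ) → (Fin (k n) → S) → ℝ) (n : ℕ) (z : S) : ℝ :=
  treeProj D (T n) z / √(zeta D (T n) 1)

/-- The first growth condition implies the second: a nonzero limit excludes `ζ_{1,k} = 0`, and `k/n
→ 0` is multiplied by the inverse of that limit. Under the second, `k/n → 0` is automatic, because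
`k ζ_{1,k} ≤ ζ_{k,k}`. -/
lemma isForestRegime_of_zeta (hZ : IsIID P D Z) (hT : ∀ n, IsTreeKernel D (T n))
    (hk : ∀ n, 1 ≤ k n)
    (hzeta :
      (Tendsto (fun n : ℕ => (k n : ℝ) / n) atTop (𝓝 0) ∧
        ∃ L : ℝ, L ≠ 0 ∧ Tendsto (fun n : ℕ =>
          k n * zeta D (T n) 1 / zeta D (T n) (k n)) atTop (𝓝 L)) ∨
      ((∀ᶠ n : ℕ in atTop, zeta D (T n) 1 ≠ 0) ∧
        Tendsto (fun n : ℕ => (k n : ℝ) / n *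
          (zeta D (T n) (k n) / (k n * zeta D (T n) 1))) atTop (𝓝 0))) :
    IsForestRegime D T := by
  have hweak : (∀ᶠ n : ℕ in atTop, zeta D (T n) 1 ≠ 0) ∧
      Tendsto (fun n : ℕ => (k n : ℝ) / n *
        (zeta D (T n) (k n) / (k n * zeta D (T n) 1))) atTop (𝓝 0) := by
    rcases hzeta with ⟨hkn, L, hL, hlim⟩ | h
    · refine ⟨(hlim.eventually_ne hL).mono fun n hn h0 => hn (by simp [h0]), ?_⟩
      simpa using hkn.mul (hlim.inv₀ hL)
    · exact h
  have hpos : ∀ᶠ n in atTop, 0 < zeta D (T n) 1 := hweak.1.mono fun n hn =>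
    lt_of_le_of_ne ((hT n).zeta_one_nonneg hZ (hk n)) hn.symm
  have hlim : Tendsto (fun n : ℕ => zeta D (T n) (k n) / (n * zeta D (T n) 1)) atTop (𝓝 0) := by
    refine hweak.2.congr fun n => ?_
    have : (k n : ℝ) ≠ 0 := by exact_mod_cast (show k n ≠ 0 by have := hk n; omega)
    rw [div_mul_div_comm, mul_left_comm, mul_div_mul_left _ _ this]
  refine ⟨hT, hk, hpos, hlim, squeeze_zero' (Eventually.of_forall fun n => by positivity) ?_ hlim⟩
  filter_upwards [hpos] with n hn
  rw [← mul_div_mul_right (k n : ℝ) (n : ℝ) hn.ne']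
  exact div_le_div_of_nonneg_right ((hT n).mul_zeta_one_le hZ) (by positivity)

lemma IsForestRegime.eventually_le (hT : IsForestRegime D T) :
    ∀ᶠ n in atTop, 2 ≤ n ∧ k n ≤ n ∧ (k n : ℝ) / n ≤ 1 / 2 := by
  filter_upwards [eventually_ge_atTop 2, hT.tendsto_div.eventually_le_const
    (show (0 : ℝ) < 1 / 2 by norm_num)] with n hn hkn
  refine ⟨hn, ?_, hkn⟩
  have : (0 : ℝ) < n := by exact_mod_cast (by omega : 0 < n)
  rw [div_le_iff₀ this] at hkn
  have : (k n : ℝ) ≤ n := by linarith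
  exact_mod_cast this

lemma IsForestRegime.memLp_stdProj (hT : IsForestRegime D T) (hZ : IsIID P D Z) (n : ℕ) :
    MemLp (stdProj D T n) 2 D := by
  have e : stdProj D T n = fun z => treeProj D (T n) z * (√(zeta D (T n) 1))⁻¹ := by
    ext z
    rw [stdProj, div_eq_mul_inv]
  rw [e]
  exact ((hT.kernel n).memLp_treeProj hZ).mul_const _

lemma IsForestRegime.integral_stdProj (hT : IsForestRegime D T) (hZ : IsIID P D Z) (n : ℕ) :
    ∫ z, stdProj D T n z ∂D = 0 := by
  simp only [stdProj]
  rw [integral_div, (hT.kernel n).integral_treeProj hZ (hT.one_le n), zero_div]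

lemma IsForestRegime.integral_stdProj_sq_le (hT : IsForestRegime D T) (hZ : IsIID P D Z) (n : ℕ) :
    ∫ z, stdProj D T n z ^ 2 ∂D ≤ 1 := by
  have h0 := (hT.kernel n).zeta_one_nonneg hZ (hT.one_le n)
  simp only [stdProj, div_pow]
  rw [integral_div, ← (hT.kernel n).zeta_one hZ (hT.one_le n), Real.sq_sqrt h0]
  exact div_self_le_one _

lemma IsForestRegime.abs_integral_mul_stdProj_le (hT : IsForestRegime D T) (hZ : IsIID P D Z)
    {ψ : S → ℝ} (hψ : MemLp ψ 2 D) (n : ℕ) :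
    |∫ z, ψ z * stdProj D T n z ∂D| ≤ ∫ z, ψ z ^ 2 ∂D + 1 := by
  have hτ := hT.memLp_stdProj hZ n
  have h1 : |∫ z, ψ z * stdProj D T n z ∂D| ≤ ∫ z, (ψ z ^ 2 + stdProj D T n z ^ 2) ∂D := by
    refine abs_integral_le_integral_abs.trans ?_
    refine integral_mono (hψ.integrable_mul hτ).abs (hψ.integrable_sq.add hτ.integrable_sq)
      fun z => ?_
    simp only [abs_mul]
    nlinarith [sq_nonneg (|ψ z| - |stdProj D T n z|), sq_abs (ψ z), sq_abs (stdProj D T n z)]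
  rw [integral_add hψ.integrable_sq hτ.integrable_sq] at h1
  linarith [hT.integral_stdProj_sq_le hZ n]

/-- The standardized residual part of the directional derivatives is negligible. -/
lemma IsForestRegime.tendsto_resid (hT : IsForestRegime D T) (hZ : IsIID P D Z) :
    Tendsto (fun x : ℕ × Ω => (x.1 : ℝ)⁻¹ * ∑ i : Fin x.1,
      (forestResid Z D (T x.1) x.1 i x.2 / (k x.1 * √(zeta D (T x.1) 1))) ^ 2)
      (probFilter P) (𝓝 0) := by
  have hint : ∀ n (i : Fin n), Integrable
      (fun ω => (forestResid Z D (T n) n i ω / (k n * √(zeta D (T n) 1))) ^ 2) P := fun n i => by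
    simp_rw [div_pow]
    exact ((hT.kernel n).memLp_forestResid hZ n i).integrable_sq.div_const _
  refine tendsto_probFilter_of_tendsto_integral
    (f := fun n ω => (n : ℝ)⁻¹ * ∑ i : Fin n,
      (forestResid Z D (T n) n i ω / (k n * √(zeta D (T n) 1))) ^ 2)
    (r := fun n ω => (n : ℝ)⁻¹ * ∑ i : Fin n,
      (forestResid Z D (T n) n i ω / (k n * √(zeta D (T n) 1))) ^ 2)
    (fun n => (integrable_finsetSum _ fun i _ => hint n i).const_mul _)
    (fun n ω => by positivity) ?_ (Eventually.of_forall fun n ω => (abs_of_nonneg (by positivity)).le)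
  have hlim := hT.tendsto_zeta.const_mul 4
  rw [mul_zero] at hlim
  refine squeeze_zero' (Eventually.of_forall fun n => integral_nonneg fun ω => by positivity) ?_ hlim
  filter_upwards [hT.eventually_le, hT.zeta_pos] with n hn hz
  have hk : (k n : ℝ) ≠ 0 := by exact_mod_cast (show k n ≠ 0 by have := hT.one_le n; omega)
  have hn0 : (0 : ℝ) < n := by exact_mod_cast (by omega : 0 < n)
  rw [integral_const_mul, integral_finsetSum _ fun i _ => hint n i]
  simp_rw [div_pow, integral_div]
  rw [← Finset.sum_div, mul_pow, Real.sq_sqrt hz.le]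
  have h1 := (hT.kernel n).sum_integral_forestResid_sq_le hZ (hT.one_le n) hn.2.1 hn.2.2
  calc (n : ℝ)⁻¹ * ((∑ i : Fin n, ∫ ω, forestResid Z D (T n) n i ω ^ 2 ∂P)
        / ((k n : ℝ) ^ 2 * zeta D (T n) 1))
      ≤ (n : ℝ)⁻¹ * (4 * (k n : ℝ) ^ 2 * zeta D (T n) (k n)
        / ((k n : ℝ) ^ 2 * zeta D (T n) 1)) := by gcongr
    _ = 4 * (zeta D (T n) (k n) / (n * zeta D (T n) 1)) := by field_simp

/-- The standardized directional derivatives of the forest. -/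
def stdDirDeriv (D : Measure S) (Z : ℕ → Ω → S) (T : (n : ℕ) → (Fin (k n) → S) → ℝ) (x : ℕ × Ω)
    (i : Fin x.1) : ℝ :=
  forestDirDeriv (T x.1) (sample Z x.1 x.2) i / (k x.1 * √(zeta D (T x.1) 1))

/-- The standardized residuals of the directional derivatives of the forest. -/
def stdResid (D : Measure S) (Z : ℕ → Ω → S) (T : (n : ℕ) → (Fin (k n) → S) → ℝ) (x : ℕ × Ω)
    (i : Fin x.1) : ℝ :=
  forestResid Z D (T x.1) x.1 i x.2 / (k x.1 * √(zeta D (T x.1) 1))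

/-- This factor is the finite-population correction of sampling without replacement. -/
lemma IsForestRegime.tendsto_shrink (hT : IsForestRegime D T) :
    Tendsto (fun n : ℕ => ((n : ℝ) - k n) / (n - 1)) atTop (𝓝 1) := by
  have h1 : Tendsto (fun n : ℕ => (1 - (k n : ℝ) / n) / (1 - (n : ℝ)⁻¹)) atTop (𝓝 1) := by
    have h2 : Tendsto (fun n : ℕ => 1 - (k n : ℝ) / n) atTop (𝓝 1) := by
      simpa using hT.tendsto_div.const_sub 1
    have h3 : Tendsto (fun n : ℕ => 1 - (n : ℝ)⁻¹) atTop (𝓝 1) := by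
      simpa using (tendsto_inv_atTop_nhds_zero_nat (𝕜 := ℝ)).const_sub 1
    have h4 := Tendsto.div h2 h3 one_ne_zero
    rw [div_one] at h4
    exact h4
  refine h1.congr' ?_
  filter_upwards [eventually_ge_atTop 2] with n hn
  have hn0 : (2 : ℝ) ≤ n := by exact_mod_cast hn
  have hn1 : (n : ℝ) - 1 ≠ 0 := by linarith
  field_simp

lemma IsForestRegime.stdDirDeriv_eq (hT : IsForestRegime D T) :
    ∀ᶠ x : ℕ × Ω in probFilter P, ∀ i : Fin x.1, stdDirDeriv D Z T x i
      = ((x.1 : ℝ) - k x.1) / (x.1 - 1)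
        * (stdProj D T x.1 (Z i x.2) - (x.1 : ℝ)⁻¹ * ∑ l : Fin x.1, stdProj D T x.1 (Z l x.2))
        + stdResid D Z T x i := by
  filter_upwards [tendsto_fst_probFilter.eventually hT.eventually_le,
    tendsto_fst_probFilter.eventually hT.zeta_pos] with x hx hz i
  have hk : (k x.1 : ℝ) ≠ 0 := by exact_mod_cast (show k x.1 ≠ 0 by have := hT.one_le x.1; omega)
  have hs : √(zeta D (T x.1) 1) ≠ 0 := (Real.sqrt_pos.2 hz).ne'
  have hn : (x.1 : ℝ) ≠ 0 := by exact_mod_cast (show x.1 ≠ 0 by omega)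
  have hn1 : (x.1 : ℝ) - 1 ≠ 0 := by
    have h2 : (2 : ℝ) ≤ x.1 := by exact_mod_cast hx.1
    linarith
  simp only [stdDirDeriv, forestDirDeriv_sample (D := D) hx.2.1 hx.1 i x.2, stdProj, stdResid,
    ← Finset.sum_div]
  field_simp

lemma IsForestRegime.bddInProb_stdProj_sq (hT : IsForestRegime D T) (hZ : IsIID P D Z) :
    BddInProb P fun x : ℕ × Ω => (x.1 : ℝ)⁻¹ * ∑ i : Fin x.1, stdProj D T x.1 (Z i x.2) ^ 2 := by
  refine BddInProb.of_integral_le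
    (Y := fun n ω => (n : ℝ)⁻¹ * ∑ i : Fin n, stdProj D T n (Z i ω) ^ 2)
    (r := fun n ω => empMean (sample Z n ω) (fun z => stdProj D T n z ^ 2)) (C := 1)
    (fun n => hZ.integrable_empMean (hT.memLp_stdProj hZ n).integrable_sq n) (fun n ω => ?_) ?_
    (Eventually.of_forall fun n ω => (abs_of_nonneg (by positivity)).le)
  · rw [empMean_sample, smul_eq_mul]; positivity
  · filter_upwards [eventually_ge_atTop 1] with n hn
    rw [hZ.integral_empMean (hT.memLp_stdProj hZ n).integrable_sq hn]
    exact hT.integral_stdProj_sq_le hZ n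

lemma IsForestRegime.bddInProb_stdDirDeriv_sq (hT : IsForestRegime D T) (hZ : IsIID P D Z) :
    BddInProb P fun x : ℕ × Ω => (x.1 : ℝ)⁻¹ * ∑ i : Fin x.1, stdDirDeriv D Z T x i ^ 2 := by
  have hρ := BddInProb.of_tendsto (hT.tendsto_resid hZ)
  have hτ := hT.bddInProb_stdProj_sq hZ
  refine ((hτ.add hτ).add (hρ.add hρ)).of_abs_le ?_
  filter_upwards [hT.stdDirDeriv_eq (P := P) (Z := Z),
    tendsto_fst_probFilter.eventually hT.eventually_le] with x hx hx2
  rw [abs_of_nonneg (by positivity), abs_of_nonneg (by positivity), ← two_mul, ← two_mul,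
    ← mul_add, ← mul_add, mul_left_comm, ← Finset.sum_add_distrib]
  refine mul_le_mul_of_nonneg_left ?_ (by positivity)
  have h1 : (k x.1 : ℝ) ≤ x.1 := by exact_mod_cast hx2.2.1
  have h2 : (2 : ℝ) ≤ x.1 := by exact_mod_cast hx2.1
  have h3 : (1 : ℝ) ≤ k x.1 := by exact_mod_cast hT.one_le x.1
  have ha0 : 0 ≤ ((x.1 : ℝ) - k x.1) / (x.1 - 1) := div_nonneg (by linarith) (by linarith)
  have ha1 : ((x.1 : ℝ) - k x.1) / (x.1 - 1) ≤ 1 := div_le_one_of_le₀ (by linarith) (by linarith)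
  have h4 := sum_sub_mean_sq_le fun i : Fin x.1 => stdProj D T x.1 (Z i x.2)
  calc ∑ i : Fin x.1, stdDirDeriv D Z T x i ^ 2
      ≤ ∑ i : Fin x.1, 2 * ((stdProj D T x.1 (Z i x.2)
          - (x.1 : ℝ)⁻¹ * ∑ l : Fin x.1, stdProj D T x.1 (Z l x.2)) ^ 2
          + stdResid D Z T x i ^ 2) := by
        refine Finset.sum_le_sum fun i _ => ?_
        rw [hx i]
        refine add_sq_le.trans ?_
        rw [mul_pow]
        have := mul_le_of_le_one_left (sq_nonneg (stdProj D T x.1 (Z i x.2)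
          - (x.1 : ℝ)⁻¹ * ∑ l : Fin x.1, stdProj D T x.1 (Z l x.2))) (pow_le_one₀ ha0 ha1 (n := 2))
        linarith
    _ ≤ 2 * ∑ i : Fin x.1, (stdProj D T x.1 (Z i x.2) ^ 2 + stdResid D Z T x i ^ 2) := by
        rw [← Finset.mul_sum, Finset.sum_add_distrib, Finset.sum_add_distrib]
        linarith

/-- The infinitesimal jackknife with approximate directional derivatives `u`. -/
lemma IsForestRegime.tendsto_mean_mul_dirDeriv (hT : IsForestRegime D T) (hZ : IsIID P D Z)
    {ψ : S → ℝ} (hψ : MemLp ψ 2 D) (hψ0 : ∫ z, ψ z ∂D = 0)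
    {u : (x : ℕ × Ω) → Fin x.1 → ℝ}
    (hu : Tendsto (fun x : ℕ × Ω => (x.1 : ℝ)⁻¹ * ∑ i : Fin x.1, (u x i - ψ (Z i x.2)) ^ 2)
      (probFilter P) (𝓝 0)) :
    Tendsto (fun x : ℕ × Ω => (x.1 : ℝ)⁻¹ * ∑ i : Fin x.1, u x i * stdDirDeriv D Z T x i
      - ∫ z, ψ z * stdProj D T x.1 z ∂D) (probFilter P) (𝓝 0) := by
  have hτ := hT.memLp_stdProj hZ
  have hτ1 := hT.integral_stdProj_sq_le hZ
  have ha := hT.tendsto_shrink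
  have ha' : Tendsto (fun x : ℕ × Ω => ((x.1 : ℝ) - k x.1) / (x.1 - 1)) (probFilter P) (𝓝 1) :=
    ha.comp tendsto_fst_probFilter
  have hψ2 : BddInProb P fun x : ℕ × Ω => (x.1 : ℝ)⁻¹ * ∑ i : Fin x.1, ψ (Z i x.2) ^ 2 := by
    have h := hZ.bddInProb_empMean hψ.integrable_sq fun z => sq_nonneg _
    simp only [empMean_sample, smul_eq_mul] at h
    exact h
  have hone : MemLp (fun _ : S => (1 : ℝ)) 2 D := memLp_const _
  have hψm : Tendsto (fun x : ℕ × Ω => empMean (sample Z x.1 x.2) ψ) (probFilter P) (𝓝 0) := by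
    have := hZ.tendsto_empMean_mul (P := P) hψ (τ := fun _ _ => 1) (fun _ => hone) (by simp)
    simpa [hψ0] using this
  have hτm : Tendsto (fun x : ℕ × Ω => empMean (sample Z x.1 x.2) (stdProj D T x.1))
      (probFilter P) (𝓝 0) := by
    have := hZ.tendsto_empMean_mul (P := P) hone hτ hτ1
    simp only [one_mul, hT.integral_stdProj hZ, sub_zero] at this
    exact this
  have hψτ := hZ.tendsto_empMean_mul (P := P) hψ hτ hτ1
  have t1 : Tendsto (fun x : ℕ × Ω => (x.1 : ℝ)⁻¹ *
      ∑ i : Fin x.1, (u x i - ψ (Z i x.2)) * stdDirDeriv D Z T x i) (probFilter P) (𝓝 0) := by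
    have h1 := (hT.bddInProb_stdDirDeriv_sq hZ _ hu).sqrt
    rw [Real.sqrt_zero] at h1
    exact squeeze_zero_norm (fun x => abs_mean_mul_le _ _) h1
  have t2 : Tendsto (fun x : ℕ × Ω => (x.1 : ℝ)⁻¹ *
      ∑ i : Fin x.1, ψ (Z i x.2) * stdResid D Z T x i) (probFilter P) (𝓝 0) := by
    have h1 := (hψ2 _ (hT.tendsto_resid hZ)).sqrt
    rw [Real.sqrt_zero] at h1
    refine squeeze_zero_norm (fun x => ?_) h1
    rw [mul_comm (_ * _) (_ * _)]
    exact abs_mean_mul_le _ _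
  have t4 : Tendsto (fun x : ℕ × Ω => (((x.1 : ℝ) - k x.1) / (x.1 - 1) - 1)
      * ∫ z, ψ z * stdProj D T x.1 z ∂D) (probFilter P) (𝓝 0) := by
    have h1 := (ha.sub_const 1).abs.mul_const (∫ z, ψ z ^ 2 ∂D + 1)
    rw [sub_self, abs_zero, zero_mul] at h1
    have h2 : Tendsto (fun n : ℕ => (((n : ℝ) - k n) / (n - 1) - 1)
        * ∫ z, ψ z * stdProj D T n z ∂D) atTop (𝓝 0) := by
      refine squeeze_zero_norm (fun n => ?_) h1
      rw [norm_mul]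
      exact mul_le_mul_of_nonneg_left (hT.abs_integral_mul_stdProj_le hZ hψ n) (abs_nonneg _)
    exact h2.comp tendsto_fst_probFilter
  -- The terms are, in order: replacing `u` by `ψ`, the higher-order residual, the law of large
  -- numbers for `ψ τ_n`, the factor tending to 1, and the product of two means left by the centring
  -- of `τ_n`.
  have hfin := (((t1.add t2).add (ha'.mul hψτ)).add t4).sub (ha'.mul (hψm.mul hτm))
  simp only [add_zero, mul_zero, sub_zero] at hfin
  refine hfin.congr' ?_
  filter_upwards [hT.stdDirDeriv_eq (P := P) (Z := Z)] with x hx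
  generalize ((x.1 : ℝ) - k x.1) / (x.1 - 1) = a at hx ⊢
  have e1 : ∑ i : Fin x.1, u x i * stdDirDeriv D Z T x i
      = ∑ i : Fin x.1, (u x i - ψ (Z i x.2)) * stdDirDeriv D Z T x i
        + ∑ i : Fin x.1, ψ (Z i x.2) * stdDirDeriv D Z T x i := by
    rw [← Finset.sum_add_distrib]
    exact Finset.sum_congr rfl fun i _ => by ring
  have e2 : ∑ i : Fin x.1, ψ (Z i x.2) * stdDirDeriv D Z T x i
      = a * ∑ i : Fin x.1, ψ (Z i x.2) * stdProj D T x.1 (Z i x.2)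
      - a * ((∑ i : Fin x.1, ψ (Z i x.2))
        * ((x.1 : ℝ)⁻¹ * ∑ l : Fin x.1, stdProj D T x.1 (Z l x.2)))
      + ∑ i : Fin x.1, ψ (Z i x.2) * stdResid D Z T x i := by
    rw [Finset.sum_mul, Finset.mul_sum, Finset.mul_sum, ← Finset.sum_sub_distrib,
      ← Finset.sum_add_distrib]
    refine Finset.sum_congr rfl fun i _ => ?_
    rw [hx i]
    ring
  rw [e1, e2]
  simp only [empMean_sample, smul_eq_mul]
  ring

end

/-! ### Comparison of the estimate and the covariance with a common sequence. -/

section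

variable {Ω S : Type*} [MeasurableSpace Ω] [MeasurableSpace S] {P : Measure Ω}
  [IsProbabilityMeasure P] {D : Measure S} [IsProbabilityMeasure D] {Z : ℕ → Ω → S}
  {k : ℕ → ℕ} {T : (n : ℕ) → (Fin (k n) → S) → ℝ}

/-- The ratio of the standard deviations of the Hájek projection and the forest. -/
def projRatio (P : Measure Ω) (D : Measure S) (Z : ℕ → Ω → S)
    (T : (n : ℕ) → (Fin (k n) → S) → ℝ) (n : ℕ) : ℝ :=
  min 1 (k n * √(zeta D (T n) 1) / (√(n : ℝ) * √Var[fun ω => forest (T n) (sample Z n ω); P]))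

/-- Eventually the cap in `projRatio` is idle, because the projection has no larger variance than
the forest. The cap only serves to make the bound by 1 valid for every `n`. -/
lemma IsForestRegime.le_variance (hT : IsForestRegime D T) (hZ : IsIID P D Z) :
    ∀ᶠ n in atTop, 0 < Var[fun ω => forest (T n) (sample Z n ω); P] ∧ projRatio P D Z T n
      = k n * √(zeta D (T n) 1) / (√(n : ℝ) * √Var[fun ω => forest (T n) (sample Z n ω); P]) := by
  filter_upwards [hT.eventually_le, hT.zeta_pos] with n hn hz
  have hk : (0 : ℝ) < k n := by exact_mod_cast hT.one_le n
  have hn0 : (0 : ℝ) < n := by exact_mod_cast (by omega : 0 < n)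
  have h1 := (hT.kernel n).variance_hajekForest_le hZ (hT.one_le n) hn.2.1
  rw [(hT.kernel n).variance_hajekForest hZ (hT.one_le n) (by omega)] at h1
  have h0 : 0 < (k n : ℝ) ^ 2 / n * zeta D (T n) 1 := by positivity
  refine ⟨h0.trans_le h1, min_eq_right ?_⟩
  refine div_le_one_of_le₀ ?_ (by positivity)
  rw [← Real.sqrt_mul hn0.le]
  refine Real.le_sqrt_of_sq_le ?_
  rw [mul_pow, Real.sq_sqrt hz.le]
  calc (k n : ℝ) ^ 2 * zeta D (T n) 1 = n * ((k n : ℝ) ^ 2 / n * zeta D (T n) 1) := by field_simp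
    _ ≤ _ := by gcongr

lemma projRatio_nonneg (n : ℕ) : 0 ≤ projRatio P D Z T n :=
  le_min zero_le_one (by positivity)

lemma IsForestRegime.abs_projRatio_mul_le (hT : IsForestRegime D T) (hZ : IsIID P D Z)
    {ψ : S → ℝ} (hψ : MemLp ψ 2 D) (n : ℕ) :
    |projRatio P D Z T n * ∫ z, ψ z * stdProj D T n z ∂D| ≤ ∫ z, ψ z ^ 2 ∂D + 1 := by
  rw [abs_mul, abs_of_nonneg (projRatio_nonneg n)]
  exact (mul_le_of_le_one_left (abs_nonneg _) (min_le_left _ _)).trans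
    (hT.abs_integral_mul_stdProj_le hZ hψ n)

/-- The covariance of an asymptotically linear prediction and the forest. -/
lemma IsForestRegime.tendsto_rate_mul_covariance (hT : IsForestRegime D T) (hZ : IsIID P D Z)
    {ψ : S → ℝ} (hψ : MemLp ψ 2 D) {pred : ℕ → Ω → ℝ} {η₀ : ℝ}
    (hpred : ∀ᶠ n in atTop, MemLp (pred n) 2 P)
    (hlin : Tendsto (fun n : ℕ => ∫ ω, (√(n : ℝ) * (pred n ω - η₀ - empMean (sample Z n ω) ψ)) ^ 2 ∂P)
      atTop (𝓝 0))
    {G : ℕ → Ω → ℝ} (hG : ∀ n, MemLp (G n) 2 P)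
    (hvar : ∀ᶠ n in atTop, Var[G n; P] ≤ Var[fun ω => forest (T n) (sample Z n ω); P])
    (hcov : ∀ᶠ n in atTop, ∀ i : Fin n, cov[G n, fun ω => ψ (Z i ω); P]
      = (k n : ℝ) / n * ∫ z, treeProj D (T n) z * ψ z ∂D) :
    Tendsto (fun n : ℕ => √(n : ℝ) / √Var[fun ω => forest (T n) (sample Z n ω); P]
        * cov[pred n, G n; P]
      - projRatio P D Z T n * ∫ z, ψ z * stdProj D T n z ∂D) atTop (𝓝 0) := by
  have hlim := hlin.sqrt
  rw [Real.sqrt_zero] at hlim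
  refine squeeze_zero_norm' ?_ hlim
  filter_upwards [hpred, hvar, hcov, hT.le_variance hZ, hT.zeta_pos, eventually_ge_atTop 1] with
    n hp hv hc hσ hz hn
  have hn0 : (0 : ℝ) < n := by exact_mod_cast hn
  rw [hσ.2]
  set σ := √Var[fun ω => forest (T n) (sample Z n ω); P] with hσdef
  have hσ0 : 0 < σ := Real.sqrt_pos.2 hσ.1
  have hL := hZ.memLp_empMean hψ n
  have hΔ : MemLp (fun ω => pred n ω - η₀ - empMean (sample Z n ω) ψ) 2 P :=
    (hp.sub (memLp_const η₀)).sub hL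
  have hsplit : cov[pred n, G n; P] = cov[fun ω => pred n ω - η₀ - empMean (sample Z n ω) ψ, G n; P]
      + cov[fun ω => empMean (sample Z n ω) ψ, G n; P] := by
    have h0 : MemLp (fun ω => pred n ω - η₀) 2 P := hp.sub (memLp_const η₀)
    rw [covariance_fun_sub_left h0 hL (hG n), sub_add_cancel]
    have := covariance_add_const_left (Y := G n) (hp.integrable (by norm_num)) (-η₀)
    simp only [← sub_eq_add_neg] at this
    exact this.symm
  have hcL : cov[fun ω => empMean (sample Z n ω) ψ, G n; P]
      = (k n : ℝ) / n * ∫ z, treeProj D (T n) z * ψ z ∂D := by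
    simp only [empMean_sample, smul_eq_mul]
    rw [covariance_const_mul_left,
      covariance_fun_sum_left (fun i : Fin n => hZ.memLp_comp hψ i) (hG n)]
    simp only [covariance_comm _ (G n), hc, Finset.sum_const, Finset.card_univ, Fintype.card_fin,
      nsmul_eq_mul]
    rw [inv_mul_cancel_left₀ hn0.ne']
  have hmain : √(n : ℝ) / σ * cov[fun ω => empMean (sample Z n ω) ψ, G n; P]
      = k n * √(zeta D (T n) 1) / (√(n : ℝ) * σ) * ∫ z, ψ z * stdProj D T n z ∂D := by
    have hint : ∫ z, treeProj D (T n) z * ψ z ∂D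
        = √(zeta D (T n) 1) * ∫ z, ψ z * stdProj D T n z ∂D := by
      rw [← integral_const_mul]
      refine integral_congr_ae (ae_of_all _ fun z => ?_)
      have : √(zeta D (T n) 1) ≠ 0 := (Real.sqrt_pos.2 hz).ne'
      simp only [stdProj]
      field_simp
    rw [hcL, hint]
    generalize ∫ z, ψ z * stdProj D T n z ∂D = I
    obtain ⟨s, hs0, hse⟩ : ∃ s : ℝ, 0 < s ∧ (n : ℝ) = s ^ 2 :=
      ⟨√(n : ℝ), Real.sqrt_pos.2 hn0, (Real.sq_sqrt hn0.le).symm⟩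
    rw [hse, Real.sqrt_sq hs0.le]
    field_simp
  rw [hsplit, mul_add, hmain, add_sub_cancel_right, norm_mul, Real.norm_of_nonneg (by positivity),
    Real.norm_eq_abs]
  -- Only the linearization error is left; its covariance with `G n` is at most its `L²` norm times
  -- `σ`, and `σ` cancels against the rate.
  have h1 := abs_covariance_le_sqrt hΔ (hG n)
  have h2 : √Var[G n; P] ≤ σ := Real.sqrt_le_sqrt hv
  have h3 : Var[fun ω => pred n ω - η₀ - empMean (sample Z n ω) ψ; P]
      ≤ ∫ ω, (pred n ω - η₀ - empMean (sample Z n ω) ψ) ^ 2 ∂P := variance_le_expectation_sq hΔ.1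
  simp_rw [mul_pow]
  rw [integral_const_mul, Real.sq_sqrt hn0.le, Real.sqrt_mul hn0.le, div_mul_eq_mul_div,
    div_le_iff₀ hσ0, mul_assoc]
  refine mul_le_mul_of_nonneg_left (h1.trans ?_) (Real.sqrt_nonneg _)
  exact mul_le_mul (Real.sqrt_le_sqrt h3) h2 (Real.sqrt_nonneg _) (Real.sqrt_nonneg _)

/-- Convergence in `L²` of the linearization, from uniform integrability. -/
lemma IsIID.tendsto_integral_linearization_sq (hZ : IsIID P D Z) {ψ : S → ℝ} (hψ : MemLp ψ 2 D)
    (hψ0 : ∫ z, ψ z ∂D = 0) {pred : ℕ → Ω → ℝ} {η₀ : ℝ} {N : ℕ}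
    (hUI : UniformIntegrable (fun (n : ℕ) ω => √((n + N : ℕ) : ℝ) * (pred (n + N) ω - η₀)) 2 P)
    (hdelta : Tendsto (fun x : ℕ × Ω => √(x.1 : ℝ) * (pred x.1 x.2 - η₀
      - empMean (sample Z x.1 x.2) ψ)) (probFilter P) (𝓝 0)) :
    Tendsto (fun n : ℕ => ∫ ω, (√(n : ℝ) * (pred n ω - η₀ - empMean (sample Z n ω) ψ)) ^ 2 ∂P)
      atTop (𝓝 0) := by
  have hLm : ∀ n : ℕ, MemLp (fun ω => √((n + N : ℕ) : ℝ) * empMean (sample Z (n + N) ω) ψ) 2 P :=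
    fun n => (hZ.memLp_empMean hψ (n + N)).const_mul _
  have hL : UnifIntegrable (fun (n : ℕ) ω => √((n + N : ℕ) : ℝ) * empMean (sample Z (n + N) ω) ψ)
      2 P := fun ε hε => by
    obtain ⟨δ, hδ, h⟩ := hZ.unifIntegrable_sqrt_mul_empMean hψ hψ0 hε
    exact ⟨δ, hδ, fun n => h (n + N)⟩
  have hsub := hUI.2.1.sub hL (by norm_num) hUI.1 fun n => (hLm n).1
  have hm : TendstoInMeasure P (fun (n : ℕ) ω => √(n : ℝ) * (pred n ω - η₀
      - empMean (sample Z n ω) ψ)) atTop (fun _ => 0) :=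
    tendstoInMeasure_iff_tendsto_probFilter.2 hdelta
  have e : ((fun (n : ℕ) ω => √((n + N : ℕ) : ℝ) * (pred (n + N) ω - η₀))
      - fun (n : ℕ) ω => √((n + N : ℕ) : ℝ) * empMean (sample Z (n + N) ω) ψ)
      = fun (n : ℕ) ω => √((n + N : ℕ) : ℝ) * (pred (n + N) ω - η₀
        - empMean (sample Z (n + N) ω) ψ) := by
    ext n ω
    simp only [Pi.sub_apply]
    ring
  have hmem : ∀ n : ℕ, MemLp (fun ω => √((n + N : ℕ) : ℝ) * (pred (n + N) ω - η₀
        - empMean (sample Z (n + N) ω) ψ)) 2 P := fun n => by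
    have := (hUI.memLp n).sub (hLm n)
    rw [← congrFun e n]
    exact this
  rw [e] at hsub
  -- Vitali's theorem in `L²`: the prediction error and the linear term are both uniformly
  -- square-integrable, hence so is their difference.
  have hv := tendsto_Lp_finite_of_tendstoInMeasure (g := fun _ => (0 : ℝ)) (by norm_num)
    (by norm_num) (fun n => (hmem n).1) (memLp_const _) hsub
    fun ε hε => (hm ε hε).comp (tendsto_add_atTop_nat N)
  have hv2 : Tendsto (fun n : ℕ => √(∫ ω, (√((n + N : ℕ) : ℝ) * (pred (n + N) ω - η₀
        - empMean (sample Z (n + N) ω) ψ)) ^ 2 ∂P)) atTop (𝓝 0) := by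
    have h1 := (ENNReal.tendsto_toReal ENNReal.zero_ne_top).comp hv
    rw [ENNReal.toReal_zero] at h1
    refine h1.congr fun n => ?_
    have e0 : ∀ f : Ω → ℝ, (f - fun _ => (0 : ℝ)) = f := fun f => by ext; simp
    rw [Function.comp_apply, e0, eLpNorm_two_eq_sqrt (hmem n),
      ENNReal.toReal_ofReal (Real.sqrt_nonneg _)]
  have hv3 := hv2.pow 2
  rw [zero_pow two_ne_zero] at hv3
  refine (tendsto_add_atTop_iff_nat N).1 (hv3.congr fun n => ?_)
  rw [Real.sq_sqrt (integral_nonneg fun ω => sq_nonneg _)]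

lemma eventually_memLp_of_uniformIntegrable {pred : ℕ → Ω → ℝ} {η₀ : ℝ} {N : ℕ}
    (hUI : UniformIntegrable (fun (n : ℕ) ω => √((n + N : ℕ) : ℝ) * (pred (n + N) ω - η₀)) 2 P) :
    ∀ᶠ n in atTop, MemLp (pred n) 2 P := by
  -- Starting at `N + 1` excludes index 0, where the factor `√0` erases the prediction.
  filter_upwards [eventually_ge_atTop (N + 1)] with n hn
  obtain ⟨j, rfl⟩ : ∃ j, n = j + N := ⟨n - N, by omega⟩
  have hs : √((j + N : ℕ) : ℝ) ≠ 0 := (Real.sqrt_pos.2 (by exact_mod_cast (by omega : 0 < j + N))).ne'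
  have h := ((hUI.memLp j).const_mul (√((j + N : ℕ) : ℝ))⁻¹).add (memLp_const η₀)
  refine (memLp_congr_ae (ae_of_all _ fun ω => ?_)).1 h
  simp only [Pi.add_apply]
  field_simp
  ring

/-- The conclusions about an estimator `est` of `c`, from the comparison of both, at scale `rate`,
with a bounded sequence. -/
lemma consistency_of_scaled {rate c κ : ℕ → ℝ} {est : ℕ → Ω → ℝ} {B : ℝ} (hκ : ∀ n, |κ n| ≤ B)
    (hest : Tendsto (fun x : ℕ × Ω => rate x.1 * est x.1 x.2 - κ x.1) (probFilter P) (𝓝 0))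
    (hc : Tendsto (fun n => rate n * c n - κ n) atTop (𝓝 0)) :
    TendstoInMeasure P (fun n ω => rate n * (est n ω - c n)) atTop (fun _ => 0) ∧
    (Tendsto rate atTop atTop →
      TendstoInMeasure P (fun n ω => est n ω - c n) atTop (fun _ => 0)) ∧
    ((∃ N : ℕ, UniformIntegrable (fun (n : ℕ) ω => rate (n + N) * est (n + N) ω) 1 P) →
      Tendsto (fun n => rate n * ((∫ ω, est n ω ∂P) - c n)) atTop (𝓝 0) ∧
      (Tendsto rate atTop atTop → Tendsto (fun n => (∫ ω, est n ω ∂P) - c n) atTop (𝓝 0))) := by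
  have h1 : Tendsto (fun x : ℕ × Ω => rate x.1 * (est x.1 x.2 - c x.1)) (probFilter P) (𝓝 0) := by
    have := hest.sub (hc.comp tendsto_fst_probFilter)
    rw [sub_zero] at this
    refine this.congr fun x => ?_
    simp only [Function.comp_apply]
    ring
  refine ⟨tendstoInMeasure_iff_tendsto_probFilter.2 h1, fun hr => ?_, ?_⟩
  · rw [tendstoInMeasure_iff_tendsto_probFilter]
    have h2 := ((tendsto_inv_atTop_zero.comp hr).comp (tendsto_fst_probFilter (P := P))).mul h1
    rw [zero_mul] at h2
    refine h2.congr' ?_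
    filter_upwards [(hr.comp (tendsto_fst_probFilter (P := P))).eventually_ne_atTop 0] with x hx
    simp only [Function.comp_apply] at hx ⊢
    rw [inv_mul_cancel_left₀ hx]
  rintro ⟨N, hUI⟩
  have hκm : ∀ n : ℕ, AEStronglyMeasurable (fun _ : Ω => κ (n + N)) P := fun n =>
    aestronglyMeasurable_const
  have hκUI : UnifIntegrable (fun (n : ℕ) (_ : Ω) => κ (n + N)) 1 P := by
    intro ε hε
    obtain ⟨δ, hδ, h⟩ := unifIntegrable_const (ι := ℕ) (p := 1) (μ := P) le_rfl (by norm_num)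
      (memLp_const B) hε
    refine ⟨δ, hδ, fun n s hs hsδ => (eLpNorm_mono fun ω => ?_).trans (h n s hs hsδ)⟩
    by_cases hω : ω ∈ s
    · simp only [Set.indicator_of_mem hω, Real.norm_eq_abs]
      exact (hκ _).trans (le_abs_self B)
    · simp [Set.indicator_of_notMem hω]
  have hsub := hUI.2.1.sub hκUI le_rfl hUI.1 hκm
  have hmem : ∀ n : ℕ, MemLp ((fun ω => rate (n + N) * est (n + N) ω) - fun _ => κ (n + N)) 1 P :=
    fun n => (hUI.memLp n).sub (memLp_const _)
  have hm : TendstoInMeasure P (fun n ω => rate n * est n ω - κ n) atTop (fun _ => 0) :=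
    tendstoInMeasure_iff_tendsto_probFilter.2 hest
  have hv := tendsto_Lp_finite_of_tendstoInMeasure (g := fun _ => (0 : ℝ)) le_rfl
    (by norm_num) (fun n => (hmem n).1) (memLp_const _) hsub
    fun ε hε => (hm ε hε).comp (tendsto_add_atTop_nat N)
  -- Subtracting the bounded constants `κ` preserves uniform integrability, so convergence in
  -- measure improves to `L¹` and passes to expectations.
  have hv1 := tendsto_integral_of_L1' (fun _ => (0 : ℝ)) aestronglyMeasurable_const
    (Eventually.of_forall fun n => memLp_one_iff_integrable.1 (hmem n)) hv
  have hv2 : Tendsto (fun n => rate n * (∫ ω, est n ω ∂P) - κ n) atTop (𝓝 0) := by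
    rw [integral_zero] at hv1
    refine (tendsto_add_atTop_iff_nat N).1 (hv1.congr fun n => ?_)
    simp only [Pi.sub_apply]
    rw [integral_sub (memLp_one_iff_integrable.1 (hUI.memLp n)) (integrable_const _),
      integral_const_mul]
    simp
  have h3 : Tendsto (fun n => rate n * ((∫ ω, est n ω ∂P) - c n)) atTop (𝓝 0) := by
    have := hv2.sub hc
    rw [sub_zero] at this
    refine this.congr fun n => ?_
    ring
  refine ⟨h3, fun hr => ?_⟩
  have h4 := (tendsto_inv_atTop_zero.comp hr).mul h3
  rw [zero_mul] at h4
  refine h4.congr' ?_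
  filter_upwards [hr.eventually_ne_atTop 0] with n hn
  rw [Function.comp_apply, inv_mul_cancel_left₀ hn]

/-- The forest's variance is at most `ζ_{k,k}`, so the rate is at least of order `√n`; `max C 1`
keeps the denominator positive. -/
lemma IsForestRegime.tendsto_rate (hT : IsForestRegime D T) (hZ : IsIID P D Z)
    (hC : ∃ C : ℝ, ∀ n, zeta D (T n) (k n) ≤ C) :
    Tendsto (fun n : ℕ => √(n : ℝ) / √Var[fun ω => forest (T n) (sample Z n ω); P])
      atTop atTop := by
  obtain ⟨C, hC⟩ := hC
  have h1 : Tendsto (fun n : ℕ => √(n : ℝ) / √(max C 1)) atTop atTop :=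
    (Real.tendsto_sqrt_atTop.comp tendsto_natCast_atTop_atTop).atTop_div_const (by positivity)
  refine tendsto_atTop_mono' _ ?_ h1
  filter_upwards [hT.eventually_le, hT.le_variance hZ] with n hn hv
  have h2 := (hT.kernel n).variance_forest_le hZ hn.2.1
  have h3 : 0 < √Var[fun ω => forest (T n) (sample Z n ω); P] := Real.sqrt_pos.2 hv.1
  exact div_le_div_of_nonneg_left (Real.sqrt_nonneg _) h3
    (Real.sqrt_le_sqrt (h2.trans ((hC n).trans (le_max_left _ _))))

/-- The scaled IJ covariance estimate. -/
lemma IsForestRegime.tendsto_rate_mul_estimate (hT : IsForestRegime D T) (hZ : IsIID P D Z)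
    {ψ : S → ℝ} (hψ : MemLp ψ 2 D) (hψ0 : ∫ z, ψ z ∂D = 0)
    {u : (x : ℕ × Ω) → Fin x.1 → ℝ}
    (hu : Tendsto (fun x : ℕ × Ω => (x.1 : ℝ)⁻¹ * ∑ i : Fin x.1, (u x i - ψ (Z i x.2)) ^ 2)
      (probFilter P) (𝓝 0)) :
    Tendsto (fun x : ℕ × Ω => √(x.1 : ℝ) / √Var[fun ω => forest (T x.1) (sample Z x.1 ω); P]
        * (1 / (x.1 : ℝ) ^ 2 * ∑ i : Fin x.1, u x i * forestDirDeriv (T x.1) (sample Z x.1 x.2) i)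
      - projRatio P D Z T x.1 * ∫ z, ψ z * stdProj D T x.1 z ∂D) (probFilter P) (𝓝 0) := by
  have h := hT.tendsto_mean_mul_dirDeriv hZ hψ hψ0 hu
  have h1 : Tendsto (fun x : ℕ × Ω => projRatio P D Z T x.1 *
      ((x.1 : ℝ)⁻¹ * ∑ i : Fin x.1, u x i * stdDirDeriv D Z T x i
      - ∫ z, ψ z * stdProj D T x.1 z ∂D)) (probFilter P) (𝓝 0) := by
    refine squeeze_zero_norm (fun x => ?_) (tendsto_zero_iff_norm_tendsto_zero.1 h)
    rw [norm_mul, Real.norm_of_nonneg (projRatio_nonneg _)]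
    exact mul_le_of_le_one_left (norm_nonneg _) (min_le_left _ _)
  refine h1.congr' ?_
  filter_upwards [tendsto_fst_probFilter.eventually (hT.le_variance hZ),
    tendsto_fst_probFilter.eventually hT.zeta_pos,
    tendsto_fst_probFilter.eventually (eventually_ge_atTop 1)] with x hσ hz hn
  rw [mul_sub, hσ.2]
  congr 1
  have hn0 : (0 : ℝ) < x.1 := by exact_mod_cast hn
  have hk : (0 : ℝ) < k x.1 := by exact_mod_cast hT.one_le x.1
  have hs : 0 < √(zeta D (T x.1) 1) := Real.sqrt_pos.2 hz
  have hσ0 := Real.sqrt_pos.2 hσ.1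
  -- What remains is the scaling identity `(√n/σ) n⁻² = projRatio · n⁻¹ / (k √ζ_{1,k})`.
  simp only [stdDirDeriv, ← mul_div_assoc, ← Finset.sum_div]
  generalize ∑ i : Fin x.1, u x i * forestDirDeriv (T x.1) (sample Z x.1 x.2) i = A
  generalize √Var[fun ω => forest (T x.1) (sample Z x.1 ω); P] = σ at hσ0 ⊢
  obtain ⟨s, hs0, hse⟩ : ∃ s : ℝ, 0 < s ∧ (x.1 : ℝ) = s ^ 2 :=
    ⟨√(x.1 : ℝ), Real.sqrt_pos.2 hn0, (Real.sq_sqrt hn0.le).symm⟩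
  rw [hse, Real.sqrt_sq hs0.le]
  field_simp

end

end IJack

end

/-! ### The main theorem. -/

theorem mainTheorem1
    {Ω S X : Type*} [MeasurableSpace Ω] [MeasurableSpace S]
    -- i.i.d. data `Z 0, Z 1, …` with law `D`
    (P : Measure Ω) [IsProbabilityMeasure P] (D : Measure S) [IsProbabilityMeasure D]
    (Z : ℕ → Ω → S) (hZmeas : ∀ i, Measurable (Z i)) (hZindep : iIndepFun Z P)
    (hZlaw : ∀ i, P.map (Z i) = D)
    -- the M-estimator
    {p : ℕ} (Θ : Set (EuclideanSpace ℝ (Fin p))) (θ₀ : EuclideanSpace ℝ (Fin p))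
    (hθ₀ : θ₀ ∈ interior Θ)
    (m : EuclideanSpace ℝ (Fin p) → S → ℝ)
    (hm_meas : ∀ θ ∈ Θ, Measurable (m θ))
    (hm_int : ∀ θ ∈ Θ, Integrable (m θ) D)
    (hm_C2 : ∀ z, ContDiffOn ℝ 2 (fun θ => m θ z) (interior Θ))
    (hgrad : MemLp (IJack.grad m θ₀) 2 D)
    (henv : ∃ h : S → ℝ, Integrable h D ∧ ∃ U ∈ 𝓝 θ₀, ∀ᵐ z ∂D, ∀ θ ∈ U,
      ‖IJack.hess m θ z‖ ≤ h z)
    (hhess : (∫ z, IJack.hess m θ₀ z ∂D).IsInvertible)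
    (hsep : ∀ ε : ℝ, 0 < ε → ∃ δ : ℝ, 0 < δ ∧ ∀ θ ∈ Θ, ε ≤ ‖θ - θ₀‖ →
      (∫ z, m θ z ∂D) ≤ (∫ z, m θ₀ z ∂D) - δ)
    (hulln : ∀ ε : ℝ, 0 < ε → Tendsto (fun n : ℕ => P {ω | ∃ θ ∈ Θ,
      ε ≤ |IJack.empMean (IJack.sample Z n ω) (m θ) - (∫ z, m θ z ∂D)|}) atTop (𝓝 0))
    (θhat : (n : ℕ) → (Fin n → S) → EuclideanSpace ℝ (Fin p))
    (hargmax : ∀ n, 1 ≤ n → ∀ᵐ ω ∂P, θhat n (IJack.sample Z n ω) ∈ Θ ∧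
      IsMaxOn (fun θ => IJack.empMean (IJack.sample Z n ω) (m θ)) Θ
        (θhat n (IJack.sample Z n ω)))
    -- its prediction at `x₁`
    (η : EuclideanSpace ℝ (Fin p) → X → ℝ) (x₁ : X)
    (hη_C1 : ContDiffOn ℝ 1 (fun θ => η θ x₁) (interior Θ))
    (hη_UI : ∃ N : ℕ, UniformIntegrable (fun (n : ℕ) ω =>
      √((n + N : ℕ) : ℝ) * (η (θhat (n + N) (IJack.sample Z (n + N) ω)) x₁ - η θ₀ x₁)) 2 P)
    -- the forest at `x₂`, from trees on subsamples of size `k n`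
    (T : (k : ℕ) → X → (Fin k → S) → ℝ) (x₂ : X) (k : ℕ → ℕ) (hk : ∀ n, 1 ≤ k n)
    (hT_meas : ∀ n, Measurable (T (k n) x₂))
    (hT_symm : ∀ n, ∀ (σ : Equiv.Perm (Fin (k n))) (w : Fin (k n) → S),
      T (k n) x₂ (fun j => w (σ j)) = T (k n) x₂ w)
    (hT_L2 : ∀ n, MemLp (T (k n) x₂) 2 (Measure.pi fun _ : Fin (k n) => D))
    (hzeta :
      (Tendsto (fun n : ℕ => (k n : ℝ) / n) atTop (𝓝 0) ∧
        ∃ L : ℝ, L ≠ 0 ∧ Tendsto (fun n : ℕ =>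
          k n * IJack.zeta D (T (k n) x₂) 1 / IJack.zeta D (T (k n) x₂) (k n)) atTop (𝓝 L)) ∨
      ((∀ᶠ n : ℕ in atTop, IJack.zeta D (T (k n) x₂) 1 ≠ 0) ∧
        Tendsto (fun n : ℕ => (k n : ℝ) / n *
          (IJack.zeta D (T (k n) x₂) (k n) / (k n * IJack.zeta D (T (k n) x₂) 1)))
          atTop (𝓝 0))) :
    let pred : ℕ → Ω → ℝ := fun n ω => η (θhat n (IJack.sample Z n ω)) x₁
    let Fhat : ℕ → Ω → ℝ := fun n ω => IJack.forest (T (k n) x₂) (IJack.sample Z n ω)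
    let Fproj : ℕ → Ω → ℝ := fun n ω => IJack.hajekForest D (T (k n) x₂) (IJack.sample Z n ω)
    let est : ℕ → Ω → ℝ := fun n ω => IJack.ijCov m η x₁ (T (k n) x₂) (IJack.sample Z n ω)
      (θhat n (IJack.sample Z n ω))
    let rate : ℕ → ℝ := fun n => √(n : ℝ) / √(Var[Fhat n; P])
    -- consistency on the scale of the standardised predictions
    TendstoInMeasure P (fun n ω => rate n * (est n ω - cov[pred n, Fhat n; P])) atTop
      (fun _ => 0) ∧
    TendstoInMeasure P (fun n ω => rate n * (est n ω - cov[pred n, Fproj n; P])) atTop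
      (fun _ => 0) ∧
    -- consistency without rescaling
    ((∃ C : ℝ, ∀ n, IJack.zeta D (T (k n) x₂) (k n) ≤ C) →
      TendstoInMeasure P (fun n ω => est n ω - cov[pred n, Fhat n; P]) atTop (fun _ => 0) ∧
      TendstoInMeasure P (fun n ω => est n ω - cov[pred n, Fproj n; P]) atTop (fun _ => 0)) ∧
    -- convergence of the expected estimates
    ((∃ N : ℕ, UniformIntegrable (fun (n : ℕ) ω => rate (n + N) * est (n + N) ω) 1 P) →
      Tendsto (fun n => rate n * ((∫ ω, est n ω ∂P) - cov[pred n, Fhat n; P])) atTop (𝓝 0) ∧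
      Tendsto (fun n => rate n * ((∫ ω, est n ω ∂P) - cov[pred n, Fproj n; P])) atTop (𝓝 0) ∧
      ((∃ C : ℝ, ∀ n, IJack.zeta D (T (k n) x₂) (k n) ≤ C) →
        Tendsto (fun n => (∫ ω, est n ω ∂P) - cov[pred n, Fhat n; P]) atTop (𝓝 0) ∧
        Tendsto (fun n => (∫ ω, est n ω ∂P) - cov[pred n, Fproj n; P]) atTop (𝓝 0))) := by
  obtain ⟨h, hh, hU⟩ := henv
  have hθΘ := interior_subset hθ₀
  have hZ : IJack.IsIID P D Z := ⟨hZmeas, hZindep, hZlaw⟩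
  have H : IJack.IsRegularCriterion D Θ θ₀ m h :=
    { mem_interior := hθ₀
      measurable := hm_meas
      integrable := hm_int
      contDiffOn := hm_C2
      memLp_grad := hgrad
      integrable_env := hh
      hess_le := hU
      isInvertible := hhess
      integral_le := fun θ hθ => by
        rcases eq_or_ne θ θ₀ with rfl | hne
        · exact le_rfl
        · obtain ⟨δ, hδ, hle⟩ := hsep ‖θ - θ₀‖ (norm_pos_iff.2 (sub_ne_zero.2 hne))
          linarith [hle θ hθ le_rfl] }
  have hT : IJack.IsForestRegime D fun n => T (k n) x₂ :=
    IJack.isForestRegime_of_zeta hZ (fun n => ⟨hT_meas n, hT_symm n, hT_L2 n⟩) hk hzeta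
  let th : ℕ × Ω → EuclideanSpace ℝ (Fin p) := fun x => θhat x.1 (IJack.sample Z x.1 x.2)
  have hmax : ∀ᶠ x in IJack.probFilter P, th x ∈ Θ ∧
      IsMaxOn (fun θ => IJack.empMean (IJack.sample Z x.1 x.2) (m θ)) Θ (th x) :=
    IJack.eventually_probFilter_of_ae ((eventually_ge_atTop 1).mono hargmax)
  have hth : Tendsto th (IJack.probFilter P) (𝓝 θ₀) :=
    IJack.tendsto_estimator hθΘ hsep hulln hmax
  -- A maximizer on the boundary need not annihilate the score; consistency rules this out with
  -- probability tending to one.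
  have hfoc : ∀ᶠ x in IJack.probFilter P,
      IJack.empMean (IJack.sample Z x.1 x.2) (IJack.grad m (th x)) = 0 := by
    filter_upwards [hmax, hth.eventually (isOpen_interior.mem_nhds hθ₀)] with x hx hxi
    exact H.score_eq_zero _ hxi hx.2
  have hη : DifferentiableAt ℝ (fun θ => η θ x₁) θ₀ :=
    (hη_C1.contDiffAt (isOpen_interior.mem_nhds hθ₀)).differentiableAt (by norm_num)
  let ψ : S → ℝ := IJack.influence D θ₀ m fun θ => η θ x₁
  have hψ : MemLp ψ 2 D := H.memLp_influence _
  have hψ0 : ∫ z, ψ z ∂D = 0 := H.integral_influence _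
  obtain ⟨N, hUI⟩ := hη_UI
  have hdelta := H.tendsto_delta hZ hth hfoc hη
  have hlin := hZ.tendsto_integral_linearization_sq
    (pred := fun n ω => η (θhat n (IJack.sample Z n ω)) x₁) (η₀ := η θ₀ x₁) hψ hψ0 hUI hdelta
  have hpred := IJack.eventually_memLp_of_uniformIntegrable
    (pred := fun n ω => η (θhat n (IJack.sample Z n ω)) x₁) (η₀ := η θ₀ x₁) hUI
  have hest := hT.tendsto_rate_mul_estimate hZ hψ hψ0
    (H.tendsto_mean_sq_dirDeriv hZ hth hfoc hη_C1)
  have hκ := hT.abs_projRatio_mul_le (P := P) hZ hψ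
  have hcF := hT.tendsto_rate_mul_covariance hZ hψ hpred hlin
    (fun n => (hT.kernel n).memLp_forest hZ n) (Eventually.of_forall fun n => le_rfl)
    (hT.eventually_le.mono fun n hn i => (hT.kernel n).covariance_forest_comp hZ hn.2.1 hψ i)
  have hcP := hT.tendsto_rate_mul_covariance hZ hψ hpred hlin
    (fun n => (hT.kernel n).memLp_hajekForest hZ n)
    (hT.eventually_le.mono fun n hn =>
      (hT.kernel n).variance_hajekForest_le hZ (hT.one_le n) hn.2.1)
    (Eventually.of_forall fun n i =>
      (hT.kernel n).covariance_hajekForest_comp hZ (hT.one_le n) hψ i)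
  intro pred Fhat Fproj est rate
  -- The common deterministic centre of the scaled estimate and of both scaled covariances.
  let κ : ℕ → ℝ := fun n => IJack.projRatio P D Z (fun n => T (k n) x₂) n
    * ∫ z, ψ z * IJack.stdProj D (fun n => T (k n) x₂) n z ∂D
  have hκ' : ∀ n, |κ n| ≤ ∫ z, ψ z ^ 2 ∂D + 1 := hκ
  have hest' : Tendsto (fun x : ℕ × Ω => rate x.1 * est x.1 x.2 - κ x.1)
      (IJack.probFilter P) (𝓝 0) := hest
  have hcF' : Tendsto (fun n => rate n * cov[pred n, Fhat n; P] - κ n) atTop (𝓝 0) := hcF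
  have hcP' : Tendsto (fun n => rate n * cov[pred n, Fproj n; P] - κ n) atTop (𝓝 0) := hcP
  have hF := IJack.consistency_of_scaled hκ' hest' hcF'
  have hP := IJack.consistency_of_scaled hκ' hest' hcP'
  exact ⟨hF.1, hP.1, fun hC => ⟨hF.2.1 (hT.tendsto_rate hZ hC), hP.2.1 (hT.tendsto_rate hZ hC)⟩,
    fun hI => ⟨(hF.2.2 hI).1, (hP.2.2 hI).1, fun hC =>
      ⟨(hF.2.2 hI).2 (hT.tendsto_rate hZ hC), (hP.2.2 hI).2 (hT.tendsto_rate hZ hC)⟩⟩⟩
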